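/- Let $n\ge 0$ be an integer and let $J$ be the block diagonal $2n\times 2n$ matrix with $n$ diagonal blocks $\begin{pmatrix}0&-1\\1&0\end{pmatrix}$. For $\mathbb K=\mathbb R$ (the space $O(2n,\mathbb C)/O(2n)$) or $\mathbb K=\mathbb C$ (the space $SO^*(4n)/U(2n)$), let $X_n(\mathbb K)$ be the set of $2n\times 2n$ matrices $R$ over $\mathbb K$ with $$J^{-1}R^tJ=R,\qquad R+R^*\gg 0$$ (that is, $R+R^*$ is positive definite). Write $R=T+S$ with $T=T^*$, $S=-S^*$, and let $[A]_{2j}$ be the left upper $2j\times 2j$ block of $A$. For a complex matrix $A$ with eigenvalues $\mu_i$ (counted with algebraic multiplicity) in the right half-plane, put $\det A^{s}:=\exp(s\sum_i\ln\mu_i)$ and $\det A^{\{s\|t\}}:=\exp(s\sum_i\ln\mu_i+t\,\overline{\sum_i\ln\mu_i})$, with the principal logarithm; real matrices are regarded as complex ones. The measure $dT\,dS$ is the Lebesgue measure in the independent entries. For $\mathbb K=\mathbb R$ the $2\times2$ diagonal blocks of $T$ are $t_a\cdot 1$, its blocks above the diagonal are $\begin{pmatrix}\alpha&\beta\\-\beta&\alpha\end{pmatrix}$,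 the diagonal blocks of $S$ are $0$, its blocks above the diagonal are $\begin{pmatrix}\beta'&\alpha'\\\alpha'&-\beta'\end{pmatrix}$, and $dT\,dS$ is the product of all $dt_a$ and all $d\alpha\,d\beta\,d\alpha'\,d\beta'$ (all parameters real). For $\mathbb K=\mathbb C$ the diagonal blocks of $T$ are $t_a\cdot 1$ with $t_a\in\mathbb R$, its blocks above the diagonal are $\begin{pmatrix}\alpha&\beta\\-\overline\beta&\overline\alpha\end{pmatrix}$ with $\alpha,\beta\in\mathbb C$, $S=iS'$ with $S'$ of the same form as $T$, and $dT\,dS$ is the product of the Lebesgue measures in all these parameters of $T$ and of $S'$. Let $\lambda_j,\sigma_j,\tau_j\in\mathbb C$ ($1\le j\le n$) and $\lambda_{n+1}=\sigma_{n+1}=\tau_{n+1}=0$. (a) If $\operatorname{Re}(\lambda_k-(n+k)+2)>0$ and $\operatorname{Re}(\sigma_k-\lambda_k-(n-k))>0$ for $k=1,\dots,n$, then the following integral converges absolutely and $$\int_{X_n(\mathbb R)}\prod_{j=1}^n\frac{\det[T]_{2j}^{(\lambda_j-\lambda_{j+1})/2}}{\det[1+T+S]_{2j}^{(\sigma_j-\sigma_{j+1})/2}}\;\det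 T^{-(2n-1)/2}\,dT\,dS=\prod_{k=1}^n\pi^{2k-2}\,\frac{\Gamma(\lambda_k-(n+k)+2)\,\Gamma(\sigma_k-\lambda_k-(n-k))}{\Gamma(\sigma_k-2(n-k))}.$$ (b) If $\operatorname{Re}(\lambda_k-2(n+k)+3)>0$ and $\operatorname{Re}(\sigma_k+\tau_k-\lambda_k-2(n-k))>0$ for $k=1,\dots,n$, then the following integral converges absolutely and $$\int_{X_n(\mathbb C)}\prod_{j=1}^n\frac{\det[T]_{2j}^{(\lambda_j-\lambda_{j+1})/2}}{\det[1+T+S]_{2j}^{\{(\sigma_j-\sigma_{j+1})/2\,\|\,(\tau_j-\tau_{j+1})/2\}}}\;\det T^{-(2n-1)}\,dT\,dS$$ $$=\prod_{k=1}^n2^{2+4(n-k)-\sigma_k-\tau_k}\,\pi^{4k-3}\,\frac{\Gamma(\lambda_k-2(n+k)+3)\,\Gamma(\sigma_k+\tau_k-\lambda_k-2(n-k))}{\Gamma(\sigma_k-2(n-k))\,\Gamma(\tau_k-2(n-k))},$$ where $1/\Gamma$ is $0$ at the poles of $\Gamma$. -/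

import Mathlib

open scoped Matrix Kronecker BigOperators ComplexOrder

noncomputable section

/-- Row and column indices of `2n × 2n` matrices, written in `2 × 2` blocks: the pair `(a, e)`
stands for the index `2a + e` (`a = 0, …, n - 1`, `e = 0, 1`). -/
abbrev BlockIdx (n : ℕ) : Type := Fin n × Fin 2

/-- The block diagonal `2n × 2n` matrix with diagonal blocks `(0, -1; 1, 0)`. -/
def matJ (n : ℕ) (K : Type*) [RCLike K] : Matrix (BlockIdx n) (BlockIdx n) K :=
  (1 : Matrix (Fin n) (Fin n) K) ⊗ₖ !![0, -1; 1, 0]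

/-- The `2n × 2n` matrices `R` over `K` with `J⁻¹ Rᵗ J = R` and `R + R* ≫ 0`. For `K = ℝ` this is
the model of `O(2n,ℂ)/O(2n)`, for `K = ℂ` that of `SO*(4n)/U(2n)`. -/
def wedge (n : ℕ) (K : Type*) [RCLike K] : Set (Matrix (BlockIdx n) (BlockIdx n) K) :=
  {R | (matJ n K)⁻¹ * Rᵀ * matJ n K = R ∧ (R + Rᴴ).PosDef}

/-- `[A]_{2j}`, the left upper block of size `2j` (for `j ≤ n`). -/
def leadBlock {n : ℕ} {K : Type*} (j : ℕ) (A : Matrix (BlockIdx n) (BlockIdx n) K) :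
    Matrix {p : BlockIdx n // p.1.val < j} {p : BlockIdx n // p.1.val < j} K :=
  A.toSquareBlockProp fun p => p.1.val < j

/-- The sum of the principal logarithms of the eigenvalues, with algebraic multiplicity. -/
def logDet {m : Type*} [Fintype m] [DecidableEq m] (A : Matrix m m ℂ) : ℂ :=
  (A.charpoly.roots.map Complex.log).sum

/-- `det A ^ s = exp (s ∑ log λ_j)`, the sum over the eigenvalues `λ_j` of `A`. -/
def detPow {m : Type*} [Fintype m] [DecidableEq m] (A : Matrix m m ℂ) (s : ℂ) : ℂ :=
  Complex.exp (s * logDet A)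

/-- `det A ^ {s‖t} = (det A) ^ s (conj (det A)) ^ t`, with the branches fixed by `detPow`. -/
def detPowPair {m : Type*} [Fintype m] [DecidableEq m] (A : Matrix m m ℂ) (s t : ℂ) : ℂ :=
  Complex.exp (s * logDet A + t * (starRingEnd ℂ) (logDet A))

/-- A real matrix, viewed as a complex one. -/
def toC {m : Type*} (A : Matrix m m ℝ) : Matrix m m ℂ := A.map Complex.ofReal

/-- Positions of the `2 × 2` blocks above the diagonal. -/
abbrev UpperIdx (n : ℕ) : Type := {p : Fin n × Fin n // p.1 < p.2}

/-- The `2n × 2n` matrix with diagonal blocks `d a`, blocks `u (a, b)` at the positions `(a, b)`,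
`a < b`, and blocks `c • (u (a, b))*` at the positions `(b, a)`, `a < b`. -/
def fillBlocks {n : ℕ} {K : Type*} [RCLike K] (c : K) (d : Fin n → Matrix (Fin 2) (Fin 2) K)
    (u : UpperIdx n → Matrix (Fin 2) (Fin 2) K) : Matrix (BlockIdx n) (BlockIdx n) K :=
  Matrix.of fun p q =>
    if h : p.1 < q.1 then u ⟨(p.1, q.1), h⟩ p.2 q.2
    else if h : q.1 < p.1 then c * star (u ⟨(q.1, p.1), h⟩ q.2 p.2)
    else d p.1 p.2 q.2

/-- Coordinates on the real matrices `T` (first factor) and `S` (second factor): the diagonal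
entries of `T`, and for each block above the diagonal the two independent entries of the block of
`T`, combined into one complex number, and the two independent entries of the block of `S`. -/
abbrev RealCoord (n : ℕ) : Type :=
  ((Fin n → ℝ) × (UpperIdx n → ℂ)) × (UpperIdx n → ℂ)

/-- The symmetric matrix `T`, with blocks `(α, β; -β, α)`. -/
def realT {n : ℕ} (x : RealCoord n) : Matrix (BlockIdx n) (BlockIdx n) ℝ :=
  fillBlocks 1 (fun a => x.1.1 a • (1 : Matrix (Fin 2) (Fin 2) ℝ))
    (fun p => !![(x.1.2 p).re, (x.1.2 p).im; -(x.1.2 p).im, (x.1.2 p).re])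

/-- The antisymmetric matrix `S`, with blocks `(β, α; α, -β)`. -/
def realS {n : ℕ} (x : RealCoord n) : Matrix (BlockIdx n) (BlockIdx n) ℝ :=
  fillBlocks (-1) (fun _ => 0)
    (fun p => !![(x.2 p).im, (x.2 p).re; (x.2 p).re, -(x.2 p).im])

/-- Coordinates on the space of complex matrices `T` (or `S`): one real number for each diagonal
block, and the two independent complex entries of each block above the diagonal. -/
abbrev QuatCoord (n : ℕ) : Type := (Fin n → ℝ) × (UpperIdx n → ℂ × ℂ)

/-- The hermitian matrix with diagonal blocks `y.1 a • 1` and with blocks `(α, β; -β̄, ᾱ)` above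
the diagonal. -/
def quatHerm {n : ℕ} (y : QuatCoord n) : Matrix (BlockIdx n) (BlockIdx n) ℂ :=
  fillBlocks 1 (fun a => (y.1 a : ℂ) • (1 : Matrix (Fin 2) (Fin 2) ℂ))
    (fun p => !![(y.2 p).1, (y.2 p).2; -star (y.2 p).2, star (y.2 p).1])

/-- The coordinates of the pair `(T, S)` in the complex case. -/
abbrev CplxCoord (n : ℕ) : Type := QuatCoord n × QuatCoord n

/-- The hermitian matrix `T`. -/
def cplxT {n : ℕ} (x : CplxCoord n) : Matrix (BlockIdx n) (BlockIdx n) ℂ := quatHerm x.1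

/-- The anti-hermitian matrix `S`. -/
def cplxS {n : ℕ} (x : CplxCoord n) : Matrix (BlockIdx n) (BlockIdx n) ℂ :=
  Complex.I • quatHerm x.2

/-! ### The coordinates parametrise exactly the two spaces -/

theorem symm_iff {n : ℕ} {K : Type*} [RCLike K] (R : Matrix (BlockIdx n) (BlockIdx n) K) :
    (matJ n K)⁻¹ * Rᵀ * matJ n K = R ↔
      ∀ a b, R (b, 0) (a, 0) = R (a, 1) (b, 1) ∧ R (b, 0) (a, 1) = -R (a, 0) (b, 1) ∧
        R (b, 1) (a, 0) = -R (a, 1) (b, 0) := by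
  have hJJ : matJ n K * matJ n K = -1 := by
    have h2 : (!![0, -1; 1, 0] : Matrix (Fin 2) (Fin 2) K) * !![0, -1; 1, 0] = (-1 : K) • 1 := by
      ext i j; fin_cases i <;> fin_cases j <;> simp
    rw [matJ, ← Matrix.mul_kronecker_mul, h2, Matrix.kronecker_smul]
    simp
  have hinv : (matJ n K)⁻¹ = -matJ n K := by
    apply Matrix.inv_eq_left_inv
    rw [neg_mul, hJJ, neg_neg]
  have key : ∀ a b e f, ((matJ n K)⁻¹ * Rᵀ * matJ n K) (b, e) (a, f) =
      !![R (a, 1) (b, 1), -R (a, 0) (b, 1); -R (a, 1) (b, 0), R (a, 0) (b, 0)] e f := by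
    intro a b e f
    rw [hinv]
    fin_cases e <;> fin_cases f <;>
      simp [Matrix.mul_apply, Fintype.sum_prod_type, matJ, Matrix.one_apply, Fin.sum_univ_two]
  constructor
  · intro h a b
    refine ⟨?_, ?_, ?_⟩
    · have := key a b 0 0; rw [h] at this; simpa using this
    · have := key a b 0 1; rw [h] at this; simpa using this
    · have := key a b 1 0; rw [h] at this; simpa using this
  · intro h
    ext ⟨b, e⟩ ⟨a, f⟩
    rw [key]
    obtain ⟨h1, h2, h3⟩ := h a b
    have h4 := (h b a).1
    fin_cases e <;> fin_cases f
    · simpa using h1.symm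
    · simpa using h2.symm
    · simpa using h3.symm
    · simpa using h4

theorem realT_isHermitian {n : ℕ} (x : RealCoord n) : (realT x)ᴴ = realT x := by
  ext ⟨a, e⟩ ⟨b, f⟩
  rcases lt_trichotomy a b with h | h | h
  · simp [realT, fillBlocks, h, h.not_gt]
  · subst h
    fin_cases e <;> fin_cases f <;> simp [realT, fillBlocks]
  · simp [realT, fillBlocks, h, h.not_gt]

theorem realS_antiHermitian {n : ℕ} (x : RealCoord n) : (realS x)ᴴ = -realS x := by
  ext ⟨a, e⟩ ⟨b, f⟩
  rcases lt_trichotomy a b with h | h | h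
  · simp [realS, fillBlocks, h, h.not_gt]
  · subst h
    simp [realS, fillBlocks]
  · simp [realS, fillBlocks, h, h.not_gt]

theorem cplxT_isHermitian {n : ℕ} (x : CplxCoord n) : (cplxT x)ᴴ = cplxT x := by
  ext ⟨a, e⟩ ⟨b, f⟩
  rcases lt_trichotomy a b with h | h | h
  · simp [cplxT, quatHerm, fillBlocks, h, h.not_gt]
  · subst h
    fin_cases e <;> fin_cases f <;> simp [cplxT, quatHerm, fillBlocks]
  · simp [cplxT, quatHerm, fillBlocks, h, h.not_gt]

theorem cplxS_antiHermitian {n : ℕ} (x : CplxCoord n) : (cplxS x)ᴴ = -cplxS x := by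
  have h : (quatHerm x.2)ᴴ = quatHerm x.2 := cplxT_isHermitian (x.2, x.2)
  rw [cplxS, Matrix.conjTranspose_smul, h]
  simp

/-- `x ↦ T + S` is a bijection onto the real matrices with `J⁻¹ Rᵗ J = R`. -/
theorem real_param {n : ℕ} :
    Function.Injective (fun x : RealCoord n => realT x + realS x) ∧
    Set.range (fun x : RealCoord n => realT x + realS x) =
      {R | (matJ n ℝ)⁻¹ * Rᵀ * matJ n ℝ = R} := by
  refine ⟨?_, Set.Subset.antisymm ?_ ?_⟩
  · intro x y hxy
    have H : ∀ p q, (realT x + realS x) p q = (realT y + realS y) p q := fun p q =>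
      congrFun (congrFun hxy p) q
    refine Prod.ext (Prod.ext ?_ ?_) ?_
    · ext a
      simpa [realT, realS, fillBlocks] using H (a, 0) (a, 0)
    all_goals
      ext ⟨⟨a, b⟩, h⟩
      have h' : a < b := h
      have h00 := H (a, 0) (b, 0)
      have h01 := H (a, 0) (b, 1)
      have h10 := H (a, 1) (b, 0)
      have h11 := H (a, 1) (b, 1)
      simp [realT, realS, fillBlocks, h'] at h00 h01 h10 h11
      apply Complex.ext <;> linarith
  · rintro _ ⟨x, rfl⟩
    refine (symm_iff _).2 fun a b => ?_
    rcases lt_trichotomy a b with h | h | h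
    · simp [realT, realS, fillBlocks, h, h.not_gt]; ring_nf; exact ⟨trivial, trivial⟩
    · subst h
      simp [realT, realS, fillBlocks]
    · simp [realT, realS, fillBlocks, h, h.not_gt]; ring_nf; exact ⟨trivial, trivial⟩
  · intro R hR
    have hR' := (symm_iff R).1 hR
    refine ⟨((fun a => R (a, 0) (a, 0), fun p =>
      ⟨(R (p.1.1, 0) (p.1.2, 0) + R (p.1.1, 1) (p.1.2, 1)) / 2,
        (R (p.1.1, 0) (p.1.2, 1) - R (p.1.1, 1) (p.1.2, 0)) / 2⟩), fun p =>
      ⟨(R (p.1.1, 0) (p.1.2, 1) + R (p.1.1, 1) (p.1.2, 0)) / 2,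
        (R (p.1.1, 0) (p.1.2, 0) - R (p.1.1, 1) (p.1.2, 1)) / 2⟩), ?_⟩
    ext ⟨a, e⟩ ⟨b, f⟩
    obtain ⟨h1, h2, h3⟩ := hR' a b
    obtain ⟨h4, h5, h6⟩ := hR' b a
    rcases lt_trichotomy a b with h | h | h
    · fin_cases e <;> fin_cases f <;> simp [realT, realS, fillBlocks, h] <;> ring
    · subst h
      fin_cases e <;> fin_cases f <;> simp [realT, realS, fillBlocks] <;> linarith
    · fin_cases e <;> fin_cases f <;> simp [realT, realS, fillBlocks, h, h.not_gt] <;> linarith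

set_option maxHeartbeats 1000000 in
/-- `x ↦ T + S` is a bijection onto the complex matrices with `J⁻¹ Rᵗ J = R`. -/
theorem cplx_param {n : ℕ} :
    Function.Injective (fun x : CplxCoord n => cplxT x + cplxS x) ∧
    Set.range (fun x : CplxCoord n => cplxT x + cplxS x) =
      {R | (matJ n ℂ)⁻¹ * Rᵀ * matJ n ℂ = R} := by
  refine ⟨?_, Set.Subset.antisymm ?_ ?_⟩
  · intro x y hxy
    have H : ∀ p q, (cplxT x + cplxS x) p q = (cplxT y + cplxS y) p q := fun p q =>
      congrFun (congrFun hxy p) q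
    have hd : ∀ a, x.1.1 a = y.1.1 a ∧ x.2.1 a = y.2.1 a := by
      intro a
      have h00 := H (a, 0) (a, 0)
      simp [cplxT, cplxS, quatHerm, fillBlocks, Complex.ext_iff] at h00
      exact h00
    have hu : ∀ p, x.1.2 p = y.1.2 p ∧ x.2.2 p = y.2.2 p := by
      rintro ⟨⟨a, b⟩, h⟩
      have h' : a < b := h
      have h00 := H (a, 0) (b, 0)
      have h01 := H (a, 0) (b, 1)
      have h10 := H (a, 1) (b, 0)
      have h11 := H (a, 1) (b, 1)
      simp [cplxT, cplxS, quatHerm, fillBlocks, h', Complex.ext_iff] at h00 h01 h10 h11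
      refine ⟨Prod.ext (Complex.ext ?_ ?_) (Complex.ext ?_ ?_),
        Prod.ext (Complex.ext ?_ ?_) (Complex.ext ?_ ?_)⟩ <;> linarith [h00.1, h00.2, h01.1,
          h01.2, h10.1, h10.2, h11.1, h11.2]
    exact Prod.ext (Prod.ext (funext fun a => (hd a).1) (funext fun p => (hu p).1))
      (Prod.ext (funext fun a => (hd a).2) (funext fun p => (hu p).2))
  · rintro _ ⟨x, rfl⟩
    refine (symm_iff _).2 fun a b => ?_
    rcases lt_trichotomy a b with h | h | h
    · simp [cplxT, cplxS, quatHerm, fillBlocks, h, h.not_gt]; ring_nf; exact ⟨trivial, trivial⟩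
    · subst h
      simp [cplxT, cplxS, quatHerm, fillBlocks]
    · simp [cplxT, cplxS, quatHerm, fillBlocks, h, h.not_gt]; ring_nf; exact ⟨trivial, trivial⟩
  · intro R hR
    have hR' := (symm_iff R).1 hR
    refine ⟨((fun a => (R (a, 0) (a, 0)).re, fun p =>
      ((R (p.1.1, 0) (p.1.2, 0) + star (R (p.1.1, 1) (p.1.2, 1))) / 2,
        (R (p.1.1, 0) (p.1.2, 1) - star (R (p.1.1, 1) (p.1.2, 0))) / 2)),
      (fun a => (R (a, 0) (a, 0)).im, fun p =>
      (-Complex.I * (R (p.1.1, 0) (p.1.2, 0) - star (R (p.1.1, 1) (p.1.2, 1))) / 2,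
        -Complex.I * (R (p.1.1, 0) (p.1.2, 1) + star (R (p.1.1, 1) (p.1.2, 0))) / 2))), ?_⟩
    ext ⟨a, e⟩ ⟨b, f⟩
    obtain ⟨h1, h2, h3⟩ := hR' a b
    obtain ⟨h4, h5, h6⟩ := hR' b a
    have hd1 : ∀ z w : ℂ, (z + star w) / 2 + Complex.I * (-Complex.I * (z - star w) / 2) = z := by
      intro z w; linear_combination (-(z - star w) / 2) * Complex.I_sq
    have hd2 : ∀ z w : ℂ, (z - star w) / 2 + Complex.I * (-Complex.I * (z + star w) / 2) = z := by
      intro z w; linear_combination (-(z + star w) / 2) * Complex.I_sq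
    have hd3 : ∀ z w : ℂ, star ((z + star w) / 2) +
        Complex.I * star (-Complex.I * (z - star w) / 2) = w := by
      intro z w
      apply Complex.ext <;> simp <;> ring
    have hd4 : ∀ z w : ℂ, -star ((z - star w) / 2) +
        Complex.I * -star (-Complex.I * (z + star w) / 2) = w := by
      intro z w
      apply Complex.ext <;> simp <;> ring
    have hd6 : ∀ z : ℂ, (z.re : ℂ) + Complex.I * (z.im : ℂ) = z := by
      intro z; rw [mul_comm]; exact Complex.re_add_im z
    rcases lt_trichotomy a b with h | h | h
    · simp only [cplxT, cplxS, quatHerm, fillBlocks, Matrix.add_apply, Matrix.smul_apply,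
        Matrix.of_apply, h, dif_pos, smul_eq_mul]
      fin_cases e <;> fin_cases f
      · exact hd1 _ _
      · exact hd2 _ _
      · exact hd4 _ _
      · exact hd3 _ _
    · subst h
      have e1 : R (a, 0) (a, 1) = 0 := by linear_combination h2 / 2
      have e2 : R (a, 1) (a, 0) = 0 := by linear_combination h3 / 2
      simp only [cplxT, cplxS, quatHerm, fillBlocks, Matrix.add_apply, Matrix.smul_apply,
        Matrix.of_apply, lt_irrefl, dif_neg, not_false_iff, smul_eq_mul]
      fin_cases e <;> fin_cases f
      · simpa using hd6 _
      · simpa using e1.symm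
      · simpa using e2.symm
      · simpa [← h1] using hd6 (R (a, 0) (a, 0))
    · simp only [cplxT, cplxS, quatHerm, fillBlocks, Matrix.add_apply, Matrix.smul_apply,
        Matrix.of_apply, h, h.not_gt, dif_pos, dif_neg, not_false_iff, smul_eq_mul, one_mul]
      fin_cases e <;> fin_cases f
      · refine Eq.trans ?_ h4.symm
        exact hd3 _ _
      · refine Eq.trans ?_ ((congrArg Neg.neg (hd2 (R (b, 0) (a, 1)) (R (b, 1) (a, 0)))).trans
          h5.symm)
        simp only [Fin.isValue, Fin.zero_eta, Fin.mk_one, Matrix.cons_val_zero,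
          Matrix.cons_val_one, Matrix.of_apply, star_neg, star_star]
        ring
      · refine Eq.trans ?_ ((congrArg Neg.neg (hd4 (R (b, 0) (a, 1)) (R (b, 1) (a, 0)))).trans
          h6.symm)
        simp only [Fin.isValue, Fin.zero_eta, Fin.mk_one, Matrix.cons_val_zero,
          Matrix.cons_val_one, Matrix.of_apply]
        ring
      · refine Eq.trans ?_ ((hd1 (R (b, 0) (a, 0)) (R (b, 1) (a, 1))).trans h1)
        simp

/-- The integrand in the real case, in the coordinates of `T` and `S`. -/
def realIntegrand (n : ℕ) (lam sig : ℕ → ℂ) (x : RealCoord n) : ℂ :=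
  (∏ j ∈ Finset.Icc 1 n,
    detPow (toC (leadBlock j (realT x))) ((lam j - lam (j + 1)) / 2) /
      detPow (toC (leadBlock j (1 + realT x + realS x))) ((sig j - sig (j + 1)) / 2)) *
    detPow (toC (realT x)) (-(2 * (n : ℂ) - 1) / 2)

/-- The integrand in the complex case, in the coordinates of `T` and `S`. -/
def cplxIntegrand (n : ℕ) (lam sig tau : ℕ → ℂ) (x : CplxCoord n) : ℂ :=
  (∏ j ∈ Finset.Icc 1 n,
    detPow (leadBlock j (cplxT x)) ((lam j - lam (j + 1)) / 2) /
      detPowPair (leadBlock j (1 + cplxT x + cplxS x))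
        ((sig j - sig (j + 1)) / 2) ((tau j - tau (j + 1)) / 2)) *
    detPow (cplxT x) (-(2 * (n : ℂ) - 1))

end

/-! The integrals are computed by induction on `n`: the last block row and column are integrated out
while the remaining matrices, again called `T` and `S`, stay fixed.

The symmetry `J⁻¹RᵗJ = R` passes to Schur complements, and a `2 × 2` matrix with this symmetry is a
multiple `c·1` of the identity (`schurCompl_eq_smul`). So splitting off the last block divides the
determinant by `c²` and, since all matrices involved are accretive, subtracts `2 log c` from the
logarithm (`logDet_succ`). The halves in the exponents thus become plain powers of scalars. Let `v`,
`w` be the first columns of the last block columns of `T`, `S`, and `t`, `is` the last diagonal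
entries (`s = 0` over `ℝ`). The scalars are `u = t - v*T⁻¹v` for `T` and `c = 1 + t + is -
(v-w)*(1+T+S)⁻¹(v+w)` for `1+T+S`.

Completing the square (`re_form_column`) gives `Re c = 1 + u + v*Av + y*My`, where `A = T⁻¹ -
(1+T)⁻¹`, `M` is the hermitian part of `(1+T+S)⁻¹` and `y = w - S(1+T)⁻¹v`. The change of variables
`(v,w,t) ↦ (v,y,u)` preserves Lebesgue measure. Writing the negative power of `Re c` as a Gamma
integral leaves two Gaussian integrals and one Gamma integral (`integralEq_quadratic_step`). Over
`ℂ` the variable `s` is integrated first by Cauchy's beta integral (`cauchy_beta`), which leaves `Re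
c` to the power `-(σ+τ-1)`.

The result depends on `T`, `S` only through `det A · det M = 1/(det T |det(1+T+S)|²)`. With `d =
dim_ℝ K` this is the factor `stepDet = (det T)^{d/2} |det(1+T+S)|^d`, which shifts the `λ_j` by `d`
and the `σ_j`, `τ_j` in a way that restores the same integral in rank `n` (`realIntegrand_succ`,
`cplxIntegrand_succ`). Divided by `stepDet`, the kernel in the last column has constant mass, so
Fubini (`IntegralEq.mul_kernel`) multiplies the previous value by a constant. Absolute convergence
comes along in the induction, because the norm of the kernel is, or is dominated by, a kernel with
real exponents. -/

open MeasureTheory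

/-! ### Integrability with a given value, and Fubini -/

/-- `f` is integrable with integral `c`. -/
def IntegralEq {α : Type*} [MeasurableSpace α] (f : α → ℂ) (μ : Measure α) (c : ℂ) : Prop :=
  Integrable f μ ∧ ∫ x, f x ∂μ = c

theorem IntegralEq.comp_measurePreserving {α β : Type*} [MeasurableSpace α] [MeasurableSpace β]
    {μ : Measure α} {ν : Measure β} {f : β → ℂ} {c : ℂ} (h : IntegralEq f ν c) {Φ : α → β}
    (hΦ : MeasurePreserving Φ μ ν) : IntegralEq (fun x => f (Φ x)) μ c := by
  obtain ⟨h1, h2⟩ := h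
  refine ⟨hΦ.integrable_comp_of_integrable h1, ?_⟩
  rw [← h2, ← hΦ.map_eq, integral_map hΦ.measurable.aemeasurable]
  rw [hΦ.map_eq]
  exact h1.aestronglyMeasurable

theorem IntegralEq.const_mul {α : Type*} [MeasurableSpace α] {μ : Measure α} {f : α → ℂ} {c : ℂ}
    (h : IntegralEq f μ c) (k : ℂ) : IntegralEq (fun x => k * f x) μ (k * c) :=
  ⟨h.1.const_mul k, by rw [integral_const_mul, h.2]⟩

theorem IntegralEq.mul_prod {α β : Type*} [MeasurableSpace α] [MeasurableSpace β]
    {μ : Measure α} {ν : Measure β} [SFinite μ] [SFinite ν] {f : α → ℂ} {g : β → ℂ} {c d : ℂ}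
    (hf : IntegralEq f μ c) (hg : IntegralEq g ν d) :
    IntegralEq (fun z : α × β => f z.1 * g z.2) (μ.prod ν) (c * d) :=
  ⟨hf.1.mul_prod hg.1, by rw [integral_prod_mul, hf.2, hg.2]⟩

/-- Fubini for a product of a function on the base with a kernel of constant mass. -/
theorem IntegralEq.mul_kernel {α β : Type*} [MeasurableSpace α] [MeasurableSpace β]
    {μ : Measure α} {ν : Measure β} [SFinite μ] [SFinite ν] {f : α → ℂ} {g : α → β → ℂ} {c d : ℂ}
    {B : ℝ} (hf : IntegralEq f μ c)
    (hg : Measurable (Function.uncurry g)) (hgd : ∀ x, f x ≠ 0 → IntegralEq (g x) ν d)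
    (hB : ∀ x, f x ≠ 0 → ∫ y, ‖g x y‖ ∂ν ≤ B) :
    IntegralEq (fun z : α × β => f z.1 * g z.1 z.2) (μ.prod ν) (c * d) := by
  have hm : AEStronglyMeasurable (fun z : α × β => f z.1 * g z.1 z.2) (μ.prod ν) :=
    (hf.1.aestronglyMeasurable.comp_fst).mul hg.aestronglyMeasurable
  have hi : Integrable (fun z : α × β => f z.1 * g z.1 z.2) (μ.prod ν) := by
    rw [integrable_prod_iff hm]
    constructor
    · refine Filter.Eventually.of_forall fun x => ?_
      by_cases hx : f x = 0
      · simp [hx]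
      · exact (hgd x hx).1.const_mul (f x)
    · refine Integrable.mono' (hf.1.norm.mul_const B) hm.norm.integral_prod_right'
        (Filter.Eventually.of_forall fun x => ?_)
      simp only [norm_mul]
      rw [integral_const_mul, Real.norm_of_nonneg (by positivity)]
      by_cases hx : f x = 0
      · simp [hx]
      · exact mul_le_mul_of_nonneg_left (hB x hx) (norm_nonneg _)
  refine ⟨hi, ?_⟩
  rw [integral_prod _ hi, ← hf.2, ← integral_mul_const]
  congr 1
  ext x
  simp only
  rw [integral_const_mul]
  by_cases hx : f x = 0
  · simp [hx]
  · rw [(hgd x hx).2]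

/-! ### Gamma integrals and Laplace transforms -/

theorem integralEq_cpow_mul_exp {a : ℂ} {r : ℝ} (ha : 0 < a.re) (hr : 0 < r) :
    IntegralEq (fun t : ℝ => (t : ℂ) ^ (a - 1) * Complex.exp (-(r * t)))
      (volume.restrict (Set.Ioi 0)) ((r : ℂ) ^ (-a) * Complex.Gamma a) := by
  have h : ∫ t : ℝ in Set.Ioi 0, (t : ℂ) ^ (a - 1) * Complex.exp (-(r * t)) =
      (r : ℂ) ^ (-a) * Complex.Gamma a := by
    rw [Complex.integral_cpow_mul_exp_neg_mul_Ioi ha hr, one_div, Complex.cpow_neg,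
      Complex.inv_cpow]
    rw [Complex.arg_ofReal_of_nonneg hr.le]
    exact Real.pi_ne_zero.symm
  refine ⟨?_, h⟩
  -- The integral of a non-integrable function is `0` by convention, while the value found is
  -- nonzero.
  by_contra hn
  rw [integral_undef hn] at h
  have h1 : (r : ℂ) ^ (-a) ≠ 0 := by
    rw [Complex.cpow_ne_zero_iff]; left; exact_mod_cast hr.ne'
  exact mul_ne_zero h1 (Complex.Gamma_ne_zero_of_re_pos ha) h.symm

theorem integrableOn_cpow_mul_exp {a r : ℂ} (ha : 0 < a.re) (hr : 0 < r.re) :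
    IntegrableOn (fun t : ℝ => (t : ℂ) ^ (a - 1) * Complex.exp (-(r * t))) (Set.Ioi 0) := by
  have h := (integralEq_cpow_mul_exp ha hr).1
  refine Integrable.mono h ?_ ?_
  · exact (by fun_prop : Measurable _).aestronglyMeasurable
  · refine Filter.Eventually.of_forall fun t => le_of_eq ?_
    simp [Complex.norm_exp]

/-- A Laplace transform that is a pure power `C s^(-a)` gives the Stieltjes-type transform. -/
theorem IntegralEq.of_laplace {Y : Type*} [MeasurableSpace Y] {μ : Measure Y} [SFinite μ]
    {h : Y → ℂ} {q : Y → ℝ} (hh : Measurable h) (hq : Measurable q) (hq0 : ∀ y, 0 ≤ q y)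
    {a ρ C : ℂ} {C' X : ℝ} (hρ0 : 0 < ρ.re) (hρ : a.re < ρ.re) (hX : 0 < X)
    (h1 : ∀ s : ℝ, 0 < s →
      IntegralEq (fun y => h y * Complex.exp (-(s * q y))) μ (C * (s : ℂ) ^ (-a)))
    (h2 : ∀ s : ℝ, 0 < s → ∫ y, ‖h y * Complex.exp (-(s * q y))‖ ∂μ = C' * s ^ (-a.re)) :
    IntegralEq (fun y => h y * ((X + q y : ℝ) : ℂ) ^ (-ρ)) μ
      (C * (X : ℂ) ^ (a - ρ) * (Complex.Gamma (ρ - a) / Complex.Gamma ρ)) := by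
  -- Fubini for `F`: integration over `s` first gives `Γ(ρ) (X + q)^(-ρ)`; integration over `Y`
  -- first leaves the Gamma integral of `s^(ρ-a-1) e^(-Xs)`.
  set F : ℝ × Y → ℂ := fun z => ((z.1 : ℂ) ^ (ρ - 1) * Complex.exp (-(X * z.1))) *
    (h z.2 * Complex.exp (-(z.1 * q z.2))) with hF
  have hFm : Measurable F := by fun_prop
  have hra : 0 < (ρ - a).re := by simpa using hρ
  have hG := integralEq_cpow_mul_exp hra hX
  have hpow : ∀ s : ℝ, 0 < s → (s : ℂ) ^ (ρ - 1) * (s : ℂ) ^ (-a) = (s : ℂ) ^ (ρ - a - 1) := by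
    intro s hs
    rw [← Complex.cpow_add _ _ (by exact_mod_cast hs.ne')]
    congr 1; ring
  have hFi : Integrable F ((volume.restrict (Set.Ioi 0)).prod μ) := by
    rw [integrable_prod_iff hFm.aestronglyMeasurable]
    constructor
    · filter_upwards [ae_restrict_mem measurableSet_Ioi] with s hs
      exact (h1 s hs).1.const_mul ((s : ℂ) ^ (ρ - 1) * Complex.exp (-(X * s)))
    -- `h2` is needed only here: it makes the iterated integral of `‖F‖` a constant times an
    -- absolutely convergent Gamma integral.
    · refine (hG.1.norm.const_mul C').congr ?_
      filter_upwards [ae_restrict_mem measurableSet_Ioi] with s hs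
      have hs' : 0 < s := hs
      simp only [hF]
      simp_rw [norm_mul (((s : ℝ) : ℂ) ^ (ρ - 1) * Complex.exp (-(X * s)))]
      rw [integral_const_mul, h2 s hs, ← hpow s hs, norm_mul, norm_mul, norm_mul,
        Complex.norm_cpow_eq_rpow_re_of_pos hs' (-a)]
      simp only [Complex.neg_re]
      ring
  have hval := integral_prod_symm F hFi
  rw [integral_prod F hFi] at hval
  have hL : ∫ s : ℝ in Set.Ioi 0, ∫ y, F (s, y) ∂μ =
      C * ((X : ℂ) ^ (a - ρ) * Complex.Gamma (ρ - a)) := by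
    rw [← neg_sub ρ a, ← hG.2, ← integral_const_mul]
    refine setIntegral_congr_fun measurableSet_Ioi fun s hs => ?_
    simp only [hF]
    rw [integral_const_mul, (h1 s hs).2, ← hpow s hs]
    ring
  have hinner : ∀ y, ∫ s : ℝ in Set.Ioi 0, F (s, y) =
      Complex.Gamma ρ * (h y * ((X + q y : ℝ) : ℂ) ^ (-ρ)) := by
    intro y
    have hXq : 0 < X + q y := by linarith [hq0 y]
    have := (integralEq_cpow_mul_exp hρ0 hXq).2
    rw [mul_left_comm, mul_comm (Complex.Gamma ρ), ← this, ← integral_const_mul]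
    congr 1
    ext s
    simp only [hF]
    rw [mul_mul_mul_comm, mul_comm (_ ^ _) (h y), mul_assoc, ← Complex.exp_add]
    congr 3
    push_cast; ring
  have hΓ := Complex.Gamma_ne_zero_of_re_pos hρ0
  constructor
  · have := hFi.integral_prod_right
    simp_rw [hinner] at this
    refine (this.const_mul (Complex.Gamma ρ)⁻¹).congr (Filter.Eventually.of_forall fun y => ?_)
    simp only
    rw [inv_mul_cancel_left₀ hΓ]
  · simp_rw [hinner] at hval
    rw [hL, integral_const_mul] at hval
    rw [← mul_right_inj' hΓ, ← hval]
    field_simp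

/-- Identity theorem: both sides are holomorphic in `r` on the right half-plane and agree on the
positive reals, which accumulate at `1`. -/
theorem laplace_cpow_eq {a r : ℂ} (ha : 0 < a.re) (hr : 0 < r.re) :
    ∫ t : ℝ in Set.Ioi 0, (t : ℂ) ^ (a - 1) * Complex.exp (-(r * t)) =
      r ^ (-a) * Complex.Gamma a := by
  set U : Set ℂ := {z | 0 < z.re} with hU
  have hUo : IsOpen U := isOpen_lt continuous_const Complex.continuous_re
  have hUc : IsPreconnected U := (convex_halfSpace_re_gt 0).isPreconnected
  have hf : DifferentiableOn ℂ
      (fun r : ℂ => ∫ t : ℝ in Set.Ioi 0, (t : ℂ) ^ (a - 1) * Complex.exp (-(r * t))) U := by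
    intro r hr
    have hr' : 0 < r.re := hr
    have ha1 : 0 < (a + 1).re := by simp; linarith
    have hr2 : 0 < ((r.re / 2 : ℝ) : ℂ).re := by simp; linarith
    refine (DifferentiableAt.differentiableWithinAt ?_)
    refine (hasDerivAt_integral_of_dominated_loc_of_deriv_le (𝕜 := ℂ)
      (F := fun (r : ℂ) (t : ℝ) => (t : ℂ) ^ (a - 1) * Complex.exp (-(r * t)))
      (F' := fun (r : ℂ) (t : ℝ) => (t : ℂ) ^ (a - 1) * (Complex.exp (-(r * t)) * -t))
      -- Differentiation in `r` brings down a factor `t`, which raises `a` to `a + 1`; the rate `Re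
      -- r / 2` serves a whole neighbourhood of `r`.
      (bound := fun t : ℝ =>
        ‖(t : ℂ) ^ (a + 1 - 1) * Complex.exp (-(((r.re / 2 : ℝ) : ℂ) * t))‖)
      (s := {z : ℂ | r.re / 2 < z.re}) ?_ ?_ ?_ ?_ ?_ ?_ ?_).2.differentiableAt
    · exact (isOpen_lt continuous_const Complex.continuous_re).mem_nhds (by simp; linarith)
    · exact Filter.Eventually.of_forall fun z => (by fun_prop : Measurable _).aestronglyMeasurable
    · exact integrableOn_cpow_mul_exp ha hr'
    · exact (by fun_prop : Measurable _).aestronglyMeasurable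
    · filter_upwards [ae_restrict_mem measurableSet_Ioi] with t ht z hz
      have ht' : 0 < t := ht
      have hz' : r.re / 2 < z.re := hz
      have e : (t : ℂ) ^ (a + 1 - 1) = (t : ℂ) ^ (a - 1) * t := by
        rw [add_sub_right_comm, Complex.cpow_add _ _ (by exact_mod_cast ht'.ne'),
          Complex.cpow_one]
      rw [e]
      simp only [norm_mul, norm_neg, Complex.norm_exp, mul_assoc]
      refine mul_le_mul_of_nonneg_left ?_ (norm_nonneg _)
      rw [mul_comm]
      refine mul_le_mul_of_nonneg_left (Real.exp_le_exp.2 ?_) (norm_nonneg _)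
      simp
      nlinarith
    · exact (integrableOn_cpow_mul_exp ha1 hr2).norm
    · refine Filter.Eventually.of_forall fun t z _ => ?_
      have h1 : HasDerivAt (fun z : ℂ => -(z * t)) (-(t : ℂ)) z :=
        ((hasDerivAt_id z).mul_const (t : ℂ)).neg.congr_deriv (by simp)
      exact (h1.cexp).const_mul _
  have hg : DifferentiableOn ℂ (fun r : ℂ => r ^ (-a) * Complex.Gamma a) U := by
    intro r hr
    have hr' : r ∈ Complex.slitPlane := Or.inl hr
    exact (((hasDerivAt_id r).cpow_const hr').mul_const _).differentiableAt.differentiableWithinAt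
  refine (hf.analyticOnNhd hUo).eqOn_of_preconnected_of_frequently_eq (hg.analyticOnNhd hUo)
    hUc (z₀ := 1) (by simp [hU]) ?_ hr
  have ht : Filter.Tendsto (fun x : ℝ => (x : ℂ)) (nhdsWithin 1 {1}ᶜ)
      (nhdsWithin 1 {1}ᶜ) := by
    refine tendsto_nhdsWithin_iff.2 ⟨?_, ?_⟩
    · exact (Complex.continuous_ofReal.tendsto' 1 1 (by simp)).mono_left nhdsWithin_le_nhds
    · filter_upwards [self_mem_nhdsWithin] with x hx
      simpa using hx
  refine ht.frequently (Filter.Eventually.frequently ?_)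
  have : ∀ᶠ x : ℝ in nhdsWithin 1 {1}ᶜ, 0 < x :=
    nhdsWithin_le_nhds (lt_mem_nhds (by norm_num))
  filter_upwards [this] with x hx
  exact (integralEq_cpow_mul_exp ha hx).2

/-! ### Cauchy's beta integral -/

/-- `z ^ (-σ) * (conj z) ^ (-τ)`. -/
noncomputable def cpowPair (σ τ z : ℂ) : ℂ := z ^ (-σ) * (starRingEnd ℂ z) ^ (-τ)

theorem measurable_cpowPair (σ τ : ℂ) : Measurable (cpowPair σ τ) := by
  unfold cpowPair
  have : Measurable (fun z : ℂ => (starRingEnd ℂ) z) := Complex.continuous_conj.measurable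
  fun_prop

/-- Imaginary parts of the exponents contribute only factors `exp (± arg · Im)`, and `|arg| ≤ π`. -/
theorem norm_cpowPair_le {σ τ z : ℂ} (hz : 0 < z.re) :
    ‖cpowPair σ τ z‖ ≤
      Real.exp (Real.pi * (|σ.im| + |τ.im|)) * ‖z‖ ^ (-(σ + τ).re) := by
  have hz0 : z ≠ 0 := by rintro rfl; simp at hz
  have hn : 0 < ‖z‖ := norm_pos_iff.2 hz0
  have hc : (starRingEnd ℂ) z ≠ 0 := by simpa using hz0
  rw [cpowPair, norm_mul, Complex.norm_cpow_of_ne_zero hz0, Complex.norm_cpow_of_ne_zero hc,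
    Complex.norm_conj, div_mul_div_comm, ← Real.rpow_add hn, ← Real.exp_add, div_eq_mul_inv,
    ← Real.exp_neg, mul_comm]
  have hle : ∀ w v : ℂ, |w.arg * v.im| ≤ Real.pi * |v.im| := fun w v => by
    rw [abs_mul]
    exact mul_le_mul_of_nonneg_right (Complex.abs_arg_le_pi w) (abs_nonneg _)
  have h1 := (abs_le.1 (hle z (-σ))).1
  have h2 := (abs_le.1 (hle ((starRingEnd ℂ) z) (-τ))).1
  simp only [Complex.neg_im, abs_neg, Complex.add_re, Complex.neg_re] at *
  rw [neg_add σ.re]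
  refine mul_le_mul_of_nonneg_right (Real.exp_le_exp.2 ?_) (by positivity)
  linarith

/-- For equal real exponents the phases of the two powers cancel. So a pure power of `‖z‖` is itself
a Cauchy integrand, and its integral is known exactly. -/
theorem cpowPair_ofReal {ρ : ℝ} {z : ℂ} (hz : 0 < z.re) :
    cpowPair ((ρ / 2 : ℝ) : ℂ) ((ρ / 2 : ℝ) : ℂ) z = ((‖z‖ ^ (-ρ) : ℝ) : ℂ) := by
  have hz0 : z ≠ 0 := by rintro rfl; simp at hz
  have hn : 0 < ‖z‖ := norm_pos_iff.2 hz0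
  have ha : z.arg ≠ Real.pi := by
    intro h
    have := Complex.abs_arg_lt_pi_div_two_iff.2 (Or.inl hz)
    rw [h, abs_of_pos Real.pi_pos] at this
    linarith [Real.pi_pos]
  have hc : (starRingEnd ℂ) z ^ (-((ρ / 2 : ℝ) : ℂ)) =
      (starRingEnd ℂ) (z ^ (-((ρ / 2 : ℝ) : ℂ))) := by
    rw [Complex.conj_cpow _ _ ha, map_neg, Complex.conj_ofReal]
  rw [cpowPair, hc, Complex.mul_conj, Complex.normSq_eq_norm_sq,
    Complex.norm_cpow_of_ne_zero hz0]
  simp only [Complex.neg_re, Complex.ofReal_re, Complex.neg_im, Complex.ofReal_im, neg_zero,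
    mul_zero, Real.exp_zero, div_one]
  rw [← Real.rpow_natCast, ← Real.rpow_mul hn.le]
  congr 2
  push_cast; ring

theorem integrable_norm_add_mul_I {a ρ : ℝ} (ha : 0 < a) (hρ : 1 < ρ) :
    Integrable (fun s : ℝ => ‖(a : ℂ) + s * Complex.I‖ ^ (-ρ)) := by
  have h := ((integrable_rpow_neg_one_add_norm_sq (E := ℝ) (μ := volume) (r := ρ)
    (by simpa using hρ)).comp_div ha.ne').const_mul (a ^ (-ρ))
  refine h.congr (Filter.Eventually.of_forall fun s => ?_)
  simp only
  rw [Complex.norm_add_mul_I, Real.sqrt_eq_rpow, ← Real.rpow_mul (by positivity)]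
  have : a ^ 2 + s ^ 2 = a ^ 2 * (1 + ‖s / a‖ ^ 2) := by
    rw [Real.norm_eq_abs, sq_abs]; field_simp
  rw [this, Real.mul_rpow (by positivity) (by positivity), ← Real.rpow_natCast a,
    ← Real.rpow_mul ha.le]
  congr 2 <;> push_cast <;> ring

theorem integrable_cpowPair {a : ℝ} {σ τ : ℂ} (ha : 0 < a) (h : 1 < (σ + τ).re) :
    Integrable (fun s : ℝ => cpowPair σ τ (a + s * Complex.I)) := by
  refine ((integrable_norm_add_mul_I ha h).const_mul
    (Real.exp (Real.pi * (|σ.im| + |τ.im|)))).mono' ?_ ?_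
  · exact ((measurable_cpowPair σ τ).comp (by fun_prop)).aestronglyMeasurable
  · exact Filter.Eventually.of_forall fun s => norm_cpowPair_le (by simpa using ha)

open scoped FourierTransform in
theorem fourier_laplace_kernel {a : ℝ} {σ : ℂ} (ha : 0 < a) (hσ : 1 < σ.re) (w : ℝ) :
    𝓕 (fun x : ℝ => Set.indicator (Set.Ioi (0 : ℝ))
      (fun x : ℝ => (x : ℂ) ^ (σ - 1) * Complex.exp (-(a * x))) x) w =
      ((a : ℂ) + (2 * Real.pi * w : ℝ) * Complex.I) ^ (-σ) * Complex.Gamma σ := by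
  rw [Real.fourier_real_eq_integral_exp_smul, ← laplace_cpow_eq (by linarith) (by simpa using ha),
    ← integral_indicator measurableSet_Ioi]
  congr 1
  ext x
  by_cases hx : x ∈ Set.Ioi (0 : ℝ)
  · simp only [Set.indicator_of_mem hx, smul_eq_mul]
    rw [mul_left_comm, ← Complex.exp_add]
    congr 2
    push_cast; ring
  · simp only [Set.indicator_of_notMem hx, smul_zero]

/-- Parseval: up to Gamma factors, the powers `z^(-σ)` and `z̄^(-τ)` on the line `Re z = a` are the
Fourier transforms of `x^(σ-1) e^(-ax)` and (reflected) `x^(τ-1) e^(-ax)` on `x > 0`. The product of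
these functions is the integrand of a Gamma integral with rate `2a`. -/
theorem cauchy_beta_aux {a : ℝ} {σ τ : ℂ} (ha : 0 < a) (hσ : 1 < σ.re) (hτ : 1 < τ.re) :
    ∫ s : ℝ, cpowPair σ τ (a + s * Complex.I) =
      2 * Real.pi * ((2 * a : ℝ) : ℂ) ^ (1 - σ - τ) *
        (Complex.Gamma (σ + τ - 1) / (Complex.Gamma σ * Complex.Gamma τ)) := by
  have hΓσ := Complex.Gamma_ne_zero_of_re_pos (show 0 < σ.re by linarith)
  have hΓτ := Complex.Gamma_ne_zero_of_re_pos (show 0 < τ.re by linarith)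
  set k : ℂ → ℝ → ℂ := fun σ x => Set.indicator (Set.Ioi (0 : ℝ))
      (fun x : ℝ => (x : ℂ) ^ (σ - 1) * Complex.exp (-(a * x))) x with hk
  have hki : ∀ σ : ℂ, 1 < σ.re → Integrable (k σ) := fun σ hσ =>
    (integrable_indicator_iff measurableSet_Ioi).2
      (integrableOn_cpow_mul_exp (by linarith) (by simpa using ha))
  have hF : ∀ σ : ℂ, 1 < σ.re → FourierTransform.fourier (k σ) = fun w : ℝ =>
      ((a : ℂ) + (2 * Real.pi * w : ℝ) * Complex.I) ^ (-σ) * Complex.Gamma σ := fun σ hσ =>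
    funext fun w => fourier_laplace_kernel ha hσ w
  -- Fourier inversion at every point needs continuity across `0`; it holds because `Re (τ - 1) > 0`
  -- makes `max x 0 ^ (τ - 1)` vanish for `x ≤ 0`.
  have hkc : Continuous (k τ) := by
    have hkeq : k τ = fun x : ℝ => ((max x 0 : ℝ) : ℂ) ^ (τ - 1) * Complex.exp (-(a * x)) := by
      ext x
      simp only [hk]
      by_cases hx : 0 < x
      · rw [Set.indicator_of_mem (Set.mem_Ioi.2 hx), max_eq_left hx.le]
      · rw [Set.indicator_of_notMem (by simpa using hx), max_eq_right (not_lt.1 hx), Complex.ofReal_zero,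
          Complex.zero_cpow, zero_mul]
        intro h
        have := congrArg Complex.re h
        simp at this; linarith
    rw [hkeq]
    have h2 : Continuous fun x : ℝ => ((max x 0 : ℝ) : ℂ) ^ (τ - 1) := by
      have := Complex.continuous_ofReal_cpow_const (y := τ - 1) (by simp; linarith)
      exact this.comp (continuous_id.max continuous_const)
    exact h2.mul (by fun_prop)
  have hFi : Integrable (FourierTransform.fourier (k τ)) := by
    rw [hF τ hτ]
    refine Integrable.mul_const ?_ _
    have := (integrable_cpowPair (σ := τ) (τ := 0) ha (by simpa using hτ)).comp_mul_left'
      (R := 2 * Real.pi) (by positivity)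
    refine this.congr (Filter.Eventually.of_forall fun w => ?_)
    simp [cpowPair]
  have hinv := hkc.fourierInv_fourier_eq (hki τ hτ) hFi
  have hneg : Integrable (fun w : ℝ => FourierTransform.fourier (k τ) (-w)) := hFi.comp_neg
  -- Move the transform from `k σ` to the reflected transform of `k τ`; the transform of the latter
  -- is the inverse transform of `𝓕 (k τ)`, that is `k τ`.
  have key : ∫ w : ℝ, FourierTransform.fourier (k σ) w * FourierTransform.fourier (k τ) (-w) =
      ∫ x : ℝ, k σ x * k τ x := by
    have h := VectorFourier.integral_fourierIntegral_smul_eq_flip (L := innerₗ ℝ)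
      (μ := (volume : Measure ℝ)) (ν := (volume : Measure ℝ))
      Real.continuous_fourierChar continuous_inner (hki σ hσ) hneg
    simp only [smul_eq_mul, flip_innerₗ] at h
    refine h.trans ?_
    congr 1
    ext x
    congr 1
    refine Eq.trans ?_ (congrFun hinv x)
    rw [Real.fourierInv_eq_fourier_comp_neg]
    rfl
  have hR : ∫ x : ℝ, k σ x * k τ x =
      ((2 * a : ℝ) : ℂ) ^ (1 - σ - τ) * Complex.Gamma (σ + τ - 1) := by
    have h := (integralEq_cpow_mul_exp (a := σ + τ - 1) (r := 2 * a) (by simp; linarith)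
      (by positivity)).2
    rw [show 1 - σ - τ = -(σ + τ - 1) by ring, ← h, ← integral_indicator measurableSet_Ioi]
    congr 1
    ext x
    by_cases hx : x ∈ Set.Ioi (0 : ℝ)
    · have hx0 : (x : ℂ) ≠ 0 := by exact_mod_cast (ne_of_gt hx)
      simp only [hk, Set.indicator_of_mem hx]
      rw [mul_mul_mul_comm, ← Complex.cpow_add _ _ hx0, ← Complex.exp_add]
      congr 2
      · ring
      · push_cast; ring
    · simp only [hk, Set.indicator_of_notMem hx, zero_mul]
  have hL : ∫ w : ℝ, FourierTransform.fourier (k σ) w * FourierTransform.fourier (k τ) (-w) =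
      (Complex.Gamma σ * Complex.Gamma τ) *
        ((2 * Real.pi : ℂ)⁻¹ * ∫ s : ℝ, cpowPair σ τ (a + s * Complex.I)) := by
    have h := Measure.integral_comp_mul_left
      (fun s : ℝ => cpowPair σ τ (a + s * Complex.I)) (2 * Real.pi)
    rw [abs_of_pos (by positivity)] at h
    have h' : ((2 * Real.pi : ℂ)⁻¹ * ∫ s : ℝ, cpowPair σ τ (a + s * Complex.I)) =
        ∫ w : ℝ, cpowPair σ τ (a + ((2 * Real.pi * w : ℝ) : ℂ) * Complex.I) := by
      rw [h]; simp
    rw [h', ← integral_const_mul, hF σ hσ, hF τ hτ]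
    congr 1
    ext w
    simp only [cpowPair]
    have : (starRingEnd ℂ) ((a : ℂ) + ((2 * Real.pi * w : ℝ) : ℂ) * Complex.I) =
        (a : ℂ) + ((2 * Real.pi * -w : ℝ) : ℂ) * Complex.I := by
      rw [map_add, map_mul, Complex.conj_ofReal, Complex.conj_ofReal, Complex.conj_I]
      push_cast; ring
    rw [this]
    ring
  rw [hL, hR] at key
  have hpi : (Real.pi : ℂ) ≠ 0 := by exact_mod_cast Real.pi_ne_zero
  have h2 : (2 * Real.pi : ℂ) ≠ 0 := mul_ne_zero two_ne_zero hpi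
  rw [mul_left_comm, inv_mul_eq_iff_eq_mul₀ h2] at key
  rw [mul_div_assoc', eq_div_iff (mul_ne_zero hΓσ hΓτ), mul_comm, key]
  ring

theorem integral_cpowPair_comm (a : ℝ) (σ τ : ℂ) :
    ∫ s : ℝ, cpowPair σ τ (a + s * Complex.I) = ∫ s : ℝ, cpowPair τ σ (a + s * Complex.I) := by
  rw [← integral_neg_eq_self (fun s : ℝ => cpowPair σ τ (a + s * Complex.I))]
  congr 1
  ext s
  simp only [cpowPair]
  rw [mul_comm]
  congr 2 <;> simp

theorem cpowPair_tendsto_zero {a : ℝ} {σ τ : ℂ} (ha : 0 < a) (h : 0 < (σ + τ).re)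
    {l : Filter ℝ} (hl : Filter.Tendsto (fun s : ℝ => |s|) l Filter.atTop) :
    Filter.Tendsto (fun s : ℝ => cpowPair σ τ (a + s * Complex.I)) l (nhds 0) := by
  have h1 : Filter.Tendsto (fun s : ℝ => ‖(a : ℂ) + s * Complex.I‖) l Filter.atTop := by
    refine Filter.tendsto_atTop_mono (fun s => ?_) hl
    have := Complex.abs_im_le_norm ((a : ℂ) + s * Complex.I)
    simpa using this
  have h2 := ((tendsto_rpow_neg_atTop h).comp h1).const_mul
    (Real.exp (Real.pi * (|σ.im| + |τ.im|)))
  rw [mul_zero] at h2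
  exact squeeze_zero_norm (fun s => norm_cpowPair_le (by simpa using ha)) h2

/-- Two linear relations hold among the integrals with exponents `(σ, τ)`, `(σ, τ+1)` and `(σ-1,
τ+1)`: one from `z + z̄ = 2a`, one from the vanishing integral of the derivative of `z^(1-σ)
z̄^(-τ)`. The third integral is eliminated. -/
theorem integral_cpowPair_succ {a : ℝ} {σ τ : ℂ} (ha : 0 < a) (h : 1 < (σ + τ).re) :
    (σ + τ - 1) * ∫ s : ℝ, cpowPair σ τ (a + s * Complex.I) =
      2 * a * τ * ∫ s : ℝ, cpowPair σ (τ + 1) (a + s * Complex.I) := by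
  have hi0 := integrable_cpowPair ha h
  have hi1 := integrable_cpowPair (σ := σ) (τ := τ + 1) ha (by simp at h ⊢; linarith)
  have hi2 := integrable_cpowPair (σ := σ - 1) (τ := τ + 1) ha (by simp at h ⊢; linarith)
  have hz : ∀ s : ℝ, (a : ℂ) + s * Complex.I ∈ Complex.slitPlane := fun s =>
    Or.inl (by simpa using ha)
  have hzc : ∀ s : ℝ, (starRingEnd ℂ) ((a : ℂ) + s * Complex.I) ∈ Complex.slitPlane := fun s =>
    Or.inl (by simpa using ha)
  have e1 : ∀ s : ℝ, cpowPair (σ - 1) (τ + 1) (a + s * Complex.I) =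
      ((a : ℂ) + s * Complex.I) * cpowPair σ (τ + 1) (a + s * Complex.I) := fun s => by
    rw [cpowPair, cpowPair, neg_sub, sub_eq_add_neg,
      Complex.cpow_add _ _ (Complex.slitPlane_ne_zero (hz s)), Complex.cpow_one]
    ring
  have e2 : ∀ s : ℝ, cpowPair σ τ (a + s * Complex.I) =
      (starRingEnd ℂ) ((a : ℂ) + s * Complex.I) * cpowPair σ (τ + 1) (a + s * Complex.I) := by
    intro s
    rw [cpowPair, cpowPair, show -τ = 1 + -(τ + 1) by ring,
      Complex.cpow_add _ _ (Complex.slitPlane_ne_zero (hzc s)), Complex.cpow_one]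
    ring
  have hA : 2 * a * ∫ s : ℝ, cpowPair σ (τ + 1) (a + s * Complex.I) =
      (∫ s : ℝ, cpowPair (σ - 1) (τ + 1) (a + s * Complex.I)) +
        ∫ s : ℝ, cpowPair σ τ (a + s * Complex.I) := by
    rw [← integral_add hi2 hi0, ← integral_const_mul]
    congr 1
    ext s
    rw [e1, e2, ← add_mul, Complex.add_conj]
    simp
  have hB : (∫ s : ℝ, Complex.I * (τ * cpowPair (σ - 1) (τ + 1) (a + s * Complex.I) -
      (σ - 1) * cpowPair σ τ (a + s * Complex.I))) = 0 - 0 := by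
    refine integral_of_hasDerivAt_of_tendsto
      (f := fun s : ℝ => cpowPair (σ - 1) τ (a + s * Complex.I)) ?_ ?_ ?_ ?_
    · intro s
      have d0 : HasDerivAt (fun s : ℝ => (a : ℂ) + s * Complex.I) Complex.I s := by
        simpa using ((hasDerivAt_id s).ofReal_comp.mul_const Complex.I).const_add (a : ℂ)
      have d1 : HasDerivAt (fun s : ℝ => (starRingEnd ℂ) ((a : ℂ) + s * Complex.I))
          (-Complex.I) s := by
        simpa [sub_eq_add_neg] using
          ((hasDerivAt_id s).ofReal_comp.mul_const (-Complex.I)).const_add (a : ℂ)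
      have d2 : HasDerivAt (fun s : ℝ => ((a : ℂ) + s * Complex.I) ^ (-(σ - 1))) _ s :=
        (((hasDerivAt_id _).cpow_const (hz s)).comp s d0 :)
      have d3 : HasDerivAt (fun s : ℝ => (starRingEnd ℂ) ((a : ℂ) + s * Complex.I) ^ (-τ)) _ s :=
        (((hasDerivAt_id _).cpow_const (hzc s)).comp s d1 :)
      refine (d2.mul d3).congr_deriv ?_
      simp only [cpowPair, id]
      rw [show -(σ - 1) - 1 = -σ by ring, show -τ - 1 = -(τ + 1) by ring]
      ring
    · exact ((hi2.const_mul τ).sub (hi0.const_mul (σ - 1))).const_mul _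
    · exact cpowPair_tendsto_zero ha (by simp at h ⊢; linarith) Filter.tendsto_abs_atBot_atTop
    · exact cpowPair_tendsto_zero ha (by simp at h ⊢; linarith) Filter.tendsto_abs_atTop_atTop
  rw [integral_const_mul, integral_sub (hi2.const_mul τ) (hi0.const_mul (σ - 1)),
    integral_const_mul, integral_const_mul, sub_zero] at hB
  have hB' := (mul_eq_zero.1 hB).resolve_left Complex.I_ne_zero
  linear_combination τ * (-hA) - hB'

/-- Cauchy's beta integral. -/
theorem cauchy_beta {a : ℝ} {σ τ : ℂ} (ha : 0 < a) (h : 1 < (σ + τ).re) :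
    IntegralEq (fun s : ℝ => cpowPair σ τ (a + s * Complex.I)) volume
      (2 * Real.pi * ((2 * a : ℝ) : ℂ) ^ (1 - σ - τ) *
        (Complex.Gamma (σ + τ - 1) / (Complex.Gamma σ * Complex.Gamma τ))) := by
  refine ⟨integrable_cpowPair ha h, ?_⟩
  have step : ∀ σ τ : ℂ, 1 < (σ + τ).re →
      (∫ s : ℝ, cpowPair σ (τ + 1) (a + s * Complex.I) =
        2 * Real.pi * ((2 * a : ℝ) : ℂ) ^ (1 - σ - (τ + 1)) *
        (Complex.Gamma (σ + (τ + 1) - 1) / (Complex.Gamma σ * Complex.Gamma (τ + 1)))) →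
      ∫ s : ℝ, cpowPair σ τ (a + s * Complex.I) =
        2 * Real.pi * ((2 * a : ℝ) : ℂ) ^ (1 - σ - τ) *
        (Complex.Gamma (σ + τ - 1) / (Complex.Gamma σ * Complex.Gamma τ)) := by
    intro σ τ h hs
    have hne : σ + τ - 1 ≠ 0 := by
      intro h0
      have := congrArg Complex.re h0
      simp at this h; linarith
    have h2a : ((2 * a : ℝ) : ℂ) ≠ 0 := by exact_mod_cast (by positivity)
    have hr := integral_cpowPair_succ ha h
    rw [hs] at hr
    rw [← mul_right_inj' hne, hr]
    have g1 : Complex.Gamma (σ + (τ + 1) - 1) = (σ + τ - 1) * Complex.Gamma (σ + τ - 1) := by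
      rw [← Complex.Gamma_add_one _ hne]; congr 1; ring
    -- This form of the functional equation stays valid at the poles, where `Gamma` and hence its
    -- inverse take the value `0`; no nonvanishing of `τ` is needed.
    have g2 : (Complex.Gamma τ)⁻¹ = τ * (Complex.Gamma (τ + 1))⁻¹ := by
      simpa using Complex.one_div_Gamma_eq_self_mul_one_div_Gamma_add_one τ
    have g3 : ((2 * a : ℝ) : ℂ) ^ (1 - σ - τ) =
        ((2 * a : ℝ) : ℂ) ^ (1 - σ - (τ + 1)) * (2 * a) := by
      rw [show 1 - σ - τ = 1 - σ - (τ + 1) + 1 by ring, Complex.cpow_add _ _ h2a,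
        Complex.cpow_one]
      push_cast; ring
    rw [g1, g3]
    simp only [div_eq_mul_inv, mul_inv]
    rw [g2]
    ring
  -- The range `Re σ, Re τ > 1` is enlarged in two stages: `s1` lowers `τ` by unit steps while `Re σ
  -- > 1`, then `s2` lowers `σ`, using the symmetry `s ↦ -s` that exchanges the two exponents.
  have s1 : ∀ N : ℕ, ∀ σ τ : ℂ, 1 < (σ + τ).re → 1 < σ.re → 1 < τ.re + N →
      ∫ s : ℝ, cpowPair σ τ (a + s * Complex.I) =
        2 * Real.pi * ((2 * a : ℝ) : ℂ) ^ (1 - σ - τ) *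
        (Complex.Gamma (σ + τ - 1) / (Complex.Gamma σ * Complex.Gamma τ)) := by
    intro N
    induction N with
    | zero => intro σ τ _ h1 h2; exact cauchy_beta_aux ha h1 (by simpa using h2)
    | succ N ih =>
      intro σ τ h h1 h2
      refine step σ τ h (ih σ (τ + 1) ?_ h1 ?_)
      · simp at h ⊢; linarith
      · push_cast at h2; simp; linarith
  have s2 : ∀ N : ℕ, ∀ σ τ : ℂ, 1 < (σ + τ).re → 1 < σ.re + N →
      ∫ s : ℝ, cpowPair σ τ (a + s * Complex.I) =
        2 * Real.pi * ((2 * a : ℝ) : ℂ) ^ (1 - σ - τ) *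
        (Complex.Gamma (σ + τ - 1) / (Complex.Gamma σ * Complex.Gamma τ)) := by
    intro N
    induction N with
    | zero =>
      intro σ τ h h1
      obtain ⟨M, hM⟩ := exists_nat_gt (1 - τ.re)
      exact s1 M σ τ h (by simpa using h1) (by linarith)
    | succ N ih =>
      intro σ τ h h1
      rw [integral_cpowPair_comm, show 1 - σ - τ = 1 - τ - σ by ring, add_comm σ τ,
        mul_comm (Complex.Gamma σ)]
      refine step τ σ (by rwa [add_comm]) ?_
      rw [integral_cpowPair_comm, show 1 - τ - (σ + 1) = 1 - (σ + 1) - τ by ring,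
        add_comm τ (σ + 1), mul_comm (Complex.Gamma τ)]
      refine ih (σ + 1) τ ?_ ?_
      · simp at h ⊢; linarith
      · push_cast at h1; simp; linarith
  obtain ⟨N, hN⟩ := exists_nat_gt (1 - σ.re)
  exact s2 N σ τ h (by linarith)

/-! ### Gaussian integrals of positive definite forms over `ℝ` and `ℂ` -/

/-- A field `ℝ` or `ℂ` with a Haar measure normalised as Lebesgue measure. -/
class LebesgueField (K : Type*) [RCLike K] [MeasureSpace K] : Prop where
  integral_gauss : ∀ s : ℝ, 0 < s →
    ∫ x : K, Real.exp (-s * ‖x‖ ^ 2) = (Real.pi / s) ^ ((Module.finrank ℝ K : ℝ) / 2)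
  abs_norm : ∀ z : K, |Algebra.norm ℝ z| = ‖z‖ ^ (Module.finrank ℝ K)

instance : LebesgueField ℝ where
  integral_gauss s hs := GaussianFourier.integral_rexp_neg_mul_sq_norm hs
  abs_norm z := by simp [Algebra.norm_self]

instance : LebesgueField ℂ where
  integral_gauss s hs := GaussianFourier.integral_rexp_neg_mul_sq_norm hs
  abs_norm z := by
    rw [Algebra.norm_complex_apply, Complex.finrank_real_complex, Complex.normSq_eq_norm_sq,
      abs_of_nonneg (by positivity)]

section reForm

variable {K : Type*} [RCLike K] {ι : Type*} [Fintype ι]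

/-- The real part of `x* A x`. -/
def reForm (A : Matrix ι ι K) (x : ι → K) : ℝ :=
  RCLike.re (star x ⬝ᵥ (A *ᵥ x))

theorem reForm_one [DecidableEq ι] (x : ι → K) : reForm (1 : Matrix ι ι K) x = ∑ i, ‖x i‖ ^ 2 := by
  rw [reForm, Matrix.one_mulVec, dotProduct, map_sum]
  refine Finset.sum_congr rfl fun i _ => ?_
  rw [Pi.star_apply, RCLike.star_def, RCLike.conj_mul]
  norm_cast

theorem reForm_continuous (A : Matrix ι ι K) : Continuous (reForm A) := by
  unfold reForm
  have : Continuous fun x : ι → K => star x ⬝ᵥ (A *ᵥ x) :=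
    continuous_star.dotProduct (continuous_const.matrix_mulVec continuous_id)
  exact RCLike.continuous_re.comp this

end reForm

section Gaussian

variable {K : Type*} [RCLike K] [MeasureSpace K] [(volume : Measure K).IsAddHaarMeasure]
  [LebesgueField K] {ι : Type*} [Fintype ι]

theorem integral_gauss_pi {s : ℝ} (hs : 0 < s) :
    ∫ x : ι → K, Real.exp (-s * ∑ i, ‖x i‖ ^ 2) =
      (Real.pi / s) ^ ((Module.finrank ℝ K * Fintype.card ι : ℝ) / 2) := by
  simp_rw [Finset.mul_sum, Real.exp_sum]
  rw [integral_fintype_prod_volume_eq_pow (fun z : K => Real.exp (-s * ‖z‖ ^ 2)),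
    LebesgueField.integral_gauss s hs, ← Real.rpow_natCast, ← Real.rpow_mul (by positivity)]
  congr 1; ring

variable [BorelSpace K] [DecidableEq ι]

/-- Write `A = B*B` and substitute `Bx`. As a real linear map, `B` has Jacobian `|det B|^d` with `d
= dim_ℝ K`, and `|det B|² = det A`. -/
theorem integral_gauss_posDef {A : Matrix ι ι K} (hA : A.PosDef) {s : ℝ} (hs : 0 < s) :
    ∫ x : ι → K, Real.exp (-s * reForm A x) =
      (RCLike.re A.det) ^ (-(Module.finrank ℝ K : ℝ) / 2) *
      (Real.pi / s) ^ ((Module.finrank ℝ K * Fintype.card ι : ℝ) / 2) := by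
  obtain ⟨B, hB⟩ : ∃ B : Matrix ι ι K, A = Bᴴ * B := by
    open scoped MatrixOrder in
    exact CStarAlgebra.nonneg_iff_eq_star_mul_self.mp hA.posSemidef.nonneg
  have hdet : RCLike.re A.det = ‖B.det‖ ^ 2 := by
    rw [hB, Matrix.det_mul, Matrix.det_conjTranspose, RCLike.star_def, RCLike.conj_mul]
    norm_cast
  have hpos : 0 < RCLike.re A.det := (RCLike.pos_iff.1 hA.det_pos).1
  have hB0 : B.det ≠ 0 := by
    intro h
    rw [hdet, h] at hpos
    simp at hpos
  have hBn : 0 < ‖B.det‖ := norm_pos_iff.2 hB0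
  set f : (ι → K) →ₗ[ℝ] (ι → K) := (Matrix.toLin' B).restrictScalars ℝ with hf
  have hfd : LinearMap.det f = Algebra.norm ℝ B.det := by
    rw [hf]
    exact LinearMap.det_restrictScalars.trans (by rw [LinearMap.det_toLin'])
  have hfa : |LinearMap.det f| = ‖B.det‖ ^ (Module.finrank ℝ K) := by
    rw [hfd, LebesgueField.abs_norm]
  have hf0 : LinearMap.det f ≠ 0 := by
    rw [← abs_pos, hfa]; positivity
  have hmap := Measure.map_linearMap_addHaar_eq_smul_addHaar (volume : Measure (ι → K)) hf0
  have hmeas : Continuous f := f.continuous_of_finiteDimensional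
  have h1 : ∫ x : ι → K, Real.exp (-s * reForm A x) =
      ∫ x, Real.exp (-s * ∑ i, ‖x i‖ ^ 2) ∂(Measure.map f volume) := by
    rw [integral_map hmeas.measurable.aemeasurable
      (Continuous.aestronglyMeasurable (by fun_prop))]
    congr 1
    ext x
    rw [← reForm_one]
    congr 2
    simp only [reForm, hB, hf, LinearMap.coe_restrictScalars, Matrix.toLin'_apply,
      Matrix.one_mulVec, Matrix.star_mulVec, ← Matrix.mulVec_mulVec, Matrix.dotProduct_mulVec]
  rw [h1, hmap, integral_smul_measure, integral_gauss_pi hs, smul_eq_mul,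
    ENNReal.toReal_ofReal (abs_nonneg _), abs_inv, hfa, hdet]
  congr 1
  rw [← Real.rpow_natCast, ← Real.rpow_natCast, ← Real.rpow_neg hBn.le, ← Real.rpow_mul hBn.le]
  congr 1
  push_cast; ring

theorem integralEq_gauss_posDef {A : Matrix ι ι K} (hA : A.PosDef) {s : ℝ} (hs : 0 < s) :
    IntegralEq (fun x : ι → K => Complex.exp (-(s * reForm A x))) volume
      ((((RCLike.re A.det) ^ (-(Module.finrank ℝ K : ℝ) / 2) *
        Real.pi ^ ((Module.finrank ℝ K * Fintype.card ι : ℝ) / 2) : ℝ) : ℂ) *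
        (s : ℂ) ^ (-(((Module.finrank ℝ K * Fintype.card ι : ℝ) / 2 : ℝ) : ℂ))) := by
  have h := integral_gauss_posDef hA hs
  have hpos : 0 < RCLike.re A.det := (RCLike.pos_iff.1 hA.det_pos).1
  have hi : Integrable fun x : ι → K => Real.exp (-s * reForm A x) := by
    by_contra hn
    rw [integral_undef hn] at h
    have : 0 < (RCLike.re A.det) ^ (-(Module.finrank ℝ K : ℝ) / 2) *
      (Real.pi / s) ^ ((Module.finrank ℝ K * Fintype.card ι : ℝ) / 2) := by positivity
    linarith
  have e : (fun x : ι → K => Complex.exp (-(s * reForm A x))) =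
      fun x => ((Real.exp (-s * reForm A x) : ℝ) : ℂ) := by
    ext x; push_cast; ring_nf
  rw [e]
  refine ⟨hi.ofReal, ?_⟩
  rw [integral_complex_ofReal, h, ← Complex.ofReal_neg, ← Complex.ofReal_cpow hs.le,
    ← Complex.ofReal_mul]
  congr 1
  rw [Real.div_rpow Real.pi_pos.le hs.le, Real.rpow_neg hs.le]
  ring

end Gaussian

/-! ### Accretive matrices `1 + T + S` and completion of the square -/

section AccretiveMatrices

theorem posDef_one_add {K : Type*} [RCLike K] {ι : Type*} [DecidableEq ι] {T : Matrix ι ι K}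
    (hT : T.PosDef) : (1 + T).PosDef := Matrix.PosDef.one.add hT

variable {K : Type*} [RCLike K] {ι : Type*} [Fintype ι]

theorem reForm_add (A B : Matrix ι ι K) (x : ι → K) :
    reForm (A + B) x = reForm A x + reForm B x := by
  simp [reForm, Matrix.add_mulVec, dotProduct_add]

theorem re_star_dotProduct_comm (x y : ι → K) :
    RCLike.re (star x ⬝ᵥ y) = RCLike.re (star y ⬝ᵥ x) := by
  rw [← RCLike.conj_re, ← RCLike.star_def, Matrix.star_dotProduct]
  simp [dotProduct_comm]

theorem reForm_of_skew {S : Matrix ι ι K} (hS : Sᴴ = -S) (x : ι → K) : reForm S x = 0 := by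
  have h : reForm S x = -reForm S x := by
    conv_lhs => rw [reForm, re_star_dotProduct_comm, Matrix.star_mulVec,
      ← Matrix.dotProduct_mulVec, hS, Matrix.neg_mulVec, dotProduct_neg, map_neg]
    rfl
  linarith

theorem det_ne_zero_of_reForm_pos [DecidableEq ι] {A : Matrix ι ι K}
    (hA : ∀ x, x ≠ 0 → 0 < reForm A x) : A.det ≠ 0 := by
  intro h
  obtain ⟨v, hv, hv0⟩ := Matrix.exists_mulVec_eq_zero_iff.2 h
  have := hA v hv
  rw [reForm, hv0] at this
  simp at this

theorem reForm_pos_of_posDef {A : Matrix ι ι K} (hA : A.PosDef) {x : ι → K} (hx : x ≠ 0) :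
    0 < reForm A x := hA.re_dotProduct_pos hx

theorem reForm_nonneg_of_posDef {A : Matrix ι ι K} (hA : A.PosDef) (x : ι → K) :
    0 ≤ reForm A x := hA.posSemidef.re_dotProduct_nonneg x

variable [DecidableEq ι] {T S : Matrix ι ι K}

theorem reForm_one_add_add (hS : Sᴴ = -S) (x : ι → K) :
    reForm (1 + T + S) x = reForm (1 + T) x := by
  rw [reForm_add, reForm_of_skew hS, add_zero]

theorem det_one_add_add_ne_zero (hT : T.PosDef) (hS : Sᴴ = -S) : (1 + T + S).det ≠ 0 :=
  det_ne_zero_of_reForm_pos fun x hx => by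
    rw [reForm_one_add_add hS]; exact reForm_pos_of_posDef (posDef_one_add hT) hx

/-- The difference is the inverse of `(1 + T) T`; written as `T + T*T`, this product is visibly
positive definite. -/
theorem inv_sub_inv_one_add (hT : T.PosDef) : T⁻¹ - (1 + T)⁻¹ = (T + Tᴴ * T)⁻¹ := by
  have h1 : IsUnit T.det := (Matrix.isUnit_iff_isUnit_det _).1 hT.isUnit
  have h2 : IsUnit (1 + T).det := (Matrix.isUnit_iff_isUnit_det _).1 (posDef_one_add hT).isUnit
  have e : T + Tᴴ * T = (1 + T) * T := by rw [hT.1, add_mul, one_mul]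
  rw [e, Matrix.mul_inv_rev]
  have : T⁻¹ * (1 + T) * (1 + T)⁻¹ = T⁻¹ := by
    rw [mul_assoc, Matrix.mul_nonsing_inv _ h2, mul_one]
  conv_lhs => rw [← this]
  rw [mul_add, mul_one, add_mul, Matrix.nonsing_inv_mul _ h1, one_mul, add_sub_cancel_right]

theorem posDef_inv_sub_inv_one_add (hT : T.PosDef) : (T⁻¹ - (1 + T)⁻¹).PosDef := by
  rw [inv_sub_inv_one_add hT]
  exact (hT.add_posSemidef (Matrix.posSemidef_conjTranspose_mul_self T)).inv

/-- The hermitian part of `(1 + T + S)⁻¹`. -/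
noncomputable def invHermPart (T S : Matrix ι ι K) : Matrix ι ι K :=
  ((1 + T + S)⁻¹)ᴴ * (1 + T) * (1 + T + S)⁻¹

theorem posDef_invHermPart (hT : T.PosDef) (hS : Sᴴ = -S) : (invHermPart T S).PosDef := by
  refine (posDef_one_add hT).conjTranspose_mul_mul_same ?_
  rw [Matrix.mulVec_injective_iff_isUnit, Matrix.isUnit_nonsing_inv_iff,
    Matrix.isUnit_iff_isUnit_det, isUnit_iff_ne_zero]
  exact det_one_add_add_ne_zero hT hS

theorem re_det_pos {A : Matrix ι ι K} (hA : A.PosDef) : 0 < RCLike.re A.det :=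
  (RCLike.pos_iff.1 hA.det_pos).1

theorem det_eq_ofReal_re {A : Matrix ι ι K} (hA : A.PosDef) :
    A.det = ((RCLike.re A.det : ℝ) : K) :=
  (RCLike.conj_eq_iff_re.1 (RCLike.conj_eq_iff_im.2 (RCLike.pos_iff.1 hA.det_pos).2)).symm

/-- The first determinant is `1 / (det T · det (1+T))`, the second is `det (1+T) / |det (1+T+S)|²`,
and `det (1+T)` cancels. What remains can be absorbed by shifting the parameters. -/
theorem re_det_mul_re_det (hT : T.PosDef) (hS : Sᴴ = -S) :
    RCLike.re (T⁻¹ - (1 + T)⁻¹).det * RCLike.re (invHermPart T S).det =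
      (RCLike.re T.det * ‖(1 + T + S).det‖ ^ 2)⁻¹ := by
  have hP := det_one_add_add_ne_zero hT hS
  have h1 := det_eq_ofReal_re (posDef_inv_sub_inv_one_add hT)
  have h2 := det_eq_ofReal_re (posDef_invHermPart hT hS)
  have h3 := det_eq_ofReal_re hT
  have hT0 : T.det ≠ 0 := ((Matrix.isUnit_iff_isUnit_det _).1 hT.isUnit).ne_zero
  have hH0 : (1 + T).det ≠ 0 :=
    ((Matrix.isUnit_iff_isUnit_det _).1 (posDef_one_add hT).isUnit).ne_zero
  have key : (T⁻¹ - (1 + T)⁻¹).det * (invHermPart T S).det =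
      (T.det * ((‖(1 + T + S).det‖ ^ 2 : ℝ) : K))⁻¹ := by
    have e : T + Tᴴ * T = (1 + T) * T := by rw [hT.1, add_mul, one_mul]
    rw [inv_sub_inv_one_add hT, e, invHermPart]
    simp only [Matrix.det_mul, Matrix.det_nonsing_inv, Ring.inverse_eq_inv',
      Matrix.det_conjTranspose]
    have hn : ((‖(1 + T + S).det‖ ^ 2 : ℝ) : K) =
        (starRingEnd K) (1 + T + S).det * (1 + T + S).det := by
      rw [RCLike.conj_mul]; norm_cast
    have hP' : (starRingEnd K) (1 + T + S).det ≠ 0 := by simpa using hP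
    rw [hn]
    simp only [RCLike.star_def, map_inv₀]
    field_simp
  rw [h1, h2, h3] at key
  exact_mod_cast key

/-- Completing the square in the last column. -/
theorem re_form_column (hT : T.PosDef) (hS : Sᴴ = -S) (v w : ι → K) :
    RCLike.re (star (v - w) ⬝ᵥ ((1 + T + S)⁻¹ *ᵥ (v + w))) =
      reForm (1 + T)⁻¹ v - reForm (invHermPart T S) (w - S *ᵥ ((1 + T)⁻¹ *ᵥ v)) := by
  set H := 1 + T with hH
  set P := H + S with hP
  have hHd : IsUnit H.det := (Matrix.isUnit_iff_isUnit_det _).1 (posDef_one_add hT).isUnit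
  have hPd : IsUnit P.det := (det_one_add_add_ne_zero hT hS).isUnit
  -- With this `a` one has `v + w = Pa + y` and `v - w = P*a - y`. Expanding leaves the cross terms
  -- `a*y - y*a`, whose real part is zero.
  set a := H⁻¹ *ᵥ v with ha
  set y := w - S *ᵥ a with hy
  set x := P⁻¹ *ᵥ y with hx
  have hHa : H *ᵥ a = v := by rw [ha, Matrix.mulVec_mulVec, Matrix.mul_nonsing_inv _ hHd,
    Matrix.one_mulVec]
  have hPx : P *ᵥ x = y := by rw [hx, Matrix.mulVec_mulVec, Matrix.mul_nonsing_inv _ hPd,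
    Matrix.one_mulVec]
  have hPa : P *ᵥ a = v + S *ᵥ a := by rw [hP, Matrix.add_mulVec, hHa]
  have hHh : Hᴴ = H := (posDef_one_add hT).1
  have hPa' : Pᴴ *ᵥ a = v - S *ᵥ a := by
    rw [hP, Matrix.conjTranspose_add, hS, hHh, Matrix.add_mulVec, hHa, Matrix.neg_mulVec,
      sub_eq_add_neg]
  have e1 : v + w = P *ᵥ a + y := by rw [hPa, hy]; abel
  have e2 : v - w = Pᴴ *ᵥ a - y := by rw [hPa', hy]; abel
  have e3 : P⁻¹ *ᵥ (v + w) = a + x := by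
    rw [e1, Matrix.mulVec_add, Matrix.mulVec_mulVec, Matrix.nonsing_inv_mul _ hPd,
      Matrix.one_mulVec]
  have e4 : ∀ z, star (Pᴴ *ᵥ a) ⬝ᵥ z = star a ⬝ᵥ (P *ᵥ z) := fun z => by
    rw [Matrix.star_mulVec, Matrix.conjTranspose_conjTranspose, Matrix.dotProduct_mulVec]
  have hSz : ∀ z, RCLike.re (star z ⬝ᵥ (P *ᵥ z)) = reForm H z := fun z =>
    reForm_one_add_add hS z
  have f1 : RCLike.re (star a ⬝ᵥ (P *ᵥ a)) = reForm H⁻¹ v := by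
    rw [hSz, reForm, hHa, re_star_dotProduct_comm]; rfl
  have f2 : RCLike.re (star y ⬝ᵥ x) = reForm (invHermPart T S) y := by
    have : reForm (invHermPart T S) y = reForm H x := by
      rw [reForm, reForm, invHermPart, ← Matrix.mulVec_mulVec, ← Matrix.mulVec_mulVec,
        Matrix.dotProduct_mulVec, ← Matrix.star_mulVec]
    rw [this, ← hSz x, hPx, re_star_dotProduct_comm]
  rw [e3, e2, star_sub, sub_dotProduct, dotProduct_add, dotProduct_add, e4, e4, hPx, map_sub,
    map_add, map_add, f1, f2, re_star_dotProduct_comm a y]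
  ring

end AccretiveMatrices

/-! ### The integral over the last column -/

/-- `u ^ b` for `u > 0`, and `0` elsewhere. -/
noncomputable def posCpow (b : ℂ) (u : ℝ) : ℂ := if 0 < u then (u : ℂ) ^ b else 0

theorem posCpow_of_pos (b : ℂ) {u : ℝ} (hu : 0 < u) : posCpow b u = (u : ℂ) ^ b := if_pos hu

theorem posCpow_of_nonpos (b : ℂ) {u : ℝ} (hu : ¬0 < u) : posCpow b u = 0 := if_neg hu

theorem measurable_posCpow (b : ℂ) : Measurable (posCpow b) :=
  Measurable.ite measurableSet_Ioi (by fun_prop) measurable_const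

theorem norm_posCpow (b : ℂ) (u : ℝ) : ((‖posCpow b u‖ : ℝ) : ℂ) = posCpow b.re u := by
  by_cases hu : 0 < u
  · rw [posCpow_of_pos _ hu, posCpow_of_pos _ hu, Complex.norm_cpow_eq_rpow_re_of_pos hu,
      Complex.ofReal_cpow hu.le]
  · rw [posCpow_of_nonpos _ hu, posCpow_of_nonpos _ hu, norm_zero, Complex.ofReal_zero]

theorem norm_ofReal_cpow {X : ℝ} (hX : 0 < X) (b : ℂ) :
    ((‖(X : ℂ) ^ b‖ : ℝ) : ℂ) = (X : ℂ) ^ (b.re : ℂ) := by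
  rw [Complex.norm_cpow_eq_rpow_re_of_pos hX, Complex.ofReal_cpow hX.le]

theorem norm_exp_neg_mul (s r : ℝ) :
    ((‖Complex.exp (-(s * r))‖ : ℝ) : ℂ) = Complex.exp (-(s * r)) := by
  rw [Complex.norm_exp]; push_cast; simp

/-- Replacing `u` by `max u 0` changes nothing where `posCpow` is nonzero and makes the exponent
nonnegative everywhere, as `IntegralEq.of_laplace` requires. -/
theorem integralEq_posCpow {b : ℂ} (hb : -1 < b.re) {s : ℝ} (hs : 0 < s) :
    IntegralEq (fun u : ℝ => posCpow b u * Complex.exp (-(s * (max u 0 : ℝ)))) volume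
      (Complex.Gamma (b + 1) * (s : ℂ) ^ (-(b + 1))) := by
  have h := integralEq_cpow_mul_exp (a := b + 1) (by simp; linarith) hs
  have e : (fun u : ℝ => posCpow b u * Complex.exp (-(s * (max u 0 : ℝ)))) =
      Set.indicator (Set.Ioi 0) fun t : ℝ => (t : ℂ) ^ (b + 1 - 1) * Complex.exp (-(s * t)) := by
    ext u
    by_cases hu : 0 < u
    · rw [Set.indicator_of_mem (Set.mem_Ioi.2 hu), posCpow_of_pos _ hu, max_eq_left hu.le,
        add_sub_cancel_right]
    · rw [Set.indicator_of_notMem (by simpa using hu), posCpow_of_nonpos _ hu, zero_mul]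
  rw [e]
  refine ⟨(integrable_indicator_iff measurableSet_Ioi).2 h.1, ?_⟩
  rw [integral_indicator measurableSet_Ioi, h.2, mul_comm]

theorem measurePreserving_translate {α β γ : Type*} [MeasurableSpace α] [MeasurableSpace β]
    [MeasurableSpace γ] [AddGroup γ] [MeasurableAdd₂ γ] {μ : Measure α} {ν : Measure β}
    {η : Measure γ} [SFinite μ] [SFinite η] [η.IsAddRightInvariant] {f : α → β}
    (hf : MeasurePreserving f μ ν) {k : α → γ} (hk : Measurable k) :
    MeasurePreserving (fun p : α × γ => (f p.1, p.2 + k p.1)) (μ.prod η) (ν.prod η) :=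
  hf.skew_product (g := fun a c => c + k a)
    (measurable_snd.add (hk.comp measurable_fst))
    (Filter.Eventually.of_forall fun a => map_add_right_eq_self η (k a))

section Step

variable (K : Type*) [RCLike K] (ι : Type*) [Fintype ι]

/-- The constant `π^d Γ(b + 1) Γ(ρ - b - 1 - d) / Γ(ρ)` with `d = dim_ℝ K ^ ι`. -/
noncomputable def stepConst (b ρ : ℂ) : ℂ :=
  Complex.Gamma (b + 1) * ((Real.pi ^ (Module.finrank ℝ K * Fintype.card ι) : ℝ) : ℂ) *
    (Complex.Gamma (ρ - (b + 1 + (Module.finrank ℝ K * Fintype.card ι : ℕ))) / Complex.Gamma ρ)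

variable {K ι} [DecidableEq ι]

/-- The Schur complement of the last block of `T`, with last column `v` and corner `t`. -/
noncomputable def schurT (T : Matrix ι ι K) (v : ι → K) (t : ℝ) : ℝ := t - reForm T⁻¹ v

/-- The product `(v - w)* (1 + T + S)⁻¹ (v + w)`. -/
noncomputable def schurForm (T S : Matrix ι ι K) (z : (ι → K) × (ι → K)) : K :=
  star (z.1 - z.2) ⬝ᵥ ((1 + T + S)⁻¹ *ᵥ (z.1 + z.2))

/-- The integrand of the real case as a function of the last column. -/
noncomputable def realKernel (b σ : ℂ) (T S : Matrix ι ι K) (z : ((ι → K) × (ι → K)) × ℝ) : ℂ :=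
  posCpow b (schurT T z.1.1 z.2) *
    ((1 + z.2 - RCLike.re (schurForm T S z.1) : ℝ) : ℂ) ^ (-σ)

/-- The integrand of the complex case as a function of the last column. -/
noncomputable def cplxKernel (b σ τ : ℂ) (T S : Matrix ι ι K)
    (z : (((ι → K) × (ι → K)) × ℝ) × ℝ) : ℂ :=
  posCpow b (schurT T z.1.1.1 z.1.2) *
    cpowPair σ τ (((1 + z.1.2 - RCLike.re (schurForm T S z.1.1) : ℝ) : ℂ) +
      ((z.2 - RCLike.im (schurForm T S z.1.1) : ℝ) : ℂ) * Complex.I)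

/-- The determinant factor `(det T)^{d/2} |det (1 + T + S)|^d`, `d = dim K`. -/
noncomputable def stepDet (T S : Matrix ι ι K) : ℝ :=
  (RCLike.re T.det) ^ ((Module.finrank ℝ K : ℝ) / 2) * ‖(1 + T + S).det‖ ^ (Module.finrank ℝ K)

/-- The shear that diagonalises the integrand. -/
noncomputable def shear (T S : Matrix ι ι K) (z : ((ι → K) × (ι → K)) × ℝ) :
    ((ι → K) × (ι → K)) × ℝ :=
  ((z.1.1, z.1.2 - S *ᵥ ((1 + T)⁻¹ *ᵥ z.1.1)), schurT T z.1.1 z.2)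

/-- In the coordinates of `shear`, the real part of the Schur complement of `1 + T + S` has no mixed
terms; the integral over the column then separates after a Laplace transform. -/
theorem re_schurForm {T S : Matrix ι ι K} (hT : T.PosDef) (hS : Sᴴ = -S)
    (z : ((ι → K) × (ι → K)) × ℝ) :
    1 + z.2 - RCLike.re (schurForm T S z.1) =
      1 + (reForm (T⁻¹ - (1 + T)⁻¹) (shear T S z).1.1 + reForm (invHermPart T S)
        (shear T S z).1.2 + (shear T S z).2) := by
  have h : reForm T⁻¹ z.1.1 = reForm (T⁻¹ - (1 + T)⁻¹) z.1.1 + reForm (1 + T)⁻¹ z.1.1 := by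
    rw [← reForm_add, sub_add_cancel]
  simp only [schurForm, re_form_column hT hS, shear, schurT]
  linarith

theorem one_le_re_schurForm {T S : Matrix ι ι K} (hT : T.PosDef) (hS : Sᴴ = -S)
    (z : ((ι → K) × (ι → K)) × ℝ) (hz : 0 < schurT T z.1.1 z.2) :
    0 < 1 + z.2 - RCLike.re (schurForm T S z.1) := by
  rw [re_schurForm hT hS]
  have h1 := reForm_nonneg_of_posDef (posDef_inv_sub_inv_one_add hT) (shear T S z).1.1
  have h2 := reForm_nonneg_of_posDef (posDef_invHermPart hT hS) (shear T S z).1.2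
  have h3 : 0 < (shear T S z).2 := hz
  linarith

theorem stepDet_eq {T S : Matrix ι ι K} (hT : T.PosDef) (hS : Sᴴ = -S) :
    (RCLike.re (T⁻¹ - (1 + T)⁻¹).det * RCLike.re (invHermPart T S).det) ^
      (-(Module.finrank ℝ K : ℝ) / 2) = stepDet T S := by
  have hP : 0 < ‖(1 + T + S).det‖ := norm_pos_iff.2 (det_one_add_add_ne_zero hT hS)
  rw [re_det_mul_re_det hT hS, stepDet, Real.inv_rpow (by have := re_det_pos hT; positivity),
    ← Real.rpow_neg (by have := re_det_pos hT; positivity),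
    Real.mul_rpow (re_det_pos hT).le (by positivity), ← Real.rpow_natCast, ← Real.rpow_natCast,
    ← Real.rpow_mul hP.le]
  congr 2 <;> push_cast <;> ring

theorem stepDet_pos {T S : Matrix ι ι K} (hT : T.PosDef) (hS : Sᴴ = -S) : 0 < stepDet T S := by
  have hP : 0 < ‖(1 + T + S).det‖ := norm_pos_iff.2 (det_one_add_add_ne_zero hT hS)
  have := re_det_pos hT
  unfold stepDet
  positivity

variable [MeasureSpace K] [BorelSpace K] [(volume : Measure K).IsAddHaarMeasure]
  [SigmaFinite (volume : Measure K)]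

/-- The map is unitriangular: `w` and `t` are translated by functions of `v` alone. -/
theorem measurePreserving_shear (T S : Matrix ι ι K) :
    MeasurePreserving (shear T S) volume volume := by
  have h1 : Measurable fun v : ι → K => -(S *ᵥ ((1 + T)⁻¹ *ᵥ v)) :=
    (Continuous.neg (continuous_const.matrix_mulVec
      (continuous_const.matrix_mulVec continuous_id))).measurable
  have h2 : Measurable fun z : (ι → K) × (ι → K) => -reForm T⁻¹ z.1 :=
    ((reForm_continuous T⁻¹).comp continuous_fst).neg.measurable
  have := measurePreserving_translate (η := (volume : Measure ℝ)) (measurePreserving_translate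
    (η := (volume : Measure (ι → K))) (MeasurePreserving.id (volume : Measure (ι → K))) h1) 
    h2
  have e : shear T S = fun p : ((ι → K) × (ι → K)) × ℝ =>
      ((id p.1.1, p.1.2 + -(S *ᵥ ((1 + T)⁻¹ *ᵥ p.1.1))), p.2 + -reForm T⁻¹ p.1.1) := by
    ext p <;> simp [shear, schurT, sub_eq_add_neg]
  rw [e]
  exact this

variable [LebesgueField K]

/-- The Laplace transform in the whole expression is a pure power: each Gaussian contributes
`s^(-d/2)` and the `u`-integral `s^(-(b+1))`. Then `IntegralEq.of_laplace` applies with `X = 1`. -/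
theorem integralEq_quadratic_step {A M : Matrix ι ι K} (hA : A.PosDef) (hM : M.PosDef) {b ρ : ℂ}
    (hb : -1 < b.re) (hρ : b.re + 1 + (Module.finrank ℝ K * Fintype.card ι : ℕ) < ρ.re) :
    IntegralEq (fun z : ((ι → K) × (ι → K)) × ℝ => posCpow b z.2 *
      ((1 + (reForm A z.1.1 + reForm M z.1.2 + max z.2 0) : ℝ) : ℂ) ^ (-ρ)) volume
      ((((RCLike.re A.det * RCLike.re M.det) ^ (-(Module.finrank ℝ K : ℝ) / 2) : ℝ) : ℂ) *
        stepConst K ι b ρ) := by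
  set d : ℕ := Module.finrank ℝ K * Fintype.card ι with hd
  set D : ℝ := (RCLike.re A.det * RCLike.re M.det) ^ (-(Module.finrank ℝ K : ℝ) / 2) with hD
  have hAc := reForm_continuous A
  have hMc := reForm_continuous M
  have hAm : Measurable (reForm A) := hAc.measurable
  have hMm : Measurable (reForm M) := hMc.measurable
  have lap : ∀ b : ℂ, -1 < b.re → ∀ s : ℝ, 0 < s →
      IntegralEq (fun z : ((ι → K) × (ι → K)) × ℝ => posCpow b z.2 *
        Complex.exp (-(s * (reForm A z.1.1 + reForm M z.1.2 + max z.2 0 : ℝ)))) volume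
        ((Complex.Gamma (b + 1) * ((D * Real.pi ^ d : ℝ) : ℂ)) * (s : ℂ) ^ (-(b + 1 + d))) := by
    intro b hb s hs
    have hs0 : (s : ℂ) ≠ 0 := by exact_mod_cast hs.ne'
    have h := ((integralEq_gauss_posDef hA hs).mul_prod
      (integralEq_gauss_posDef hM hs)).mul_prod (integralEq_posCpow hb hs)
    convert! h using 1
    · ext z
      rw [← Complex.exp_add, mul_left_comm, ← Complex.exp_add]
      congr 2
      push_cast; ring
    · have e1 : (s : ℂ) ^ (-(b + 1 + d)) =
          (s : ℂ) ^ (-(((Module.finrank ℝ K * Fintype.card ι : ℝ) / 2 : ℝ) : ℂ)) *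
          (s : ℂ) ^ (-(((Module.finrank ℝ K * Fintype.card ι : ℝ) / 2 : ℝ) : ℂ)) *
          (s : ℂ) ^ (-(b + 1)) := by
        rw [← Complex.cpow_add _ _ hs0, ← Complex.cpow_add _ _ hs0]
        congr 1
        rw [hd]; push_cast; ring
      have e2 : Real.pi ^ d = Real.pi ^ ((Module.finrank ℝ K * Fintype.card ι : ℝ) / 2) *
          Real.pi ^ ((Module.finrank ℝ K * Fintype.card ι : ℝ) / 2) := by
        rw [← Real.rpow_add Real.pi_pos, ← Real.rpow_natCast, hd]
        congr 1
        push_cast; ring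
      rw [e1, e2, hD, Real.mul_rpow (re_det_pos hA).le (re_det_pos hM).le]
      push_cast
      ring
  have hre : (b + 1 + (d : ℂ)).re = b.re + 1 + d := by simp
  have hmain := IntegralEq.of_laplace (Y := ((ι → K) × (ι → K)) × ℝ) (μ := volume)
    (h := fun z => posCpow b z.2)
    (q := fun z => reForm A z.1.1 + reForm M z.1.2 + max z.2 0)
    ((measurable_posCpow b).comp measurable_snd)
    (((hAm.comp (measurable_fst.comp measurable_fst)).add
      (hMm.comp (measurable_snd.comp measurable_fst))).add
      (measurable_snd.max measurable_const))
    (fun z => add_nonneg (add_nonneg (reForm_nonneg_of_posDef hA _)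
      (reForm_nonneg_of_posDef hM _)) (le_max_right _ _))
    (a := b + 1 + d) (ρ := ρ) (C := Complex.Gamma (b + 1) * ((D * Real.pi ^ d : ℝ) : ℂ))
    (C' := Real.Gamma (b.re + 1) * (D * Real.pi ^ d)) (X := 1)
    (by have : (0 : ℝ) ≤ d := Nat.cast_nonneg d
        linarith) (by rw [hre]; exact hρ) one_pos (lap b hb) ?_
  · convert hmain using 1
    rw [Complex.ofReal_one, Complex.one_cpow, stepConst, ← hd]
    push_cast
    ring
  -- The norm of the integrand is the integrand for `Re b`, so its integral is the formula just
  -- proved for a real parameter.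
  · intro s hs
    have h := (lap (b.re : ℂ) (by simpa using hb) s hs).2
    have e : ∀ z : ((ι → K) × (ι → K)) × ℝ, posCpow (b.re : ℂ) z.2 *
        Complex.exp (-(s * (reForm A z.1.1 + reForm M z.1.2 + max z.2 0 : ℝ))) =
        ((‖posCpow b z.2 * Complex.exp (-(s * (reForm A z.1.1 + reForm M z.1.2 +
          max z.2 0 : ℝ)))‖ : ℝ) : ℂ) := fun z => by
      rw [norm_mul, Complex.ofReal_mul, norm_posCpow, norm_exp_neg_mul]
    simp_rw [e] at h
    rw [integral_complex_ofReal] at h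
    have h3 : Complex.Gamma ((b.re : ℂ) + 1) = ((Real.Gamma (b.re + 1) : ℝ) : ℂ) := by
      rw [← Complex.Gamma_ofReal]; push_cast; rfl
    have h4 : (s : ℂ) ^ (-((b.re : ℂ) + 1 + d)) = ((s ^ (-(b.re + 1 + d)) : ℝ) : ℂ) := by
      rw [Complex.ofReal_cpow hs.le]; push_cast; rfl
    rw [h3, h4, ← Complex.ofReal_mul, ← Complex.ofReal_mul] at h
    rw [hre]
    exact_mod_cast h

theorem integralEq_realKernel {T S : Matrix ι ι K} (hT : T.PosDef) (hS : Sᴴ = -S) {b σ : ℂ}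
    (hb : -1 < b.re) (hσ : b.re + 1 + (Module.finrank ℝ K * Fintype.card ι : ℕ) < σ.re) :
    IntegralEq (realKernel b σ T S) volume (stepDet T S * stepConst K ι b σ) := by
  have h := (integralEq_quadratic_step (posDef_inv_sub_inv_one_add hT) (posDef_invHermPart hT hS)
    hb hσ).comp_measurePreserving (measurePreserving_shear T S)
  rw [stepDet_eq hT hS] at h
  convert! h using 1
  ext z
  rw [realKernel]
  by_cases hz : 0 < schurT T z.1.1 z.2
  · rw [re_schurForm hT hS, max_eq_left (show 0 ≤ (shear T S z).2 from hz.le)]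
    rfl
  · rw [posCpow_of_nonpos _ hz, posCpow_of_nonpos _ (show ¬0 < (shear T S z).2 from hz),
      zero_mul, zero_mul]

/-- Both bases are positive wherever the kernel is nonzero, so taking norms replaces the exponents
by their real parts. After division by `stepDet` the bound is uniform in `T` and `S`. -/
theorem integral_norm_realKernel {T S : Matrix ι ι K} (hT : T.PosDef) (hS : Sᴴ = -S) {b σ : ℂ}
    (hb : -1 < b.re) (hσ : b.re + 1 + (Module.finrank ℝ K * Fintype.card ι : ℕ) < σ.re) :
    ∫ z, ‖realKernel b σ T S z‖ = stepDet T S * ‖stepConst K ι b.re σ.re‖ := by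
  have h := (integralEq_realKernel hT hS (b := b.re) (σ := σ.re) (by simpa using hb)
    (by simpa using hσ)).2
  have e : ∀ z, realKernel (b.re : ℂ) (σ.re : ℂ) T S z = ((‖realKernel b σ T S z‖ : ℝ) : ℂ) := by
    intro z
    by_cases hz : 0 < schurT T z.1.1 z.2
    · rw [realKernel, realKernel, norm_mul, Complex.ofReal_mul, norm_posCpow,
        norm_ofReal_cpow (one_le_re_schurForm hT hS z hz)]
      simp
    · rw [realKernel, realKernel, posCpow_of_nonpos _ hz, posCpow_of_nonpos _ hz]
      simp
  simp_rw [e] at h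
  rw [integral_complex_ofReal] at h
  have h' := congrArg norm h
  rw [norm_mul, Complex.norm_real, Complex.norm_real, Real.norm_of_nonneg (by positivity),
    Real.norm_of_nonneg (stepDet_pos hT hS).le] at h'
  exact h'

end Step

/-! ### The complex kernel: integration over the imaginary corner -/

theorem integral_norm_mul_kernel_le {α β : Type*} [MeasurableSpace α] [MeasurableSpace β]
    {μ : Measure α} {ν : Measure β} [SFinite μ] [SFinite ν] {f : α → ℂ} {g : α → β → ℂ}
    {B : ℝ} (hf : Integrable f μ)
    (hfg : Integrable (fun z : α × β => f z.1 * g z.1 z.2) (μ.prod ν))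
    (hB : ∀ x, f x ≠ 0 → ∫ y, ‖g x y‖ ∂ν ≤ B) :
    ∫ z : α × β, ‖f z.1 * g z.1 z.2‖ ∂(μ.prod ν) ≤ (∫ x, ‖f x‖ ∂μ) * B := by
  rw [integral_prod _ hfg.norm, ← integral_mul_const]
  refine integral_mono hfg.norm.integral_prod_left (hf.norm.mul_const B) fun x => ?_
  simp only [norm_mul]
  rw [integral_const_mul]
  by_cases hx : f x = 0
  · simp [hx]
  · exact mul_le_mul_of_nonneg_left (hB x hx) (norm_nonneg _)

/-- The constant of Cauchy's beta integral. -/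
noncomputable def cauchyConst (σ τ : ℂ) : ℂ :=
  2 * Real.pi * (2 : ℂ) ^ (1 - σ - τ) *
    (Complex.Gamma (σ + τ - 1) / (Complex.Gamma σ * Complex.Gamma τ))

/-- The prefactor is the power of `X` that makes the total mass independent of `X`, so that the
integration over `s` fits `IntegralEq.mul_kernel`. -/
theorem integralEq_cauchy {X : ℝ} (hX : 0 < X) {σ τ : ℂ} (h : 1 < (σ + τ).re) :
    IntegralEq (fun s : ℝ => (X : ℂ) ^ (σ + τ - 1) * cpowPair σ τ (X + s * Complex.I)) volume
      (cauchyConst σ τ) := by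
  convert! (cauchy_beta hX h).const_mul ((X : ℂ) ^ (σ + τ - 1)) using 1
  have h2 : ((2 * X : ℝ) : ℂ) ^ (1 - σ - τ) = (2 : ℂ) ^ (1 - σ - τ) * (X : ℂ) ^ (1 - σ - τ) := by
    rw [Complex.ofReal_mul, Complex.mul_cpow_ofReal_nonneg (by norm_num) hX.le]
    norm_num
  have h3 : (X : ℂ) ^ (σ + τ - 1) * (X : ℂ) ^ (1 - σ - τ) = 1 := by
    rw [← Complex.cpow_add _ _ (by exact_mod_cast hX.ne')]
    ring_nf
    simp
  rw [cauchyConst, h2]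
  linear_combination (-(2 * Real.pi * (2 : ℂ) ^ (1 - σ - τ) *
    (Complex.Gamma (σ + τ - 1) / (Complex.Gamma σ * Complex.Gamma τ)))) * h3

/-- A bound for the `L¹` norm of the normalised Cauchy kernel. -/
noncomputable def cauchyBound (σ τ : ℂ) : ℝ :=
  Real.exp (Real.pi * (|σ.im| + |τ.im|)) *
    ‖cauchyConst (((σ + τ).re / 2 : ℝ) : ℂ) (((σ + τ).re / 2 : ℝ) : ℂ)‖

/-- By `norm_cpowPair_le` the norm is at most a constant times `‖z‖^(-ρ)` with `ρ = Re (σ + τ)`,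
which is the Cauchy integrand with both exponents `ρ / 2`. -/
theorem integral_norm_cauchy_le {X : ℝ} (hX : 0 < X) {σ τ : ℂ} (h : 1 < (σ + τ).re) :
    ∫ s : ℝ, ‖(X : ℂ) ^ (σ + τ - 1) * cpowPair σ τ (X + s * Complex.I)‖ ≤ cauchyBound σ τ := by
  set ρ : ℝ := (σ + τ).re with hρ
  have hz : ∀ s : ℝ, 0 < ((X : ℂ) + s * Complex.I).re := fun s => by simpa using hX
  have h0 : (((ρ / 2 : ℝ) : ℂ) + ((ρ / 2 : ℝ) : ℂ)).re = ρ := by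
    rw [Complex.add_re, Complex.ofReal_re]; ring
  have hc := integralEq_cauchy hX (σ := ((ρ / 2 : ℝ) : ℂ)) (τ := ((ρ / 2 : ℝ) : ℂ))
    (by rw [h0]; exact h)
  have e : ∀ s : ℝ, (X : ℂ) ^ (((ρ / 2 : ℝ) : ℂ) + ((ρ / 2 : ℝ) : ℂ) - 1) *
      cpowPair ((ρ / 2 : ℝ) : ℂ) ((ρ / 2 : ℝ) : ℂ) (X + s * Complex.I) =
      ((X ^ (ρ - 1) * ‖(X : ℂ) + s * Complex.I‖ ^ (-ρ) : ℝ) : ℂ) := fun s => by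
    rw [cpowPair_ofReal (hz s), Complex.ofReal_mul, Complex.ofReal_cpow hX.le]
    congr 2
    push_cast; ring
  obtain ⟨-, hv⟩ := hc
  simp_rw [e] at hv
  rw [integral_complex_ofReal] at hv
  have hv' := congrArg norm hv
  rw [Complex.norm_real, Real.norm_of_nonneg (integral_nonneg fun s => by positivity)] at hv'
  rw [cauchyBound, ← hρ, ← hv', ← integral_const_mul]
  refine integral_mono ((integralEq_cauchy hX h).1.norm)
    (((integrable_norm_add_mul_I hX h).const_mul _).const_mul _) fun s => ?_
  simp only
  rw [norm_mul, Complex.norm_cpow_eq_rpow_re_of_pos hX, mul_left_comm]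
  have : (σ + τ - 1).re = ρ - 1 := by simp [hρ]
  rw [this]
  exact mul_le_mul_of_nonneg_left (norm_cpowPair_le (hz s)) (by positivity)

section Step

variable {K : Type*} [RCLike K] {ι : Type*} [Fintype ι] [DecidableEq ι]

theorem continuous_schurForm (T S : Matrix ι ι K) : Continuous (schurForm T S) := by
  unfold schurForm
  refine Continuous.dotProduct ?_ (continuous_const.matrix_mulVec ?_)
  · exact continuous_star.comp (continuous_fst.sub continuous_snd)
  · exact continuous_fst.add continuous_snd

variable [MeasureSpace K] [BorelSpace K] [(volume : Measure K).IsAddHaarMeasure]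
  [SigmaFinite (volume : Measure K)] [LebesgueField K]

/-- For fixed `v`, `w`, `t`, the variable `s` runs over a vertical line with abscissa `X = Re c`.
Cauchy's integral turns the pair of powers into `X^(-(σ+τ-1))`, which is the real kernel with
exponent `σ + τ - 1`. -/
theorem integralEq_cplxKernel {T S : Matrix ι ι K} (hT : T.PosDef) (hS : Sᴴ = -S) {b σ τ : ℂ}
    (hb : -1 < b.re)
    (hσ : b.re + 1 + (Module.finrank ℝ K * Fintype.card ι : ℕ) < (σ + τ - 1).re) :
    IntegralEq (cplxKernel b σ τ T S) volume
      (stepDet T S * (stepConst K ι b (σ + τ - 1) * cauchyConst σ τ)) ∧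
    ∫ z, ‖cplxKernel b σ τ T S z‖ ≤
      stepDet T S * (‖stepConst K ι b.re ((σ + τ - 1).re : ℂ)‖ * cauchyBound σ τ) := by
  have hστ : 1 < (σ + τ).re := by
    have : (0 : ℝ) ≤ (Module.finrank ℝ K * Fintype.card ι : ℕ) := Nat.cast_nonneg _
    simp only [Complex.sub_re, Complex.one_re] at hσ
    linarith
  set X : ((ι → K) × (ι → K)) × ℝ → ℝ := fun z => 1 + z.2 - RCLike.re (schurForm T S z.1) with hX
  set Y : ((ι → K) × (ι → K)) × ℝ → ℝ := fun z => RCLike.im (schurForm T S z.1) with hY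
  set g : ((ι → K) × (ι → K)) × ℝ → ℝ → ℂ := fun z s =>
    (X z : ℂ) ^ (σ + τ - 1) * cpowPair σ τ (X z + ((s - Y z : ℝ) : ℂ) * Complex.I) with hg
  have hsc := continuous_schurForm T S
  have hXm : Measurable X := by
    have : Continuous X := (continuous_const.add continuous_snd).sub
      (RCLike.continuous_re.comp (hsc.comp continuous_fst))
    exact this.measurable
  have hYm : Measurable Y := by
    have : Continuous Y := RCLike.continuous_im.comp (hsc.comp continuous_fst)
    exact this.measurable
  have hgm : Measurable (Function.uncurry g) := by
    have h1 : Measurable fun p : (((ι → K) × (ι → K)) × ℝ) × ℝ => X p.1 := hXm.comp measurable_fst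
    have h2 : Measurable fun p : (((ι → K) × (ι → K)) × ℝ) × ℝ => Y p.1 := hYm.comp measurable_fst
    have h3 := measurable_cpowPair σ τ
    simp only [hg, Function.uncurry_def]
    fun_prop
  have hpos : ∀ z, realKernel b (σ + τ - 1) T S z ≠ 0 → 0 < X z := fun z hz => by
    by_cases h0 : 0 < schurT T z.1.1 z.2
    · exact one_le_re_schurForm hT hS z h0
    · exact absurd (by rw [realKernel, posCpow_of_nonpos _ h0, zero_mul]) hz
  -- The imaginary part of the quadratic expression only translates `s`.
  have hgd : ∀ z, realKernel b (σ + τ - 1) T S z ≠ 0 →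
      IntegralEq (g z) volume (cauchyConst σ τ) := fun z hz => by
    have h := integralEq_cauchy (hpos z hz) hστ
    refine ⟨h.1.comp_sub_right (Y z), ?_⟩
    rw [← h.2]
    exact integral_sub_right_eq_self (fun s : ℝ => (X z : ℂ) ^ (σ + τ - 1) *
      cpowPair σ τ (X z + s * Complex.I)) (Y z)
  have hgB : ∀ z, realKernel b (σ + τ - 1) T S z ≠ 0 →
      ∫ s, ‖g z s‖ ≤ cauchyBound σ τ := fun z hz => by
    refine le_of_eq_of_le ?_ (integral_norm_cauchy_le (hpos z hz) hστ)
    exact integral_sub_right_eq_self (fun s : ℝ => ‖(X z : ℂ) ^ (σ + τ - 1) *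
      cpowPair σ τ (X z + s * Complex.I)‖) (Y z)
  have hf := integralEq_realKernel hT hS hb hσ
  have hfg := hf.mul_kernel hgm hgd hgB
  have hle := integral_norm_mul_kernel_le hf.1 hfg.1 hgB
  rw [integral_norm_realKernel hT hS hb hσ, mul_assoc] at hle
  have e : (fun z : (((ι → K) × (ι → K)) × ℝ) × ℝ =>
      realKernel b (σ + τ - 1) T S z.1 * g z.1 z.2) = cplxKernel b σ τ T S := by
    ext z
    by_cases h0 : 0 < schurT T z.1.1.1 z.1.2
    · have hXp : 0 < X z.1 := one_le_re_schurForm hT hS z.1 h0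
      have h3 : (X z.1 : ℂ) ^ (-(σ + τ - 1)) * (X z.1 : ℂ) ^ (σ + τ - 1) = 1 := by
        rw [← Complex.cpow_add _ _ (by exact_mod_cast hXp.ne')]
        simp
      simp only [realKernel, cplxKernel, hg]
      rw [← mul_assoc, mul_assoc (posCpow _ _)]
      change posCpow b (schurT T z.1.1.1 z.1.2) * ((X z.1 : ℂ) ^ (-(σ + τ - 1)) * _) * _ = _
      rw [h3, mul_one]
    · rw [realKernel, cplxKernel, posCpow_of_nonpos _ h0]
      simp
  rw [e, mul_assoc] at hfg
  refine ⟨hfg, ?_⟩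
  rw [← e]
  exact hle

end Step

/-! ### The logarithm of the determinant as a continuous branch -/

theorem logDet_submatrix_equiv {m l : Type*} [Fintype m] [DecidableEq m] [Fintype l]
    [DecidableEq l] (A : Matrix m m ℂ) (e : l ≃ m) : logDet (A.submatrix e e) = logDet A := by
  have := Matrix.charpoly_reindex e.symm A
  rw [Matrix.reindex_apply, Equiv.symm_symm] at this
  rw [logDet, logDet, this]

section LogDet

variable {m : Type*} [Fintype m] [DecidableEq m]

theorem reForm_one_pos {K : Type*} [RCLike K] {x : m → K} (hx : x ≠ 0) :
    0 < reForm (1 : Matrix m m K) x := reForm_pos_of_posDef Matrix.PosDef.one hx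

theorem reForm_smul {m : Type*} [Fintype m] {K : Type*} [RCLike K] (s : ℝ) (A : Matrix m m K) (x : m → K) :
    reForm ((s : K) • A) x = s * reForm A x := by
  rw [reForm, Matrix.smul_mulVec, dotProduct_smul, smul_eq_mul, RCLike.re_ofReal_mul, reForm]

theorem reForm_path_pos {K : Type*} [RCLike K] {A : Matrix m m K}
    (hA : ∀ x, x ≠ 0 → 0 < reForm A x) {s : ℝ} (hs : s ∈ Set.Icc (0 : ℝ) 1) {x : m → K}
    (hx : x ≠ 0) : 0 < reForm (1 + (s : K) • (A - 1)) x := by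
  have e : (1 : Matrix m m K) + (s : K) • (A - 1) = ((1 - s : ℝ) : K) • 1 + (s : K) • A := by
    rw [smul_sub, RCLike.ofReal_sub, RCLike.ofReal_one, sub_smul, one_smul]; abel
  rw [e, reForm_add, reForm_smul, reForm_smul]
  have h1 := hA x hx
  have h2 := reForm_one_pos hx
  rcases eq_or_lt_of_le hs.1 with h | h
  · rw [← h]; linarith
  · have := mul_pos h h1
    have := mul_nonneg (sub_nonneg.2 hs.2) h2.le
    linarith

/-- Pairing `Ax = μx` with `x` gives `Re (x*Ax) = Re μ · ‖x‖²`. -/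
theorem re_root_pos {A : Matrix m m ℂ} (hA : ∀ x, x ≠ 0 → 0 < reForm A x) {μ : ℂ}
    (hμ : μ ∈ A.charpoly.roots) : 0 < μ.re := by
  have h := (Polynomial.mem_roots'.1 hμ).2
  rw [Polynomial.IsRoot, Matrix.eval_charpoly] at h
  obtain ⟨x, hx, hx0⟩ := Matrix.exists_mulVec_eq_zero_iff.2 h
  rw [Matrix.sub_mulVec, sub_eq_zero] at hx0
  have h1 : A *ᵥ x = μ • x := by
    rw [← hx0]; ext i; simp [Matrix.scalar_apply, Matrix.mulVec_diagonal]
  have h2 := hA x hx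
  have h3 := reForm_one_pos hx
  have h4 : star x ⬝ᵥ x = ((reForm (1 : Matrix m m ℂ) x : ℝ) : ℂ) := by
    rw [reForm_one, dotProduct]
    push_cast
    refine Finset.sum_congr rfl fun i _ => ?_
    rw [Pi.star_apply, RCLike.star_def, RCLike.conj_mul]; rfl
  rw [reForm, h1, dotProduct_smul, smul_eq_mul, h4] at h2
  have h5 : RCLike.re (μ * ((reForm (1 : Matrix m m ℂ) x : ℝ) : ℂ)) =
      μ.re * reForm (1 : Matrix m m ℂ) x := by
    change (μ * ((reForm (1 : Matrix m m ℂ) x : ℝ) : ℂ)).re = _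
    rw [Complex.re_mul_ofReal]
  rw [h5] at h2
  exact pos_of_mul_pos_left h2 h3.le

theorem det_path (A : Matrix m m ℂ) (s : ℂ) :
    (1 + s • (A - 1)).det = (A.charpoly.roots.map fun μ => 1 + s * (μ - 1)).prod := by
  have hsp : A.charpoly.Splits := IsAlgClosed.splits _
  have hcard : A.charpoly.roots.card = Fintype.card m := by
    rw [← hsp.natDegree_eq_card_roots, Matrix.charpoly_natDegree_eq_dim]
  by_cases hs : s = 0
  · simp [hs]
  · have h1 : (1 : Matrix m m ℂ) + s • (A - 1) =
        (-s) • (Matrix.scalar m (1 - s⁻¹) - A) := by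
      have : Matrix.scalar m (1 - s⁻¹) = (1 - s⁻¹) • (1 : Matrix m m ℂ) := by
        rw [Matrix.scalar_apply, Matrix.smul_one_eq_diagonal]
      rw [this, smul_sub, smul_sub, smul_smul, neg_smul, sub_neg_eq_add]
      have : -s * (1 - s⁻¹) = 1 - s := by field_simp; ring
      rw [this, sub_smul, one_smul]; abel
    rw [h1, Matrix.det_smul, ← Matrix.eval_charpoly, hsp.eval_eq_prod_roots_of_monic
      (Matrix.charpoly_monic A), ← hcard]
    have h2 : ∀ μ : ℂ, 1 + s * (μ - 1) = -s * (1 - s⁻¹ - μ) := fun μ => by field_simp; ring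
    simp_rw [h2]
    rw [Multiset.prod_map_mul, Multiset.map_const', Multiset.prod_replicate]

/-- A continuous function on `[0, 1]` with values in `ℤ` that vanishes at `0` vanishes at `1`. -/
theorem eq_zero_of_continuousOn_int {g : ℝ → ℝ} (hg : ContinuousOn g (Set.Icc 0 1))
    (hi : ∀ s ∈ Set.Icc (0 : ℝ) 1, ∃ k : ℤ, g s = k) (h0 : g 0 = 0) : g 1 = 0 := by
  obtain ⟨k, hk⟩ := hi 1 (by simp)
  by_contra hne
  have hk0 : k ≠ 0 := by rintro rfl; simp [hk] at hne
  have hhalf : ∀ s ∈ Set.Icc (0 : ℝ) 1, g s ≠ 1 / 2 ∧ g s ≠ -1 / 2 := by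
    intro s hs
    obtain ⟨j, hj⟩ := hi s hs
    rw [hj]
    constructor
    · intro h
      have : (2 * j : ℝ) = 1 := by rw [h]; norm_num
      have : 2 * j = 1 := by exact_mod_cast this
      omega
    · intro h
      have : (2 * j : ℝ) = -1 := by rw [h]; norm_num
      have : 2 * j = -1 := by exact_mod_cast this
      omega
  rcases lt_or_gt_of_ne hk0 with h | h
  · have h1 : (k : ℝ) ≤ -1 := by exact_mod_cast (by omega : k ≤ -1)
    obtain ⟨s, hs, hs'⟩ := intermediate_value_Icc' zero_le_one hg
      (show (-1 / 2 : ℝ) ∈ Set.Icc (g 1) (g 0) by rw [hk, h0]; constructor <;> linarith)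
    exact (hhalf s hs).2 hs'
  · have h1 : (1 : ℝ) ≤ k := by exact_mod_cast (by omega : 1 ≤ k)
    obtain ⟨s, hs, hs'⟩ := intermediate_value_Icc zero_le_one hg
      (show (1 / 2 : ℝ) ∈ Set.Icc (g 0) (g 1) by rw [hk, h0]; constructor <;> linarith)
    exact (hhalf s hs).1 hs'

/-- The logarithm of `det (1 + s (A - 1))` along the segment from `1` to `A`. -/
noncomputable def logDetPath (A : Matrix m m ℂ) (s : ℝ) : ℂ :=
  (A.charpoly.roots.map fun μ => Complex.log (1 + s * (μ - 1))).sum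

theorem re_one_add_mul_pos {μ : ℂ} (hμ : 0 < μ.re) {s : ℝ} (hs : s ∈ Set.Icc (0 : ℝ) 1) :
    0 < (1 + s * (μ - 1)).re := by
  have e : (1 + s * (μ - 1)).re = (1 - s) + s * μ.re := by simp; ring
  rw [e]
  rcases eq_or_lt_of_le hs.1 with h | h
  · rw [← h]; norm_num
  · have := mul_pos h hμ
    linarith [hs.2]

theorem logDetPath_zero (A : Matrix m m ℂ) : logDetPath A 0 = 0 := by simp [logDetPath]

theorem logDetPath_one (A : Matrix m m ℂ) : logDetPath A 1 = logDet A := by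
  simp [logDetPath, logDet]

theorem exp_logDetPath {A : Matrix m m ℂ} (hA : ∀ x, x ≠ 0 → 0 < reForm A x) {s : ℝ}
    (hs : s ∈ Set.Icc (0 : ℝ) 1) :
    Complex.exp (logDetPath A s) = (1 + (s : ℂ) • (A - 1)).det := by
  rw [logDetPath, Complex.exp_multiset_sum, Multiset.map_map, det_path]
  congr 1
  refine Multiset.map_congr rfl fun μ hμ => ?_
  have := re_one_add_mul_pos (re_root_pos hA hμ) hs
  rw [Function.comp_apply, Complex.exp_log]
  intro h
  rw [h] at this
  simp at this

theorem continuousOn_logDetPath {A : Matrix m m ℂ} (hA : ∀ x, x ≠ 0 → 0 < reForm A x) :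
    ContinuousOn (logDetPath A) (Set.Icc 0 1) := by
  have key : ∀ r : Multiset ℂ, (∀ μ ∈ r, 0 < μ.re) →
      ContinuousOn (fun s : ℝ => (r.map fun μ => Complex.log (1 + s * (μ - 1))).sum)
        (Set.Icc 0 1) := by
    intro r
    induction r using Multiset.induction with
    | empty => intro _; simpa using continuousOn_const
    | cons μ r ih =>
      intro h
      simp only [Multiset.map_cons, Multiset.sum_cons]
      refine ContinuousOn.add ?_ (ih fun ν hν => h ν (Multiset.mem_cons_of_mem hν))
      refine ContinuousOn.clog (by fun_prop) fun s hs => Or.inl ?_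
      exact re_one_add_mul_pos (h μ (Multiset.mem_cons_self μ r)) hs
  exact key _ fun μ hμ => re_root_pos hA hμ

/-- `logDet A` is determined by the continuous logarithm of the determinant along the segment
from `1` to `A`. -/
theorem logDet_eq_of_path {A : Matrix m m ℂ} (hA : ∀ x, x ≠ 0 → 0 < reForm A x) {ℓ : ℝ → ℂ}
    (hℓ : ContinuousOn ℓ (Set.Icc 0 1)) (h0 : ℓ 0 = 0)
    (hexp : ∀ s ∈ Set.Icc (0 : ℝ) 1, Complex.exp (ℓ s) = (1 + (s : ℂ) • (A - 1)).det) :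
    logDet A = ℓ 1 := by
  have hpi : (Real.pi : ℂ) ≠ 0 := by exact_mod_cast Real.pi_ne_zero
  have hper : ∀ s ∈ Set.Icc (0 : ℝ) 1, ∃ k : ℤ,
      logDetPath A s = ℓ s + k * (2 * Real.pi * Complex.I) := fun s hs =>
    Complex.exp_eq_exp_iff_exists_int.1 ((exp_logDetPath hA hs).trans (hexp s hs).symm)
  -- Two logarithms of the same determinant differ by `2πi k`; along the segment `k` is continuous,
  -- and it vanishes at `s = 0`.
  have hz := eq_zero_of_continuousOn_int
    (g := fun s => (logDetPath A s - ℓ s).im / (2 * Real.pi)) ?_ ?_ ?_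
  · obtain ⟨k, hk⟩ := hper 1 (by simp)
    rw [logDetPath_one] at hk
    simp only [logDetPath_one, hk, add_sub_cancel_left] at hz
    have : (k : ℝ) = 0 := by
      have e : ((k : ℂ) * (2 * Real.pi * Complex.I)).im = k * (2 * Real.pi) := by simp
      rw [e] at hz
      have := Real.pi_pos
      field_simp at hz
      exact hz
    have : k = 0 := by exact_mod_cast this
    rw [hk, this]; simp
  · exact (Complex.continuous_im.comp_continuousOn
      ((continuousOn_logDetPath hA).sub hℓ)).div_const _
  · intro s hs
    obtain ⟨k, hk⟩ := hper s hs
    refine ⟨k, ?_⟩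
    have e : (logDetPath A s - ℓ s).im = k * (2 * Real.pi) := by rw [hk]; simp
    rw [e]
    have := Real.pi_pos
    field_simp
  · simp [logDetPath_zero, h0]

theorem exp_logDet {A : Matrix m m ℂ} (hA : ∀ x, x ≠ 0 → 0 < reForm A x) :
    Complex.exp (logDet A) = A.det := by
  rw [← logDetPath_one, exp_logDetPath hA (by simp)]
  simp

theorem toC_eq_ofReal_mapMatrix (A : Matrix m m ℝ) :
    toC A = Complex.ofRealHom.mapMatrix A := rfl

theorem det_toC (A : Matrix m m ℝ) : (toC A).det = ((A.det : ℝ) : ℂ) := by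
  rw [toC_eq_ofReal_mapMatrix, ← RingHom.map_det]; rfl

theorem toC_path (A : Matrix m m ℝ) (s : ℝ) :
    1 + (s : ℂ) • (toC A - 1) = toC (1 + s • (A - 1)) := by
  have : (s : ℂ) • toC A = toC (s • A) := by ext i j; simp [toC]
  simp only [smul_sub, toC_eq_ofReal_mapMatrix, map_add, map_sub, map_one] at this ⊢
  rw [this]
  congr 2
  ext i j
  by_cases h : i = j
  · subst h; simp
  · simp [h]

theorem reForm_toC {m : Type*} [Fintype m] (A : Matrix m m ℝ) (x : m → ℂ) :
    reForm (toC A) x = reForm A (fun i => (x i).re) + reForm A (fun i => (x i).im) := by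
  simp only [reForm, dotProduct, Matrix.mulVec, Finset.mul_sum, map_sum, ← Finset.sum_add_distrib]
  refine Finset.sum_congr rfl fun i _ => Finset.sum_congr rfl fun j _ => ?_
  simp [toC]

theorem reForm_toC_pos {m : Type*} [Fintype m] {A : Matrix m m ℝ} (hA : ∀ x, x ≠ 0 → 0 < reForm A x) {x : m → ℂ}
    (hx : x ≠ 0) : 0 < reForm (toC A) x := by
  have hnn : ∀ y, 0 ≤ reForm A y := fun y => by
    by_cases hy : y = 0
    · simp [hy, reForm]
    · exact (hA y hy).le
  rw [reForm_toC]
  by_cases hre : (fun i => (x i).re) = 0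
  · have him : (fun i => (x i).im) ≠ 0 := fun him => hx (funext fun i =>
      Complex.ext (congrFun hre i) (congrFun him i))
    linarith [hA _ him, hnn fun i => (x i).re]
  · linarith [hA _ hre, hnn fun i => (x i).im]

/-- The segment from `1` to `A` consists of invertible matrices, so the real determinant cannot
change sign on it. -/
theorem det_pos_of_reForm_pos {A : Matrix m m ℝ} (hA : ∀ x, x ≠ 0 → 0 < reForm A x) :
    0 < A.det := by
  have hc : ContinuousOn (fun s : ℝ => (1 + s • (A - 1)).det) (Set.Icc 0 1) := by
    apply Continuous.continuousOn
    exact Continuous.matrix_det (by fun_prop)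
  by_contra hn
  have h0 : (0 : ℝ) ∈ Set.Icc ((1 + (1 : ℝ) • (A - 1)).det) ((1 + (0 : ℝ) • (A - 1)).det) := by
    simp only [one_smul, add_sub_cancel, zero_smul, add_zero, Matrix.det_one]
    exact ⟨not_lt.1 hn, zero_le_one⟩
  obtain ⟨s, hs, hs0⟩ := intermediate_value_Icc' zero_le_one hc h0
  exact det_ne_zero_of_reForm_pos (fun x hx => reForm_path_pos hA hs hx) hs0

/-- Along the segment from `1` the determinant stays positive, so its real logarithm is the
continuous branch, even when the eigenvalues are not real. -/
theorem logDet_toC {A : Matrix m m ℝ} (hA : ∀ x, x ≠ 0 → 0 < reForm A x) :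
    logDet (toC A) = ((Real.log A.det : ℝ) : ℂ) := by
  have hpos : ∀ s ∈ Set.Icc (0 : ℝ) 1, 0 < (1 + s • (A - 1)).det := fun s hs =>
    det_pos_of_reForm_pos fun x hx => reForm_path_pos hA hs hx
  have h := logDet_eq_of_path (fun x hx => reForm_toC_pos hA hx)
    (ℓ := fun s => ((Real.log (1 + s • (A - 1)).det : ℝ) : ℂ)) ?_ ?_ ?_
  · simpa using h
  · refine Complex.continuous_ofReal.comp_continuousOn (ContinuousOn.log ?_ fun s hs =>
      (hpos s hs).ne')
    exact (Continuous.matrix_det (by fun_prop)).continuousOn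
  · simp
  · intro s hs
    rw [toC_path, det_toC, ← Complex.ofReal_exp, Real.exp_log (hpos s hs)]

end LogDet

/-! ### Splitting off the last block: Schur complements -/

section Blocks

variable {n : ℕ} {K : Type*} [RCLike K]

/-- The inclusion of the first `n` block rows. -/
def upIdx (p : BlockIdx n) : BlockIdx (n + 1) := (p.1.castSucc, p.2)

/-- The last block row. -/
def lastIdx (e : Fin 2) : BlockIdx (n + 1) := (Fin.last n, e)

/-- The splitting of the block rows into the first `n` and the last one. -/
noncomputable def blockEquiv (n : ℕ) : BlockIdx n ⊕ Fin 2 ≃ BlockIdx (n + 1) :=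
  Equiv.ofBijective (Sum.elim upIdx lastIdx) (by
    constructor
    · rintro (⟨a, e⟩ | e) (⟨b, f⟩ | f) h
      · simp only [Sum.elim_inl, upIdx, Prod.mk.injEq, Fin.castSucc_inj] at h
        simp [h.1, h.2]
      · simp only [Sum.elim_inl, Sum.elim_inr, upIdx, lastIdx, Prod.mk.injEq] at h
        exact absurd h.1 (Fin.castSucc_lt_last a).ne
      · simp only [Sum.elim_inl, Sum.elim_inr, upIdx, lastIdx, Prod.mk.injEq] at h
        exact absurd h.1 (Fin.castSucc_lt_last b).ne'
      · simp only [Sum.elim_inr, lastIdx, Prod.mk.injEq] at h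
        simp [h.2]
    · rintro ⟨a, e⟩
      refine Fin.lastCases ⟨Sum.inr e, rfl⟩ (fun b => ⟨Sum.inl (b, e), rfl⟩) a)

/-- The left upper block obtained by deleting the last block row and column. -/
def restr {α : Type*} (R : Matrix (BlockIdx (n + 1)) (BlockIdx (n + 1)) α) :
    Matrix (BlockIdx n) (BlockIdx n) α := R.submatrix upIdx upIdx

/-- The Schur complement of `restr R` in `R`. -/
noncomputable def schurCompl (R : Matrix (BlockIdx (n + 1)) (BlockIdx (n + 1)) K) :
    Matrix (Fin 2) (Fin 2) K :=
  R.submatrix lastIdx lastIdx - R.submatrix lastIdx upIdx * (restr R)⁻¹ * R.submatrix upIdx lastIdx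

theorem blockEquiv_inl (p : BlockIdx n) : blockEquiv n (Sum.inl p) = upIdx p := rfl

theorem blockEquiv_inr (e : Fin 2) : blockEquiv n (Sum.inr e) = lastIdx e := rfl

theorem submatrix_blockEquiv {α : Type*} (R : Matrix (BlockIdx (n + 1)) (BlockIdx (n + 1)) α) :
    R.submatrix (blockEquiv n) (blockEquiv n) =
      Matrix.fromBlocks (restr R) (R.submatrix upIdx lastIdx) (R.submatrix lastIdx upIdx)
        (R.submatrix lastIdx lastIdx) := by
  ext (i | i) (j | j) <;> rfl

theorem matJ_mul_self : matJ n K * matJ n K = -1 := by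
  have h2 : (!![0, -1; 1, 0] : Matrix (Fin 2) (Fin 2) K) * !![0, -1; 1, 0] = (-1 : K) • 1 := by
    ext i j; fin_cases i <;> fin_cases j <;> simp
  rw [matJ, ← Matrix.mul_kronecker_mul, h2, Matrix.kronecker_smul]
  simp

theorem matJ_inv : (matJ n K)⁻¹ = -matJ n K := by
  apply Matrix.inv_eq_left_inv
  rw [neg_mul, matJ_mul_self, neg_neg]

theorem selfAdj_iff (R : Matrix (BlockIdx n) (BlockIdx n) K) :
    (matJ n K)⁻¹ * Rᵀ * matJ n K = R ↔ Rᵀ = -(matJ n K * R * matJ n K) := by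
  rw [matJ_inv]
  constructor
  · intro h
    conv_rhs => rw [← h]
    have : matJ n K * (-matJ n K * Rᵀ * matJ n K) * matJ n K =
        -((matJ n K * matJ n K) * Rᵀ * (matJ n K * matJ n K)) := by noncomm_ring
    rw [this, matJ_mul_self]; simp
  · intro h
    rw [h]
    have : -matJ n K * -(matJ n K * R * matJ n K) * matJ n K =
        ((matJ n K * matJ n K) * R * (matJ n K * matJ n K)) := by noncomm_ring
    rw [this, matJ_mul_self]; simp

/-- Matrices that are self-adjoint for the form with matrix `J`. -/
def SelfAdj (R : Matrix (BlockIdx n) (BlockIdx n) K) : Prop :=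
  Rᵀ = -(matJ n K * R * matJ n K)

theorem SelfAdj.one : SelfAdj (1 : Matrix (BlockIdx n) (BlockIdx n) K) := by
  rw [SelfAdj, mul_one, matJ_mul_self]; simp

theorem SelfAdj.add {R R' : Matrix (BlockIdx n) (BlockIdx n) K} (h : SelfAdj R)
    (h' : SelfAdj R') : SelfAdj (R + R') := by
  rw [SelfAdj] at *
  rw [Matrix.transpose_add, h, h', mul_add, add_mul, neg_add]

theorem SelfAdj.smul {R : Matrix (BlockIdx n) (BlockIdx n) K} (h : SelfAdj R) (c : K) :
    SelfAdj (c • R) := by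
  rw [SelfAdj] at *
  rw [Matrix.transpose_smul, h, Matrix.mul_smul, Matrix.smul_mul, smul_neg]

theorem SelfAdj.sub {R R' : Matrix (BlockIdx n) (BlockIdx n) K} (h : SelfAdj R)
    (h' : SelfAdj R') : SelfAdj (R - R') := by
  have := h.add (h'.smul (-1))
  rwa [neg_smul, one_smul, ← sub_eq_add_neg] at this

theorem matJ_submatrix : (matJ (n + 1) K).submatrix (blockEquiv n) (blockEquiv n) =
    Matrix.fromBlocks (matJ n K) 0 0 !![0, -1; 1, 0] := by
  ext (⟨a, e⟩ | e) (⟨b, f⟩ | f)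
  · simp [blockEquiv_inl, matJ, upIdx, Matrix.one_apply]
  · simp [blockEquiv_inl, blockEquiv_inr, matJ, upIdx, lastIdx,
      (Fin.castSucc_lt_last a).ne]
  · simp [blockEquiv_inl, blockEquiv_inr, matJ, upIdx, lastIdx,
      (Fin.castSucc_lt_last b).ne']
  · simp [blockEquiv_inr, matJ, lastIdx]

/-- In the splitting `J` is block diagonal with blocks `J` and `E`, so the Schur complement `X`
inherits the symmetry `Xᵗ = -EXE`. In size `2` this is the condition that `X` equals its adjugate,
so `X` is scalar. -/
theorem schurCompl_eq_smul {R : Matrix (BlockIdx (n + 1)) (BlockIdx (n + 1)) K}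
    (hR : SelfAdj R) : schurCompl R = schurCompl R 0 0 • 1 := by
  set A := restr R with hA
  set B := R.submatrix upIdx (lastIdx (n := n)) with hB
  set C := R.submatrix (lastIdx (n := n)) upIdx with hC
  set D := R.submatrix (lastIdx (n := n)) lastIdx with hD
  set J := matJ n K with hJ
  obtain ⟨E, hE⟩ : ∃ E : Matrix (Fin 2) (Fin 2) K, E = !![0, -1; 1, 0] := ⟨_, rfl⟩
  have E00 : E 0 0 = 0 := by simp [hE]
  have E01 : E 0 1 = -1 := by simp [hE]
  have E10 : E 1 0 = 1 := by simp [hE]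
  have E11 : E 1 1 = 0 := by simp [hE]
  have hJJ : J * J = -1 := matJ_mul_self
  have hblk : Matrix.fromBlocks Aᵀ Cᵀ Bᵀ Dᵀ =
      Matrix.fromBlocks (-(J * A * J)) (-(J * B * E)) (-(E * C * J)) (-(E * D * E)) := by
    have h := congrArg (fun M => Matrix.submatrix M (blockEquiv n) (blockEquiv n)) hR
    simp only [Matrix.submatrix_neg, Pi.neg_apply] at h
    rw [← Matrix.submatrix_mul_equiv _ _ _ (blockEquiv n), ← Matrix.submatrix_mul_equiv _ _ _
      (blockEquiv n), matJ_submatrix, ← Matrix.transpose_submatrix, submatrix_blockEquiv,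
      Matrix.fromBlocks_transpose, Matrix.fromBlocks_multiply, Matrix.fromBlocks_multiply,
      Matrix.fromBlocks_neg, ← hE] at h
    simp only [Matrix.mul_zero, Matrix.zero_mul, add_zero, zero_add] at h
    exact h
  obtain ⟨h1, h2, h3, h4⟩ := Matrix.fromBlocks_inj.1 hblk
  have hJinv : J⁻¹ = -J := matJ_inv
  have hAinv : (Aᵀ)⁻¹ = -(J * A⁻¹ * J) := by
    have e : -(J * A * J) = (-J) * (A * J) := by noncomm_ring
    have hnJ : (-J)⁻¹ = J := Matrix.inv_eq_left_inv (by rw [mul_neg, hJJ, neg_neg])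
    rw [h1, e, Matrix.mul_inv_rev, Matrix.mul_inv_rev, hJinv, hnJ]
    noncomm_ring
  have hX : (schurCompl R)ᵀ = -(E * schurCompl R * E) := by
    have e : (schurCompl R) = D - C * A⁻¹ * B := rfl
    rw [e, Matrix.transpose_sub, Matrix.transpose_mul, Matrix.transpose_mul,
      Matrix.transpose_nonsing_inv, hAinv, h2, h3, h4]
    have : -(E * C * J) * (-(J * A⁻¹ * J) * -(J * B * E)) =
        -(E * C * (J * J) * A⁻¹ * (J * J) * B * E) := by
      simp only [Matrix.mul_assoc, neg_neg, Matrix.neg_mul, Matrix.mul_neg]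
    rw [this, hJJ]
    simp only [Matrix.mul_sub, Matrix.sub_mul, Matrix.mul_neg, Matrix.neg_mul, Matrix.mul_one,
      Matrix.mul_assoc, neg_neg, sub_neg_eq_add, neg_sub]
    abel
  -- Entrywise, the diagonal entries agree and each off-diagonal entry equals its negative.
  have hent : ∀ i j, (schurCompl R)ᵀ i j = (-(E * schurCompl R * E)) i j := fun i j => by rw [hX]
  have h00 := hent 0 0
  have h01 := hent 0 1
  have h10 := hent 1 0
  simp [E00, E01, E10, E11, Matrix.mul_apply, Fin.sum_univ_two] at h00 h01 h10
  ext i j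
  fin_cases i <;> fin_cases j
  · simp
  · have : (2 : K) * schurCompl R 0 1 = 0 := by linear_combination h10
    simpa using this
  · have : (2 : K) * schurCompl R 1 0 = 0 := by linear_combination h01
    simpa using this
  · simpa using h00.symm

theorem restr_add (A B : Matrix (BlockIdx (n + 1)) (BlockIdx (n + 1)) K) :
    restr (A + B) = restr A + restr B := rfl

theorem restr_one : restr (1 : Matrix (BlockIdx (n + 1)) (BlockIdx (n + 1)) K) = 1 := by
  refine Matrix.submatrix_one _ ?_
  rintro ⟨a, e⟩ ⟨b, f⟩ h
  simp only [upIdx, Prod.mk.injEq, Fin.castSucc_inj] at h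
  simp [h.1, h.2]

theorem restr_path (R : Matrix (BlockIdx (n + 1)) (BlockIdx (n + 1)) K) (s : K) :
    restr (1 + s • (R - 1)) = 1 + s • (restr R - 1) := by
  have h : restr (1 + s • (R - 1)) = restr 1 + s • (restr R - restr 1) := rfl
  rw [h, restr_one]

theorem det_eq_det_restr_mul {R : Matrix (BlockIdx (n + 1)) (BlockIdx (n + 1)) K}
    (hR : SelfAdj R) (h0 : (restr R).det ≠ 0) :
    R.det = (restr R).det * schurCompl R 0 0 ^ 2 := by
  let _ := Matrix.invertibleOfIsUnitDet (restr R) h0.isUnit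
  rw [← Matrix.det_submatrix_equiv_self (blockEquiv n), submatrix_blockEquiv,
    Matrix.det_fromBlocks₁₁, Matrix.invOf_eq_nonsing_inv]
  congr 1
  have : (R.submatrix lastIdx lastIdx - R.submatrix lastIdx upIdx * (restr R)⁻¹ *
    R.submatrix upIdx lastIdx) = schurCompl R := rfl
  rw [this, schurCompl_eq_smul hR, Matrix.det_smul]
  simp

theorem reForm_submatrix_equiv {ι κ : Type*} [Fintype ι] [Fintype κ] (e : κ ≃ ι)
    (A : Matrix ι ι K) (x : κ → K) : reForm (A.submatrix e e) x = reForm A (x ∘ e.symm) := by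
  rw [reForm, reForm, Matrix.submatrix_mulVec_equiv, ← comp_equiv_symm_dotProduct]
  rfl

theorem reForm_restr_pos {R : Matrix (BlockIdx (n + 1)) (BlockIdx (n + 1)) K}
    (hR : ∀ x, x ≠ 0 → 0 < reForm R x) (x : BlockIdx n → K) (hx : x ≠ 0) :
    0 < reForm (restr R) x := by
  have h := hR (Sum.elim x 0 ∘ (blockEquiv n).symm) ?_
  · rw [← reForm_submatrix_equiv, submatrix_blockEquiv, reForm, Matrix.fromBlocks_mulVec] at h
    have e : star (Sum.elim x (0 : Fin 2 → K)) = Sum.elim (star x) 0 := by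
      ext (i | i) <;> simp
    rw [e, sumElim_dotProduct_sumElim] at h
    simpa [reForm] using h
  · intro h
    refine hx (funext fun i => ?_)
    simpa using congrFun h (blockEquiv n (Sum.inl i))

/-- Evaluate the form of `R` on `(-A⁻¹Bx, x)`, where `A`, `B` are the upper blocks of `R`: the upper
part of the image vanishes and the value is `x*Xx`, with `X` the Schur complement and `x` the first
basis vector. -/
theorem re_schurCompl_pos {R : Matrix (BlockIdx (n + 1)) (BlockIdx (n + 1)) K}
    (hR : ∀ x, x ≠ 0 → 0 < reForm R x) : 0 < RCLike.re (schurCompl R 0 0) := by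
  have hdet : IsUnit (restr R).det := (det_ne_zero_of_reForm_pos (reForm_restr_pos hR)).isUnit
  set x : Fin 2 → K := Pi.single 0 1 with hx
  set y : BlockIdx n → K := -((restr R)⁻¹ *ᵥ (R.submatrix upIdx lastIdx *ᵥ x)) with hy
  have h := hR (Sum.elim y x ∘ (blockEquiv n).symm) ?_
  · rw [← reForm_submatrix_equiv, submatrix_blockEquiv, reForm, Matrix.fromBlocks_mulVec] at h
    have e : star (Sum.elim y x) = Sum.elim (star y) (star x) := by
      ext (i | i) <;> simp
    rw [e, sumElim_dotProduct_sumElim] at h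
    simp only [Sum.elim_comp_inl, Sum.elim_comp_inr] at h
    have e1 : restr R *ᵥ y + R.submatrix upIdx lastIdx *ᵥ x = 0 := by
      rw [hy, Matrix.mulVec_neg, Matrix.mulVec_mulVec, Matrix.mul_nonsing_inv _ hdet,
        Matrix.one_mulVec, neg_add_cancel]
    have e2 : R.submatrix lastIdx upIdx *ᵥ y + R.submatrix lastIdx lastIdx *ᵥ x =
        schurCompl R *ᵥ x := by
      rw [hy, schurCompl, Matrix.sub_mulVec, ← Matrix.mulVec_mulVec, ← Matrix.mulVec_mulVec,
        Matrix.mulVec_neg]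
      abel
    rw [e1, e2, dotProduct_zero, zero_add] at h
    have e3 : star x ⬝ᵥ schurCompl R *ᵥ x = schurCompl R 0 0 := by
      simp [hx, Matrix.mulVec, dotProduct, Fin.sum_univ_two]
    rwa [e3] at h
  · intro h
    have := congrFun h (blockEquiv n (Sum.inr 0))
    simp [hx] at this

theorem schurCompl_one : schurCompl (1 : Matrix (BlockIdx (n + 1)) (BlockIdx (n + 1)) K) = 1 := by
  have h1 : (1 : Matrix (BlockIdx (n + 1)) (BlockIdx (n + 1)) K).submatrix
      lastIdx upIdx = 0 := by
    ext e ⟨a, f⟩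
    simp [lastIdx, upIdx, Matrix.one_apply, (Fin.castSucc_lt_last a).ne']
  have h2 : (1 : Matrix (BlockIdx (n + 1)) (BlockIdx (n + 1)) K).submatrix
      (lastIdx (n := n)) lastIdx = 1 := by
    refine Matrix.submatrix_one _ ?_
    intro e f h
    simpa [lastIdx] using h
  rw [schurCompl, h1, h2]
  simp

/-- The factorisation `det R = det (restr R) · c²` holds along the segment from `1` to `R`. There
`c` keeps positive real part, so the principal `log c` is continuous and no multiple of `2πi` can
appear. -/
theorem logDet_succ {R : Matrix (BlockIdx (n + 1)) (BlockIdx (n + 1)) ℂ} (hJ : SelfAdj R)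
    (hR : ∀ x, x ≠ 0 → 0 < reForm R x) :
    logDet R = logDet (restr R) + 2 * Complex.log (schurCompl R 0 0) := by
  have hJs : ∀ s : ℝ, SelfAdj (1 + (s : ℂ) • (R - 1)) := fun s =>
    SelfAdj.one.add ((hJ.sub SelfAdj.one).smul _)
  have hr := reForm_restr_pos hR
  have hpath : ∀ s ∈ Set.Icc (0 : ℝ) 1, ∀ x, x ≠ 0 → 0 < reForm (1 + (s : ℂ) • (R - 1)) x :=
    fun s hs x hx => reForm_path_pos hR hs hx
  have hdet : ∀ s ∈ Set.Icc (0 : ℝ) 1, (restr (1 + (s : ℂ) • (R - 1))).det ≠ 0 := fun s hs =>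
    det_ne_zero_of_reForm_pos (reForm_restr_pos (hpath s hs))
  have hcont : ContinuousOn (fun s : ℝ => schurCompl (1 + (s : ℂ) • (R - 1)) 0 0)
      (Set.Icc 0 1) := by
    rw [continuousOn_iff_continuous_domRestrict]
    have c1 : Continuous fun s : Set.Icc (0 : ℝ) 1 =>
        (1 + ((s : ℝ) : ℂ) • (R - 1) : Matrix (BlockIdx (n + 1)) (BlockIdx (n + 1)) ℂ) := by
      fun_prop
    have c2 : Continuous fun s : Set.Icc (0 : ℝ) 1 => restr (1 + ((s : ℝ) : ℂ) • (R - 1)) :=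
      c1.matrix_submatrix _ _
    have c3 : Continuous fun s : Set.Icc (0 : ℝ) 1 => (restr (1 + ((s : ℝ) : ℂ) • (R - 1)))⁻¹ := by
      simp_rw [Matrix.inv_def, Ring.inverse_eq_inv']
      exact (c2.matrix_det.inv₀ fun s => hdet s s.2).smul c2.matrix_adjugate
    have c4 : Continuous fun s : Set.Icc (0 : ℝ) 1 => schurCompl (1 + ((s : ℝ) : ℂ) • (R - 1)) :=
      (c1.matrix_submatrix _ _).sub (((c1.matrix_submatrix _ _).matrix_mul c3).matrix_mul
        (c1.matrix_submatrix _ _))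
    exact c4.matrix_elem 0 0
  -- Restriction commutes with the segment, so the branch for `restr R` is the one along its own
  -- segment from `1`.
  have h := logDet_eq_of_path hR
    (ℓ := fun s => logDetPath (restr R) s +
      2 * Complex.log (schurCompl (1 + (s : ℂ) • (R - 1)) 0 0)) ?_ ?_ ?_
  · rw [h, logDetPath_one]
    simp
  · refine (continuousOn_logDetPath hr).add (continuousOn_const.mul (hcont.clog fun s hs => ?_))
    exact Or.inl (re_schurCompl_pos (hpath s hs))
  · simp [logDetPath_zero, schurCompl_one]
  · intro s hs
    have hne : schurCompl (1 + (s : ℂ) • (R - 1)) 0 0 ≠ 0 := by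
      intro h0
      have := re_schurCompl_pos (hpath s hs)
      rw [h0] at this
      simp at this
    rw [det_eq_det_restr_mul (hJs s) (hdet s hs), Complex.exp_add, exp_logDetPath hr hs,
      restr_path, two_mul, Complex.exp_add, Complex.exp_log hne, sq]

theorem toC_inv {m : Type*} [Fintype m] [DecidableEq m] (A : Matrix m m ℝ) :
    (toC A)⁻¹ = toC A⁻¹ := by
  rw [Matrix.inv_def, Matrix.inv_def, det_toC, Ring.inverse_eq_inv', Ring.inverse_eq_inv']
  have h : (toC A).adjugate = toC A.adjugate := by
    rw [toC_eq_ofReal_mapMatrix, ← RingHom.map_adjugate]; rfl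
  rw [h]
  ext i j
  simp [toC]

theorem schurCompl_toC (R : Matrix (BlockIdx (n + 1)) (BlockIdx (n + 1)) ℝ) :
    schurCompl (toC R) 0 0 = ((schurCompl R 0 0 : ℝ) : ℂ) := by
  have h1 : restr (toC R) = toC (restr R) := rfl
  rw [schurCompl, h1, toC_inv, schurCompl]
  simp [Matrix.mul_apply, toC]

theorem SelfAdj.toC {R : Matrix (BlockIdx n) (BlockIdx n) ℝ} (h : SelfAdj R) :
    SelfAdj (toC R) := by
  have hJ : matJ n ℂ = _root_.toC (matJ n ℝ) := by
    ext ⟨a, e⟩ ⟨b, f⟩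
    simp only [matJ, Matrix.kroneckerMap_apply, _root_.toC, Matrix.map_apply, Matrix.one_apply]
    split_ifs <;> fin_cases e <;> fin_cases f <;> simp
  rw [SelfAdj] at *
  rw [hJ, toC_eq_ofReal_mapMatrix, toC_eq_ofReal_mapMatrix, ← map_mul, ← map_mul, ← map_neg, ← h]
  rfl

theorem logDet_leadBlock_restr {j : ℕ} (hj : j ≤ n)
    (R : Matrix (BlockIdx (n + 1)) (BlockIdx (n + 1)) ℂ) :
    logDet (leadBlock j R) = logDet (leadBlock j (restr R)) := by
  let e : {p : BlockIdx n // p.1.val < j} ≃ {p : BlockIdx (n + 1) // p.1.val < j} :=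
    { toFun := fun p => ⟨upIdx p.1, p.2⟩
      invFun := fun p => ⟨(⟨p.1.1.val, p.2.trans_le hj⟩, p.1.2), p.2⟩
      left_inv := fun p => rfl
      right_inv := fun p => rfl }
  exact (logDet_submatrix_equiv (leadBlock j R) e).symm

theorem logDet_leadBlock_self (R : Matrix (BlockIdx n) (BlockIdx n) ℂ) :
    logDet (leadBlock n R) = logDet R :=
  logDet_submatrix_equiv R (Equiv.subtypeUnivEquiv fun p : BlockIdx n => p.1.2)

theorem logDet_leadBlock_zero (R : Matrix (BlockIdx n) (BlockIdx n) ℂ) :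
    logDet (leadBlock 0 R) = 0 := by
  have : IsEmpty {p : BlockIdx n // p.1.val < 0} := ⟨fun p => absurd p.2 (Nat.not_lt_zero _)⟩
  simp [logDet, Matrix.charpoly]

end Blocks

/-! ### Schur complements of `T` and `1 + T + S` in terms of the last columns -/

section Link

variable {n : ℕ} {K : Type*} [RCLike K]

/-- The first column of the last block column, without the last block row. -/
def lastCol (R : Matrix (BlockIdx (n + 1)) (BlockIdx (n + 1)) K) : BlockIdx n → K :=
  fun p => R (upIdx p) (lastIdx 0)

theorem schurCompl_apply (R : Matrix (BlockIdx (n + 1)) (BlockIdx (n + 1)) K) :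
    schurCompl R 0 0 = R (lastIdx 0) (lastIdx 0) -
      (fun p => R (lastIdx 0) (upIdx p)) ⬝ᵥ ((restr R)⁻¹ *ᵥ lastCol R) := by
  rw [schurCompl, Matrix.sub_apply, Matrix.mul_assoc, Matrix.mul_apply]
  rfl

/-- The last column of `T + S` is `v + w`; since `T` is hermitian and `S` antihermitian, the last
row is `(v - w)*`. -/
theorem schurCompl_one_add_add {T S : Matrix (BlockIdx (n + 1)) (BlockIdx (n + 1)) K}
    (hT : Tᴴ = T) (hS : Sᴴ = -S) :
    schurCompl (1 + T + S) 0 0 = 1 + T (lastIdx 0) (lastIdx 0) + S (lastIdx 0) (lastIdx 0) -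
      schurForm (restr T) (restr S) (lastCol T, lastCol S) := by
  rw [schurCompl_apply, schurForm, restr_add, restr_add, restr_one]
  have h1 : ∀ p : BlockIdx n, (1 : Matrix (BlockIdx (n + 1)) (BlockIdx (n + 1)) K)
      (upIdx p) (lastIdx 0) = 0 := fun p => by
    simp [lastIdx, upIdx, Matrix.one_apply, (Fin.castSucc_lt_last p.1).ne]
  have h2 : ∀ p : BlockIdx n, (1 : Matrix (BlockIdx (n + 1)) (BlockIdx (n + 1)) K)
      (lastIdx 0) (upIdx p) = 0 := fun p => by
    simp [lastIdx, upIdx, Matrix.one_apply, (Fin.castSucc_lt_last p.1).ne']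
  congr 1
  · simp
  · congr 2
    · ext p
      have e1 := congrFun (congrFun hT (lastIdx 0)) (upIdx p)
      have e2 := congrFun (congrFun hS (lastIdx 0)) (upIdx p)
      simp only [Matrix.conjTranspose_apply, Matrix.neg_apply] at e1 e2
      simp [h2, lastCol, e1, e2]
    · ext p
      simp [h1, lastCol]

theorem schurCompl_hermitian {T : Matrix (BlockIdx (n + 1)) (BlockIdx (n + 1)) K}
    (hT : Tᴴ = T) {t : ℝ} (ht : T (lastIdx 0) (lastIdx 0) = (t : K)) :
    schurCompl T 0 0 = (schurT (restr T) (lastCol T) t : K) := by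
  have hr : (fun p => T (lastIdx 0) (upIdx p)) = star (lastCol T) := by
    ext p
    have e1 := congrFun (congrFun hT (lastIdx 0)) (upIdx p)
    simpa [lastCol, Matrix.conjTranspose_apply] using e1.symm
  have hh : (restr T)⁻¹.IsHermitian := by
    refine Matrix.IsHermitian.inv ?_
    rw [Matrix.IsHermitian, restr, Matrix.conjTranspose_submatrix, hT]
  rw [schurCompl_apply, hr, ht, schurT, RCLike.ofReal_sub, reForm]
  congr 1
  exact (RCLike.conj_eq_iff_re.1 (RCLike.conj_eq_iff_im.2
    (hh.im_star_dotProduct_mulVec_self _))).symm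

/-- Schur's criterion, with a scalar complement. It describes the rank `n + 1` domain as a fibration
over the rank `n` domain with fibre `u > 0`. -/
theorem posDef_succ_iff {T : Matrix (BlockIdx (n + 1)) (BlockIdx (n + 1)) K}
    (hT : Tᴴ = T) (hJ : SelfAdj T) {t : ℝ} (ht : T (lastIdx 0) (lastIdx 0) = (t : K)) :
    T.PosDef ↔ (restr T).PosDef ∧ 0 < schurT (restr T) (lastCol T) t := by
  have hs := schurCompl_hermitian hT ht
  have hinj : Function.Injective (upIdx (n := n)) := fun p q h =>
    Sum.inl_injective ((blockEquiv n).injective h)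
  constructor
  · intro h
    refine ⟨h.submatrix hinj, ?_⟩
    have := re_schurCompl_pos (fun x hx => reForm_pos_of_posDef h hx)
    rwa [hs, RCLike.ofReal_re] at this
  · rintro ⟨h, hpos⟩
    -- The block criterion gives only semidefiniteness; a nonzero determinant makes it definite.
    have hdet : T.det ≠ 0 := by
      rw [det_eq_det_restr_mul hJ h.det_pos.ne', hs]
      refine mul_ne_zero h.det_pos.ne' (pow_ne_zero _ ?_)
      exact_mod_cast hpos.ne'
    have hB : T.submatrix lastIdx upIdx = (T.submatrix upIdx lastIdx)ᴴ := by
      rw [Matrix.conjTranspose_submatrix, hT]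
    have hps : T.PosSemidef := by
      rw [← Matrix.posSemidef_submatrix_equiv (blockEquiv n), submatrix_blockEquiv, hB]
      let _ := h.isUnit.invertible
      rw [Matrix.PosDef.fromBlocks₁₁ _ _ h, ← hB]
      have : T.submatrix lastIdx lastIdx - T.submatrix lastIdx upIdx * (restr T)⁻¹ *
        T.submatrix upIdx lastIdx = schurCompl T := rfl
      rw [this, schurCompl_eq_smul hJ, hs]
      exact Matrix.PosSemidef.one.smul (by exact_mod_cast hpos.le)
    exact hps.posDef_iff_isUnit.2 ((Matrix.isUnit_iff_isUnit_det _).2 hdet.isUnit)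

end Link

/-! ### Measurability of the kernels in all variables -/

section Measurability

variable {K : Type*} [RCLike K] {ι : Type*} [Fintype ι] [DecidableEq ι]
  {α : Type*} [TopologicalSpace α] [MeasurableSpace α] [OpensMeasurableSpace α]

theorem measurable_stepDet {T S : α → Matrix ι ι K} (hT : Continuous T) (hS : Continuous S) :
    Measurable fun a => stepDet (T a) (S a) :=
  ((RCLike.continuous_re.comp hT.matrix_det).measurable.pow_const _).mul
    ((((continuous_const.add hT).add hS).matrix_det.norm.measurable).pow_const _)

variable [MeasurableSpace K] [BorelSpace K]

theorem measurable_inv_apply {M : α → Matrix ι ι K} (hM : Continuous M) (i j : ι) :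
    Measurable fun a => (M a)⁻¹ i j := by
  simp_rw [Matrix.inv_def, Ring.inverse_eq_inv', Matrix.smul_apply, smul_eq_mul]
  exact hM.matrix_det.measurable.inv.mul (hM.matrix_adjugate.matrix_elem i j).measurable

theorem measurable_inv_form {β : Type*} [MeasurableSpace β] {M : α → Matrix ι ι K}
    (hM : Continuous M) {f : β → α} (hf : Measurable f) {x y : β → ι → K} (hx : Measurable x)
    (hy : Measurable y) : Measurable fun a => star (x a) ⬝ᵥ ((M (f a))⁻¹ *ᵥ y a) := by
  simp only [dotProduct, Matrix.mulVec]
  refine Finset.measurable_sum _ fun i _ => Measurable.mul ?_ ?_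
  · exact continuous_star.measurable.comp ((measurable_pi_apply i).comp hx)
  · exact Finset.measurable_sum _ fun j _ => ((measurable_inv_apply hM i j).comp hf).mul
      ((measurable_pi_apply j).comp hy)

theorem measurable_schurT {T : α → Matrix ι ι K} (hT : Continuous T) :
    Measurable fun z : α × ((ι → K) × ℝ) => schurT (T z.1) z.2.1 z.2.2 :=
  (measurable_snd.comp measurable_snd).sub (RCLike.continuous_re.measurable.comp
    (measurable_inv_form hT measurable_fst (measurable_fst.comp measurable_snd)
      (measurable_fst.comp measurable_snd)))

theorem measurable_schurForm {T S : α → Matrix ι ι K} (hT : Continuous T) (hS : Continuous S) :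
    Measurable fun z : α × ((ι → K) × (ι → K)) => schurForm (T z.1) (S z.1) z.2 := by
  have h1 : Measurable fun z : α × ((ι → K) × (ι → K)) => z.2.1 :=
    measurable_fst.comp measurable_snd
  have h2 : Measurable fun z : α × ((ι → K) × (ι → K)) => z.2.2 :=
    measurable_snd.comp measurable_snd
  exact measurable_inv_form ((continuous_const.add hT).add hS) measurable_fst (h1.sub h2)
    (h1.add h2)

theorem measurable_realKernel {T S : α → Matrix ι ι K} (hT : Continuous T) (hS : Continuous S)
    (b σ : ℂ) : Measurable (Function.uncurry fun a => realKernel b σ (T a) (S a)) := by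
  have h1 : Measurable fun z : α × (((ι → K) × (ι → K)) × ℝ) => schurT (T z.1) z.2.1.1 z.2.2 :=
    (measurable_schurT hT).comp (measurable_fst.prodMk
      ((measurable_fst.comp (measurable_fst.comp measurable_snd)).prodMk
        (measurable_snd.comp measurable_snd)))
  have h2 : Measurable fun z : α × (((ι → K) × (ι → K)) × ℝ) =>
      schurForm (T z.1) (S z.1) z.2.1 :=
    (measurable_schurForm hT hS).comp (measurable_fst.prodMk (measurable_fst.comp measurable_snd))
  refine ((measurable_posCpow b).comp h1).mul (Measurable.pow_const ?_ _)
  exact Complex.measurable_ofReal.comp ((measurable_const.add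
    (measurable_snd.comp measurable_snd)).sub (RCLike.continuous_re.measurable.comp h2))

theorem measurable_cplxKernel {T S : α → Matrix ι ι K} (hT : Continuous T) (hS : Continuous S)
    (b σ τ : ℂ) : Measurable (Function.uncurry fun a => cplxKernel b σ τ (T a) (S a)) := by
  have h1 : Measurable fun z : α × ((((ι → K) × (ι → K)) × ℝ) × ℝ) =>
      schurT (T z.1) z.2.1.1.1 z.2.1.2 :=
    (measurable_schurT hT).comp (measurable_fst.prodMk
      ((measurable_fst.comp (measurable_fst.comp (measurable_fst.comp measurable_snd))).prodMk
        (measurable_snd.comp (measurable_fst.comp measurable_snd))))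
  have h2 : Measurable fun z : α × ((((ι → K) × (ι → K)) × ℝ) × ℝ) =>
      schurForm (T z.1) (S z.1) z.2.1.1 :=
    (measurable_schurForm hT hS).comp (measurable_fst.prodMk
      (measurable_fst.comp (measurable_fst.comp measurable_snd)))
  refine ((measurable_posCpow b).comp h1).mul ((measurable_cpowPair σ τ).comp ?_)
  refine (Complex.measurable_ofReal.comp ((measurable_const.add
    (measurable_snd.comp (measurable_fst.comp measurable_snd))).sub
      (RCLike.continuous_re.measurable.comp h2))).add
    ((Complex.measurable_ofReal.comp ((measurable_snd.comp measurable_snd).sub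
      (RCLike.continuous_im.measurable.comp h2))).mul_const _)

end Measurability

/-! ### Factoring Lebesgue measure along the last block column -/

section Coordinates

theorem measurePreserving_splitPi {ι κ μ : Type*} [Fintype ι] [Fintype κ] [Fintype μ]
    (E : Type*) [MeasureSpace E] [SigmaFinite (volume : Measure E)] (e : ι ⊕ κ ≃ μ) :
    MeasurePreserving (fun u : μ → E => ((fun i => u (e (Sum.inl i)), fun k => u (e (Sum.inr k))) :
      (ι → E) × (κ → E))) volume volume :=
  (volume_measurePreserving_sumPiEquivProdPi fun _ : ι ⊕ κ => E).comp
    ((volume_measurePreserving_piCongrLeft (fun _ : μ => E) e).symm _)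

theorem measurePreserving_splitLast (E : Type*) [MeasureSpace E]
    [SigmaFinite (volume : Measure E)] (n : ℕ) :
    MeasurePreserving (fun u : Fin (n + 1) → E => ((fun a : Fin n => u a.castSucc, u (Fin.last n)) :
      (Fin n → E) × E)) volume volume :=
  ((MeasurePreserving.id volume).prod (volume_preserving_funUnique (Fin 1) E)).comp
    (measurePreserving_splitPi E (finSumFinEquiv (m := n) (n := 1)))

/-- A position above the diagonal, outside the last block column. -/
def upPos {n : ℕ} (p : UpperIdx n) : UpperIdx (n + 1) :=
  ⟨(p.1.1.castSucc, p.1.2.castSucc), Fin.castSucc_lt_castSucc_iff.2 p.2⟩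

/-- A position above the diagonal in the last block column. -/
def lastPos {n : ℕ} (a : Fin n) : UpperIdx (n + 1) :=
  ⟨(a.castSucc, Fin.last n), Fin.castSucc_lt_last a⟩

/-- The positions above the diagonal, with the last block column split off. -/
noncomputable def upperEquiv (n : ℕ) : UpperIdx n ⊕ Fin n ≃ UpperIdx (n + 1) :=
  Equiv.ofBijective (Sum.elim upPos lastPos) (by
    constructor
    · rintro (⟨⟨a, b⟩, h⟩ | a) (⟨⟨c, d⟩, h'⟩ | c) H
      · simp only [Sum.elim_inl, upPos, Subtype.mk.injEq, Prod.mk.injEq, Fin.castSucc_inj] at H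
        simp [H.1, H.2]
      · simp only [Sum.elim_inl, Sum.elim_inr, upPos, lastPos, Subtype.mk.injEq,
          Prod.mk.injEq] at H
        exact absurd H.2 (Fin.castSucc_lt_last b).ne
      · simp only [Sum.elim_inl, Sum.elim_inr, upPos, lastPos, Subtype.mk.injEq,
          Prod.mk.injEq] at H
        exact absurd H.2 (Fin.castSucc_lt_last d).ne'
      · simp only [Sum.elim_inr, lastPos, Subtype.mk.injEq, Prod.mk.injEq, Fin.castSucc_inj] at H
        simp [H.1]
    · rintro ⟨⟨a, b⟩, h⟩
      have ha : a ≠ Fin.last n := ((show a < b from h).trans_le (Fin.le_last b)).ne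
      obtain ⟨a, rfl⟩ := Fin.exists_castSucc_eq.2 ha
      induction b using Fin.lastCases with
      | last => exact ⟨Sum.inr a, rfl⟩
      | cast b => exact ⟨Sum.inl ⟨(a, b), Fin.castSucc_lt_castSucc_iff.1 h⟩, rfl⟩)

theorem measurePreserving_splitUpper (E : Type*) [MeasureSpace E]
    [SigmaFinite (volume : Measure E)] (n : ℕ) :
    MeasurePreserving (fun u : UpperIdx (n + 1) → E =>
      ((fun p => u (upPos p), fun a => u (lastPos a)) : (UpperIdx n → E) × (Fin n → E)))
      volume volume :=
  measurePreserving_splitPi E (upperEquiv n)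

/-- A column of height `2n`, read as `n` pairs. -/
def colEquiv (n : ℕ) (K : Type*) [MeasurableSpace K] : (BlockIdx n → K) ≃ᵐ (Fin n → K × K) where
  toFun w a := (w (a, 0), w (a, 1))
  invFun u p := if p.2 = 0 then (u p.1).1 else (u p.1).2
  left_inv w := by
    ext ⟨a, e⟩
    fin_cases e <;> simp
  right_inv u := by
    ext a <;> simp
  measurable_toFun := by
    change Measurable fun (w : BlockIdx n → K) (a : Fin n) => (w (a, 0), w (a, 1))
    fun_prop
  measurable_invFun := by
    refine measurable_pi_lambda _ fun p => ?_
    change Measurable fun u : Fin n → K × K => if p.2 = 0 then (u p.1).1 else (u p.1).2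
    split_ifs
    · exact measurable_fst.comp (measurable_pi_apply p.1)
    · exact measurable_snd.comp (measurable_pi_apply p.1)

theorem measurePreserving_colEquiv (n : ℕ) (K : Type*) [MeasureSpace K]
    [SigmaFinite (volume : Measure K)] : MeasurePreserving (colEquiv n K) volume volume := by
  let e : Fin n ⊕ Fin n ≃ BlockIdx n :=
    { toFun := Sum.elim (fun a => (a, 0)) (fun a => (a, 1))
      invFun := fun p => if p.2 = 0 then Sum.inl p.1 else Sum.inr p.1
      left_inv := by rintro (a | a) <;> simp
      right_inv := by rintro ⟨a, f⟩; fin_cases f <;> simp }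
  exact ((volume_measurePreserving_arrowProdEquivProdArrow K K (Fin n)).symm _).comp
    (measurePreserving_splitPi K e)

/-- The column of height `2n` made of the pairs `φ (u a)`. -/
def columnOf {n : ℕ} {E K : Type*} (φ : E → K × K) (u : Fin n → E) (p : BlockIdx n) : K :=
  if p.2 = 0 then (φ (u p.1)).1 else (φ (u p.1)).2

theorem measurePreserving_columnOf {n : ℕ} {E K : Type*} [MeasureSpace E] [MeasureSpace K]
    [SigmaFinite (volume : Measure E)] [SigmaFinite (volume : Measure K)] {φ : E → K × K}
    (hφ : MeasurePreserving φ volume volume) :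
    MeasurePreserving (columnOf (n := n) φ) volume volume :=
  ((measurePreserving_colEquiv n K).symm _).comp (volume_preserving_pi fun _ => hφ)

theorem measurePreserving_prodProdProdComm {α β γ δ : Type*} [MeasureSpace α] [MeasureSpace β]
    [MeasureSpace γ] [MeasureSpace δ] [SFinite (volume : Measure α)]
    [SFinite (volume : Measure β)] [SFinite (volume : Measure γ)] [SFinite (volume : Measure δ)] :
    MeasurePreserving (fun z : (α × β) × (γ × δ) => ((z.1.1, z.2.1), (z.1.2, z.2.2)))
      volume volume := by
  have hm : Measurable fun z : (α × β) × (γ × δ) => ((z.1.1, z.2.1), (z.1.2, z.2.2)) := by fun_prop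
  have h1 : MeasurePreserving (fun z : (α × β) × (γ × δ) => (z.1.1, (z.1.2, (z.2.1, z.2.2))))
      volume volume :=
    measurePreserving_prodAssoc volume volume volume
  have h2 : MeasurePreserving (fun z : α × (β × (γ × δ)) => (z.1, ((z.2.1, z.2.2.1), z.2.2.2)))
      volume volume :=
    (MeasurePreserving.id volume).prod
      ((measurePreserving_prodAssoc volume volume volume).symm _)
  have h3 : MeasurePreserving (fun z : α × ((β × γ) × δ) => (z.1, ((z.2.1.2, z.2.1.1), z.2.2)))
      volume volume :=
    (MeasurePreserving.id volume).prod
      (Measure.measurePreserving_swap.prod (MeasurePreserving.id volume))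
  have h4 : MeasurePreserving (fun z : α × ((γ × β) × δ) => (z.1, (z.2.1.1, (z.2.1.2, z.2.2))))
      volume volume :=
    (MeasurePreserving.id volume).prod (measurePreserving_prodAssoc volume volume volume)
  have h5 : MeasurePreserving (fun z : α × (γ × (β × δ)) => ((z.1, z.2.1), z.2.2))
      volume volume :=
    (measurePreserving_prodAssoc volume volume volume).symm _
  exact h5.comp (h4.comp (h3.comp (h2.comp h1)))

theorem measurePreserving_neg_conj :
    MeasurePreserving (fun z : ℂ => -star z) volume volume :=
  (LinearIsometryEquiv.neg ℝ (E := ℂ)).measurePreserving.comp Complex.conjLIE.measurePreserving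

theorem measurePreserving_I_mul : MeasurePreserving (fun z : ℂ => Complex.I * z) volume volume := by
  have e : (fun z : ℂ => Complex.I * z) = rotation (Circle.exp (Real.pi / 2)) := by
    ext1 z
    rw [rotation_apply, Circle.coe_exp]
    push_cast
    rw [Complex.exp_pi_div_two_mul_I]
  rw [e]
  exact (rotation (Circle.exp (Real.pi / 2))).measurePreserving

/-- The last column of a real block `(α, β; -β, α)`. -/
def realColT (z : ℂ) : ℝ × ℝ := (z.re, -z.im)

/-- The first column of a real block `(β, α; α, -β)`. -/
def realColS (z : ℂ) : ℝ × ℝ := (z.im, z.re)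

/-- The first column of a complex block `(α, β; -β̄, ᾱ)`. -/
def cplxColT (z : ℂ × ℂ) : ℂ × ℂ := (z.1, -star z.2)

/-- The first column of `I` times a complex block `(α, β; -β̄, ᾱ)`. -/
def cplxColS (z : ℂ × ℂ) : ℂ × ℂ := (Complex.I * z.1, Complex.I * -star z.2)

theorem measurePreserving_realColT : MeasurePreserving realColT volume volume :=
  ((MeasurePreserving.id volume).prod (Measure.measurePreserving_neg volume)).comp
    Complex.volume_preserving_equiv_real_prod

theorem measurePreserving_realColS : MeasurePreserving realColS volume volume :=
  Measure.measurePreserving_swap.comp Complex.volume_preserving_equiv_real_prod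

theorem measurePreserving_cplxColT : MeasurePreserving cplxColT volume volume :=
  (MeasurePreserving.id volume).prod measurePreserving_neg_conj

theorem measurePreserving_cplxColS : MeasurePreserving cplxColS volume volume :=
  (measurePreserving_I_mul.prod measurePreserving_I_mul).comp measurePreserving_cplxColT

variable {n : ℕ}

/-- The coordinates of the matrix without its last block row and column. -/
def realPrev (x : RealCoord (n + 1)) : RealCoord n :=
  ((fun a => x.1.1 a.castSucc, fun p => x.1.2 (upPos p)), fun p => x.2 (upPos p))

/-- The last columns of `T` and `S` and the last diagonal entry of `T`. -/
def realLast (x : RealCoord (n + 1)) : ((BlockIdx n → ℝ) × (BlockIdx n → ℝ)) × ℝ :=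
  ((columnOf realColT fun a => x.1.2 (lastPos a), columnOf realColS fun a => x.2 (lastPos a)),
    x.1.1 (Fin.last n))

/-- The first column of a `2 × 2` block determines the block, and it arises from the coordinates by
a swap or a sign change. Hence no Jacobian constant enters; the rest is a reordering of factors. -/
theorem measurePreserving_realSplit : MeasurePreserving
    (fun x : RealCoord (n + 1) => (realPrev x, realLast x)) volume volume := by
  have h1 := ((measurePreserving_splitLast ℝ n).prod (measurePreserving_splitUpper ℂ n)).prod
    (measurePreserving_splitUpper ℂ n)
  have h2 := (measurePreserving_prodProdProdComm (α := Fin n → ℝ) (β := ℝ) (γ := UpperIdx n → ℂ)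
    (δ := Fin n → ℂ)).prod (MeasurePreserving.id (volume : Measure ((UpperIdx n → ℂ) × (Fin n → ℂ))))
  have h3 := measurePreserving_prodProdProdComm (α := (Fin n → ℝ) × (UpperIdx n → ℂ))
    (β := ℝ × (Fin n → ℂ)) (γ := UpperIdx n → ℂ) (δ := Fin n → ℂ)
  have h4 : MeasurePreserving (fun z : (ℝ × (Fin n → ℂ)) × (Fin n → ℂ) =>
      ((z.1.2, z.2), z.1.1)) volume volume :=
    Measure.measurePreserving_swap.comp (measurePreserving_prodAssoc volume volume volume)
  have h5 := (((measurePreserving_columnOf (n := n) measurePreserving_realColT).prod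
    (measurePreserving_columnOf (n := n) measurePreserving_realColS)).prod
      (MeasurePreserving.id (volume : Measure ℝ))).comp h4
  exact ((MeasurePreserving.id volume).prod h5).comp (h3.comp (h2.comp h1))

/-- The coordinates of the matrix without its last block row and column. -/
def quatPrev (y : QuatCoord (n + 1)) : QuatCoord n :=
  (fun a => y.1 a.castSucc, fun p => y.2 (upPos p))

/-- The coordinates of the matrices without their last block rows and columns. -/
def cplxPrev (x : CplxCoord (n + 1)) : CplxCoord n := (quatPrev x.1, quatPrev x.2)

/-- The last columns of `T` and `S` and the last diagonal entries of `T` and `-iS`. -/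
def cplxLast (x : CplxCoord (n + 1)) : (((BlockIdx n → ℂ) × (BlockIdx n → ℂ)) × ℝ) × ℝ :=
  (((columnOf cplxColT fun a => x.1.2 (lastPos a), columnOf cplxColS fun a => x.2.2 (lastPos a)),
    x.1.1 (Fin.last n)), x.2.1 (Fin.last n))

-- As in the real case, the maps from coordinates to columns are isometric in each entry:
-- conjugation, sign change and, for `S`, multiplication by `i`.
set_option synthInstance.maxSize 1000 in
theorem measurePreserving_cplxSplit : MeasurePreserving
    (fun x : CplxCoord (n + 1) => (cplxPrev x, cplxLast x)) volume volume := by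
  have h1 := (measurePreserving_splitLast ℝ n).prod (measurePreserving_splitUpper (ℂ × ℂ) n)
  have h2 := (measurePreserving_prodProdProdComm (α := Fin n → ℝ) (β := ℝ)
    (γ := UpperIdx n → ℂ × ℂ) (δ := Fin n → ℂ × ℂ)).comp h1
  have h3 := (measurePreserving_prodProdProdComm (α := QuatCoord n)
    (β := ℝ × (Fin n → ℂ × ℂ)) (γ := QuatCoord n) (δ := ℝ × (Fin n → ℂ × ℂ))).comp (h2.prod h2)
  have h4 : MeasurePreserving (fun z : (ℝ × (Fin n → ℂ × ℂ)) × (ℝ × (Fin n → ℂ × ℂ)) =>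
      (((z.1.2, z.2.2), z.1.1), z.2.1)) volume volume :=
    ((measurePreserving_prodAssoc (volume : Measure ((Fin n → ℂ × ℂ) × (Fin n → ℂ × ℂ)))
      (volume : Measure ℝ) (volume : Measure ℝ)).symm _).comp
      (Measure.measurePreserving_swap.comp (measurePreserving_prodProdProdComm (α := ℝ)
        (β := Fin n → ℂ × ℂ) (γ := ℝ) (δ := Fin n → ℂ × ℂ)))
  have h5 : MeasurePreserving (fun z : (((Fin n → ℂ × ℂ) × (Fin n → ℂ × ℂ)) × ℝ) × ℝ =>
      (((columnOf cplxColT z.1.1.1, columnOf cplxColS z.1.1.2), z.1.2), z.2)) volume volume :=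
    (((measurePreserving_columnOf measurePreserving_cplxColT).prod
      (measurePreserving_columnOf measurePreserving_cplxColS)).prod
        (MeasurePreserving.id (volume : Measure ℝ))).prod (MeasurePreserving.id (volume : Measure ℝ))
  exact ((MeasurePreserving.id volume).prod (h5.comp h4)).comp h3

theorem restr_realT (x : RealCoord (n + 1)) : restr (realT x) = realT (realPrev x) := by
  ext ⟨a, e⟩ ⟨b, f⟩
  simp only [restr, Matrix.submatrix_apply, upIdx, realT, fillBlocks, Matrix.of_apply,
    Fin.castSucc_lt_castSucc_iff]
  rfl

theorem restr_realS (x : RealCoord (n + 1)) : restr (realS x) = realS (realPrev x) := by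
  ext ⟨a, e⟩ ⟨b, f⟩
  simp only [restr, Matrix.submatrix_apply, upIdx, realS, fillBlocks, Matrix.of_apply,
    Fin.castSucc_lt_castSucc_iff]
  rfl

theorem lastCol_realT (x : RealCoord (n + 1)) : lastCol (realT x) = (realLast x).1.1 := by
  ext ⟨a, e⟩
  simp only [lastCol, upIdx, lastIdx, realT, fillBlocks, Matrix.of_apply, Fin.castSucc_lt_last,
    dif_pos]
  fin_cases e <;> simp [realLast, columnOf, realColT, lastPos]

theorem lastCol_realS (x : RealCoord (n + 1)) : lastCol (realS x) = (realLast x).1.2 := by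
  ext ⟨a, e⟩
  simp only [lastCol, upIdx, lastIdx, realS, fillBlocks, Matrix.of_apply, Fin.castSucc_lt_last,
    dif_pos]
  fin_cases e <;> simp [realLast, columnOf, realColS, lastPos]

theorem realT_last (x : RealCoord (n + 1)) :
    realT x (lastIdx 0) (lastIdx 0) = (realLast x).2 := by
  simp [realT, fillBlocks, lastIdx, realLast]

theorem realS_last (x : RealCoord (n + 1)) : realS x (lastIdx 0) (lastIdx 0) = 0 := by
  simp [realS, fillBlocks, lastIdx]

theorem restr_cplxT (x : CplxCoord (n + 1)) : restr (cplxT x) = cplxT (cplxPrev x) := by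
  ext ⟨a, e⟩ ⟨b, f⟩
  simp only [restr, Matrix.submatrix_apply, upIdx, cplxT, quatHerm, fillBlocks, Matrix.of_apply,
    Fin.castSucc_lt_castSucc_iff]
  rfl

theorem restr_cplxS (x : CplxCoord (n + 1)) : restr (cplxS x) = cplxS (cplxPrev x) :=
  congrArg (Complex.I • ·) (restr_cplxT (x.2, x.2))

theorem lastCol_cplxT (x : CplxCoord (n + 1)) : lastCol (cplxT x) = (cplxLast x).1.1.1 := by
  ext ⟨a, e⟩
  simp only [lastCol, upIdx, lastIdx, cplxT, quatHerm, fillBlocks, Matrix.of_apply,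
    Fin.castSucc_lt_last, dif_pos]
  fin_cases e <;> simp [cplxLast, columnOf, cplxColT, lastPos]

theorem lastCol_cplxS (x : CplxCoord (n + 1)) : lastCol (cplxS x) = (cplxLast x).1.1.2 := by
  ext ⟨a, e⟩
  simp only [lastCol, upIdx, lastIdx, cplxS, quatHerm, fillBlocks, Matrix.of_apply,
    Matrix.smul_apply, Fin.castSucc_lt_last, dif_pos]
  fin_cases e <;> simp [cplxLast, columnOf, cplxColS, lastPos]

theorem cplxT_last (x : CplxCoord (n + 1)) :
    cplxT x (lastIdx 0) (lastIdx 0) = ((cplxLast x).1.2 : ℂ) := by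
  simp [cplxT, quatHerm, fillBlocks, lastIdx, cplxLast]

theorem cplxS_last (x : CplxCoord (n + 1)) :
    cplxS x (lastIdx 0) (lastIdx 0) = Complex.I * ((cplxLast x).2 : ℂ) := by
  simp [cplxS, quatHerm, fillBlocks, lastIdx, cplxLast]

theorem selfAdj_realT_add_realS (x : RealCoord n) : SelfAdj (realT x + realS x) :=
  (selfAdj_iff _).1 (real_param.2.subset ⟨x, rfl⟩)

/-- The matrix `T` alone is `T + S` at the point whose `S`-coordinates are zero. -/
theorem selfAdj_realT (x : RealCoord n) : SelfAdj (realT x) := by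
  have h := selfAdj_realT_add_realS (x.1, 0)
  have e : realS (x.1, (0 : UpperIdx n → ℂ)) = 0 := by
    ext ⟨a, e⟩ ⟨b, f⟩
    simp only [realS, fillBlocks, Matrix.of_apply]
    split_ifs <;> fin_cases e <;> fin_cases f <;> simp
  rwa [e, add_zero] at h

theorem selfAdj_cplxT_add_cplxS (x : CplxCoord n) : SelfAdj (cplxT x + cplxS x) :=
  (selfAdj_iff _).1 (cplx_param.2.subset ⟨x, rfl⟩)

theorem selfAdj_cplxT (x : CplxCoord n) : SelfAdj (cplxT x) := by
  have h := selfAdj_cplxT_add_cplxS (x.1, 0)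
  have e : cplxS (x.1, (0 : QuatCoord n)) = 0 := by
    ext ⟨a, e⟩ ⟨b, f⟩
    simp only [cplxS, quatHerm, fillBlocks, Matrix.of_apply, Matrix.smul_apply]
    split_ifs <;> fin_cases e <;> fin_cases f <;> simp
  rwa [e, add_zero] at h

theorem continuous_fillBlocks {α K : Type*} [TopologicalSpace α] [RCLike K] (c : K)
    {d : α → Fin n → Matrix (Fin 2) (Fin 2) K} {u : α → UpperIdx n → Matrix (Fin 2) (Fin 2) K}
    (hd : Continuous d) (hu : Continuous u) : Continuous fun a => fillBlocks c (d a) (u a) := by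
  refine continuous_matrix fun p q => ?_
  simp only [fillBlocks, Matrix.of_apply]
  split_ifs
  · exact ((continuous_apply _).comp hu).matrix_elem _ _
  · exact continuous_const.mul (continuous_star.comp (((continuous_apply _).comp hu).matrix_elem _ _))
  · exact ((continuous_apply _).comp hd).matrix_elem _ _

theorem continuous_realT : Continuous (realT (n := n)) := by
  refine continuous_fillBlocks 1 ?_ ?_
  · fun_prop
  · refine continuous_pi fun p => continuous_matrix fun i j => ?_
    fin_cases i <;> fin_cases j <;> simp <;> fun_prop

theorem continuous_realS : Continuous (realS (n := n)) := by
  refine continuous_fillBlocks (-1) continuous_const ?_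
  refine continuous_pi fun p => continuous_matrix fun i j => ?_
  fin_cases i <;> fin_cases j <;> simp <;> fun_prop

theorem continuous_quatHerm : Continuous (quatHerm (n := n)) := by
  refine continuous_fillBlocks 1 ?_ ?_
  · fun_prop
  · refine continuous_pi fun p => continuous_matrix fun i j => ?_
    fin_cases i <;> fin_cases j <;> simp <;> fun_prop

theorem continuous_cplxT : Continuous (cplxT (n := n)) := continuous_quatHerm.comp continuous_fst

theorem continuous_cplxS : Continuous (cplxS (n := n)) :=
  (continuous_quatHerm.comp continuous_snd).const_smul Complex.I

end Coordinates

/-! ### The recursion in `n`, and the real case -/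

section Recursion

/-- The exponent `∑ (f j - f (j + 1)) / 2 * L j`. -/
noncomputable def powExponent (n : ℕ) (f L : ℕ → ℂ) : ℂ :=
  ∑ j ∈ Finset.Icc 1 n, (f j - f (j + 1)) / 2 * L j

/-- The parameters after splitting off the last block. -/
noncomputable def shiftParam (n : ℕ) (κ : ℂ) (f : ℕ → ℂ) (j : ℕ) : ℂ := if j ≤ n then f j - κ else 0

theorem shiftParam_of_le {n j : ℕ} (κ : ℂ) (f : ℕ → ℂ) (hj : j ≤ n) :
    shiftParam n κ f j = f j - κ := if_pos hj

theorem shiftParam_succ (n : ℕ) (κ : ℂ) (f : ℕ → ℂ) : shiftParam n κ f (n + 1) = 0 :=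
  if_neg (by lia)

/-- Shifting `f 1, …, f n` by `κ` preserves the differences with `j < n`. In the top terms `f (n+1)`
cancels from the coefficient of `L n`, leaving `f n / 2`, of which the shifted parameters account
for all but `κ / 2`. For `n = 0` this uses `L 0 = 0`. -/
theorem powExponent_succ {n : ℕ} {f L L' : ℕ → ℂ} {ℓ : ℂ} (κ : ℂ) (hf : f (n + 2) = 0)
    (h0 : L 0 = 0) (hL : ∀ j ≤ n, L' j = L j) (hL' : L' (n + 1) = L n + 2 * ℓ) :
    powExponent (n + 1) f L' =
      powExponent n (shiftParam n κ f) L + κ / 2 * L n + f (n + 1) * ℓ := by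
  cases n with
  | zero => simp [powExponent, hf, hL', h0]; ring
  | succ m =>
    have h : ∑ j ∈ Finset.Icc 1 m, (f j - f (j + 1)) / 2 * L' j =
        ∑ j ∈ Finset.Icc 1 m, (shiftParam (m + 1) κ f j - shiftParam (m + 1) κ f (j + 1)) / 2 *
          L j := by
      refine Finset.sum_congr rfl fun j hj => ?_
      have hjm := (Finset.mem_Icc.1 hj).2
      rw [shiftParam_of_le κ f (by lia), shiftParam_of_le κ f (by lia), hL j (by lia)]
      ring
    rw [powExponent, powExponent, Finset.sum_Icc_succ_top (by lia), Finset.sum_Icc_succ_top (by lia),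
      Finset.sum_Icc_succ_top (by lia), h, hL', hL _ le_rfl, hf, shiftParam_succ,
      shiftParam_of_le κ f le_rfl]
    ring

/-- Positive definite means positive semidefinite with nonzero determinant: a closed condition (an
intersection over all vectors) and an open one. -/
theorem measurableSet_posDef {K : Type*} [RCLike K] {ι : Type*} [Fintype ι] [DecidableEq ι]
    {α : Type*} [TopologicalSpace α] [MeasurableSpace α] [OpensMeasurableSpace α]
    {T : α → Matrix ι ι K} (hT : Continuous T) (hh : ∀ a, (T a)ᴴ = T a) :
    MeasurableSet {a | (T a).PosDef} := by
  have e : {a | (T a).PosDef} = (⋂ x, {a | 0 ≤ reForm (T a) x}) ∩ {a | (T a).det ≠ 0} := by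
    ext a
    simp only [Set.mem_ofPred_eq, Set.mem_inter_iff, Set.mem_iInter]
    constructor
    · exact fun h => ⟨fun x => reForm_nonneg_of_posDef h x, h.det_pos.ne'⟩
    · rintro ⟨h1, h2⟩
      have hps : (T a).PosSemidef := by
        refine Matrix.PosSemidef.of_dotProduct_mulVec_nonneg (hh a) fun x => ?_
        rw [RCLike.nonneg_iff]
        exact ⟨h1 x, Matrix.IsHermitian.im_star_dotProduct_mulVec_self (hh a) x⟩
      exact hps.posDef_iff_isUnit.2 ((Matrix.isUnit_iff_isUnit_det _).2 h2.isUnit)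
  rw [e]
  refine MeasurableSet.inter (isClosed_iInter fun x => isClosed_le continuous_const ?_).measurableSet
    (isOpen_ne_fun hT.matrix_det continuous_const).measurableSet
  exact RCLike.continuous_re.comp (continuous_const.dotProduct (hT.matrix_mulVec continuous_const))

theorem mem_wedge_iff {n : ℕ} {K : Type*} [RCLike K] {T S : Matrix (BlockIdx n) (BlockIdx n) K}
    (hT : Tᴴ = T) (hS : Sᴴ = -S) (hJ : SelfAdj (T + S)) : T + S ∈ wedge n K ↔ T.PosDef := by
  have e : T + S + (T + S)ᴴ = (2 : ℝ) • T := by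
    rw [Matrix.conjTranspose_add, hT, hS, two_smul]; abel
  rw [wedge, Set.mem_ofPred_eq, selfAdj_iff, e]
  constructor
  · rintro ⟨-, h⟩
    have := h.smul (show (0 : ℝ) < 1 / 2 by norm_num)
    rwa [smul_smul, show (1 / 2 * 2 : ℝ) = 1 by norm_num, one_smul] at this
  · exact fun h => ⟨hJ, h.smul (by norm_num)⟩

theorem reForm_one_add_add_pos {K : Type*} [RCLike K] {ι : Type*} [Fintype ι] [DecidableEq ι]
    {T S : Matrix ι ι K} (hT : T.PosDef) (hS : Sᴴ = -S) (x : ι → K) (hx : x ≠ 0) :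
    0 < reForm (1 + T + S) x := by
  rw [reForm_one_add_add hS]
  exact reForm_pos_of_posDef (posDef_one_add hT) hx

variable {n : ℕ}

/-- In rank `0` the coordinate space is a point of mass `1`, so the constant `1` integrates to the
empty product. -/
instance {ι : Type*} [Fintype ι] [IsEmpty ι] {E : Type*} [MeasureSpace E] :
    IsProbabilityMeasure (volume : Measure (ι → E)) := by
  rw [volume_pi, Measure.pi_of_empty]
  infer_instance

instance : IsProbabilityMeasure (volume : Measure (QuatCoord 0)) :=
  inferInstanceAs (IsProbabilityMeasure (Measure.prod (volume : Measure (Fin 0 → ℝ))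
    (volume : Measure (UpperIdx 0 → ℂ × ℂ))))

instance : IsProbabilityMeasure (volume : Measure (CplxCoord 0)) :=
  inferInstanceAs (IsProbabilityMeasure (Measure.prod (volume : Measure (QuatCoord 0)) volume))

instance : IsProbabilityMeasure (volume : Measure (RealCoord 0)) :=
  inferInstanceAs (IsProbabilityMeasure (Measure.prod (Measure.prod (volume : Measure (Fin 0 → ℝ))
    (volume : Measure (UpperIdx 0 → ℂ))) (volume : Measure (UpperIdx 0 → ℂ))))

/-- The real domain of integration. -/
def realDomain (n : ℕ) : Set (RealCoord n) := {x | (realT x).PosDef}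

theorem realDomain_eq : {x : RealCoord n | realT x + realS x ∈ wedge n ℝ} = realDomain n :=
  Set.ext fun x => mem_wedge_iff (realT_isHermitian x) (realS_antiHermitian x)
    (selfAdj_realT_add_realS x)

theorem mem_realDomain_succ (x : RealCoord (n + 1)) : x ∈ realDomain (n + 1) ↔
    realPrev x ∈ realDomain n ∧
      0 < schurT (realT (realPrev x)) (realLast x).1.1 (realLast x).2 := by
  have h := posDef_succ_iff (realT_isHermitian x) (selfAdj_realT x) (realT_last x)
  rwa [restr_realT, lastCol_realT] at h

theorem realIntegrand_eq_exp (lam sig : ℕ → ℂ) (x : RealCoord n) :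
    realIntegrand n lam sig x = Complex.exp
      (powExponent n lam (fun j => logDet (leadBlock j (toC (realT x)))) -
        powExponent n sig (fun j => logDet (leadBlock j (toC (1 + realT x + realS x)))) -
        (2 * (n : ℂ) - 1) / 2 * logDet (toC (realT x))) := by
  rw [realIntegrand, Finset.prod_div_distrib]
  simp only [detPow]
  rw [← Complex.exp_sum, ← Complex.exp_sum, ← Complex.exp_sub, ← Complex.exp_add, neg_div, neg_mul,
    ← sub_eq_add_neg]
  rfl

theorem stepDet_real {T S : Matrix (BlockIdx n) (BlockIdx n) ℝ} (hT : T.PosDef) (hS : Sᴴ = -S) :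
    (stepDet T S : ℂ) = Complex.exp (logDet (toC T) / 2 + logDet (toC (1 + T + S))) := by
  have hTp := fun x hx => reForm_pos_of_posDef hT (x := x) hx
  have hPp := reForm_one_add_add_pos hT hS
  have hd := det_pos_of_reForm_pos hPp
  have hdT := det_pos_of_reForm_pos hTp
  rw [logDet_toC hTp, logDet_toC hPp, stepDet, Module.finrank_self, Real.norm_of_nonneg hd.le,
    pow_one, RCLike.re_to_real, Real.rpow_def_of_pos hdT]
  nth_rewrite 1 [← Real.exp_log hd]
  rw [← Real.exp_add]
  push_cast
  congr 2
  ring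

/-- The powers of `det T` and `det (1+T+S)` left over from the last block, together with the change
from `-(2n+1)/2` to `-(2n-1)/2`, are exactly `stepDet⁻¹` when `λ` is shifted by `1` and `σ` by `2`.
The exponent of `u` is `λ_{n+1} - (2n+1)`. -/
theorem realIntegrand_succ {lam sig : ℕ → ℂ} (hlam : lam (n + 2) = 0) (hsig : sig (n + 2) = 0)
    {x : RealCoord (n + 1)} (hx : x ∈ realDomain (n + 1)) :
    realIntegrand (n + 1) lam sig x =
      realIntegrand n (shiftParam n 1 lam) (shiftParam n 2 sig) (realPrev x) *
        ((stepDet (realT (realPrev x)) (realS (realPrev x)) : ℂ)⁻¹ *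
          realKernel (lam (n + 1) - (2 * n + 1)) (sig (n + 1)) (realT (realPrev x))
            (realS (realPrev x)) (realLast x)) := by
  obtain ⟨hprev, hu⟩ := (mem_realDomain_succ x).1 hx
  have hTx : (realT x).PosDef := hx
  have hSx := realS_antiHermitian x
  have hPx := reForm_one_add_add_pos hTx hSx
  have hJP : SelfAdj (1 + realT x + realS x) := by
    rw [add_assoc]; exact SelfAdj.one.add (selfAdj_realT_add_realS x)
  set T := realT (realPrev x) with hT
  set S := realS (realPrev x) with hS
  have hc := schurCompl_one_add_add (realT_isHermitian x) hSx
  rw [realT_last, realS_last, add_zero, restr_realT, restr_realS, lastCol_realT, lastCol_realS,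
    Prod.mk.eta, ← hT, ← hS] at hc
  have hcpos := one_le_re_schurForm (T := T) (S := S) hprev (realS_antiHermitian _) (realLast x) hu
  rw [RCLike.re_to_real] at hcpos
  have hsT := schurCompl_hermitian (t := (realLast x).2) (realT_isHermitian x) (realT_last x)
  rw [restr_realT, lastCol_realT, ← hT] at hsT
  have rT : restr (toC (realT x)) = toC T := congrArg toC (restr_realT x)
  have rP : restr (toC (1 + realT x + realS x)) = toC (1 + T + S) := by
    have : restr (1 + realT x + realS x) = 1 + T + S := by
      rw [restr_add, restr_add, restr_one, restr_realT, restr_realS]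
    exact congrArg toC this
  have lT := logDet_succ (selfAdj_realT x).toC
    (fun y hy => reForm_toC_pos (fun z hz => reForm_pos_of_posDef hTx hz) hy)
  have lP := logDet_succ hJP.toC (fun y hy => reForm_toC_pos hPx hy)
  rw [schurCompl_toC, rT, hsT] at lT
  rw [schurCompl_toC, rP, hc] at lP
  rw [realIntegrand_eq_exp, realIntegrand_eq_exp, stepDet_real hprev (realS_antiHermitian _),
    ← hT, ← hS, realKernel, posCpow_of_pos _ hu, RCLike.re_to_real,
    powExponent_succ (L := fun j => logDet (leadBlock j (toC T))) 1 hlam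
      (logDet_leadBlock_zero _) (fun j hj => by rw [logDet_leadBlock_restr hj, rT])
      (by rw [logDet_leadBlock_self, logDet_leadBlock_self, lT]),
    powExponent_succ (L := fun j => logDet (leadBlock j (toC (1 + T + S)))) 2 hsig
      (logDet_leadBlock_zero _) (fun j hj => by rw [logDet_leadBlock_restr hj, rP])
      (by rw [logDet_leadBlock_self, logDet_leadBlock_self, lP]),
    logDet_leadBlock_self, logDet_leadBlock_self, lT,
    Complex.cpow_def_of_ne_zero (by exact_mod_cast hu.ne'),
    Complex.cpow_def_of_ne_zero (by exact_mod_cast hcpos.ne'), ← Complex.exp_neg,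
    ← Complex.exp_add, ← Complex.exp_add, ← Complex.exp_add]
  -- With every factor written as an exponential, a linear identity between logarithms remains.
  congr 1
  push_cast
  simp only [RCLike.ofReal_real_eq_id, id]
  ring

theorem indicator_realIntegrand_succ {lam sig : ℕ → ℂ} (hlam : lam (n + 2) = 0)
    (hsig : sig (n + 2) = 0) (x : RealCoord (n + 1)) :
    (realDomain (n + 1)).indicator (realIntegrand (n + 1) lam sig) x =
      (realDomain n).indicator (realIntegrand n (shiftParam n 1 lam) (shiftParam n 2 sig))
        (realPrev x) *
        ((stepDet (realT (realPrev x)) (realS (realPrev x)) : ℂ)⁻¹ *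
          realKernel (lam (n + 1) - (2 * n + 1)) (sig (n + 1)) (realT (realPrev x))
            (realS (realPrev x)) (realLast x)) := by
  by_cases hx : x ∈ realDomain (n + 1)
  · rw [Set.indicator_of_mem hx, Set.indicator_of_mem ((mem_realDomain_succ x).1 hx).1,
      realIntegrand_succ hlam hsig hx]
  · rw [Set.indicator_of_notMem hx]
    by_cases hp : realPrev x ∈ realDomain n
    · have hu : ¬0 < schurT (realT (realPrev x)) (realLast x).1.1 (realLast x).2 := fun h =>
        hx ((mem_realDomain_succ x).2 ⟨hp, h⟩)
      rw [realKernel, posCpow_of_nonpos _ hu]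
      simp
    · rw [Set.indicator_of_notMem hp, zero_mul]

/-- Here `b = λ_{n+1} - 2n - 1` and the column has real dimension `2n`, so the two conditions of the
column integral read `Re (λ_{n+1} - 2n) > 0` and `Re (σ_{n+1} - λ_{n+1}) > 0`. -/
theorem integralEq_real_succ {lam sig : ℕ → ℂ} (hlam : lam (n + 2) = 0) (hsig : sig (n + 2) = 0)
    (h1 : 0 < (lam (n + 1) - 2 * n).re) (h2 : 0 < (sig (n + 1) - lam (n + 1)).re) {c : ℂ}
    (ih : IntegralEq ((realDomain n).indicator
      (realIntegrand n (shiftParam n 1 lam) (shiftParam n 2 sig))) volume c) :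
    IntegralEq ((realDomain (n + 1)).indicator (realIntegrand (n + 1) lam sig)) volume
      (c * stepConst ℝ (BlockIdx n) (lam (n + 1) - (2 * n + 1)) (sig (n + 1))) := by
  have hre : (lam (n + 1) - (2 * n + 1)).re = (lam (n + 1) - 2 * n).re - 1 := by
    rw [← sub_sub, Complex.sub_re, Complex.one_re]
  have hb : -1 < (lam (n + 1) - (2 * n + 1)).re := by linarith
  have hσ : (lam (n + 1) - (2 * n + 1)).re + 1 +
      (Module.finrank ℝ ℝ * Fintype.card (BlockIdx n) : ℕ) < (sig (n + 1)).re := by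
    rw [hre, Module.finrank_self, Fintype.card_prod, Fintype.card_fin, Fintype.card_fin]
    simp only [Complex.sub_re, Complex.mul_re, Complex.natCast_re, Complex.natCast_im,
      Complex.re_ofNat, Complex.im_ofNat] at h2 ⊢
    push_cast
    linarith
  have hm : Measurable (Function.uncurry fun (y : RealCoord n)
      (z : ((BlockIdx n → ℝ) × (BlockIdx n → ℝ)) × ℝ) =>
      (stepDet (realT y) (realS y) : ℂ)⁻¹ *
        realKernel (lam (n + 1) - (2 * n + 1)) (sig (n + 1)) (realT y) (realS y) z) :=
    ((Complex.measurable_ofReal.comp ((measurable_stepDet continuous_realT continuous_realS).comp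
      measurable_fst)).inv).mul (measurable_realKernel continuous_realT continuous_realS _ _)
  have hdom : ∀ y : RealCoord n, (realDomain n).indicator
      (realIntegrand n (shiftParam n 1 lam) (shiftParam n 2 sig)) y ≠ 0 → (realT y).PosDef :=
    fun y hy => by
      have : y ∈ realDomain n := Set.mem_of_indicator_ne_zero hy
      exact this
  have h := (ih.mul_kernel (ν := volume) (d := stepConst ℝ (BlockIdx n)
    (lam (n + 1) - (2 * n + 1)) (sig (n + 1))) (B := ‖stepConst ℝ (BlockIdx n)
      ((lam (n + 1) - (2 * n + 1)).re : ℂ) ((sig (n + 1)).re : ℂ)‖) hm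
    (fun y hy => by
      have hd := stepDet_pos (hdom y hy) (realS_antiHermitian y)
      have := (integralEq_realKernel (hdom y hy) (realS_antiHermitian y) hb hσ).const_mul
        ((stepDet (realT y) (realS y) : ℂ)⁻¹)
      rwa [inv_mul_cancel_left₀ (by exact_mod_cast hd.ne')] at this)
    (fun y hy => by
      have hd := stepDet_pos (hdom y hy) (realS_antiHermitian y)
      simp only [norm_mul, norm_inv, Complex.norm_real]
      rw [integral_const_mul, integral_norm_realKernel (hdom y hy) (realS_antiHermitian y) hb hσ,
        Real.norm_of_nonneg hd.le, inv_mul_cancel_left₀ hd.ne'])).comp_measurePreserving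
    measurePreserving_realSplit
  convert h using 1
  exact funext fun x => indicator_realIntegrand_succ hlam hsig x

/-- Replacing `n + 1` by `n`, `λ` by `λ - 1` and `σ` by `σ - 2` fixes each Gamma argument with `k ≤
n`, so conditions and factors carry over; the column integral supplies the factor `k = n + 1`. -/
theorem integralEq_real (n : ℕ) : ∀ lam sig : ℕ → ℂ, lam (n + 1) = 0 → sig (n + 1) = 0 →
    (∀ k ∈ Finset.Icc 1 n,
      0 < (lam k - ((n : ℂ) + k) + 2).re ∧ 0 < (sig k - lam k - ((n : ℂ) - k)).re) →
    IntegralEq ((realDomain n).indicator (realIntegrand n lam sig)) volume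
      (∏ k ∈ Finset.Icc 1 n, (Real.pi : ℂ) ^ (2 * k - 2) *
          ((Complex.Gamma (lam k - ((n : ℂ) + k) + 2) *
            Complex.Gamma (sig k - lam k - ((n : ℂ) - k))) /
            Complex.Gamma (sig k - 2 * ((n : ℂ) - k)))) := by
  induction n with
  | zero =>
    intro lam sig _ _ _
    have e : (realDomain 0).indicator (realIntegrand 0 lam sig) = fun _ => 1 := by
      ext x
      have hx : x ∈ realDomain 0 := Matrix.PosDef.of_dotProduct_mulVec_pos (realT_isHermitian x)
        fun y hy => absurd (Subsingleton.elim y 0) hy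
      rw [Set.indicator_of_mem hx, realIntegrand_eq_exp, ← logDet_leadBlock_self]
      simp [powExponent, logDet_leadBlock_zero]
    rw [e]
    exact ⟨integrable_const _, by simp⟩
  | succ n ih =>
    intro lam sig hlam hsig hk
    have hlast := hk (n + 1) (by simp)
    have e1 : lam (n + 1) - (((n + 1 : ℕ) : ℂ) + ((n + 1 : ℕ) : ℂ)) + 2 = lam (n + 1) - 2 * n := by
      push_cast; ring
    rw [e1, sub_self, sub_zero] at hlast
    have h := integralEq_real_succ hlam hsig hlast.1 hlast.2
      (ih _ _ (shiftParam_succ _ _ _) (shiftParam_succ _ _ _) fun k hkn => ?_)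
    · convert h using 1
      rw [Finset.prod_Icc_succ_top (by lia)]
      congr 1
      · refine Finset.prod_congr rfl fun k hkn => ?_
        have hkn' := (Finset.mem_Icc.1 hkn).2
        rw [shiftParam_of_le _ _ hkn', shiftParam_of_le _ _ hkn']
        have a1 : lam k - 1 - ((n : ℂ) + k) + 2 = lam k - (((n + 1 : ℕ) : ℂ) + k) + 2 := by
          push_cast; ring
        have a2 : sig k - 2 - (lam k - 1) - ((n : ℂ) - k) =
            sig k - lam k - (((n + 1 : ℕ) : ℂ) - k) := by push_cast; ring
        have a3 : sig k - 2 - 2 * ((n : ℂ) - k) = sig k - 2 * (((n + 1 : ℕ) : ℂ) - k) := by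
          push_cast; ring
        rw [a1, a2, a3]
      · rw [stepConst, Module.finrank_self, Fintype.card_prod, Fintype.card_fin, Fintype.card_fin,
          e1, sub_self, sub_zero, mul_zero, sub_zero]
        have e2 : 2 * (n + 1) - 2 = 1 * (n * 2) := by lia
        rw [e2]
        push_cast
        ring_nf
    · have hkn' := (Finset.mem_Icc.1 hkn).2
      have := hk k (Finset.mem_Icc.2 ⟨(Finset.mem_Icc.1 hkn).1, by lia⟩)
      rw [shiftParam_of_le _ _ hkn', shiftParam_of_le _ _ hkn']
      convert this using 3 <;> push_cast <;> ring

end Recursion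

/-! ### The complex case -/

section ComplexCase

variable {n : ℕ}

/-- The complex domain of integration. -/
def cplxDomain (n : ℕ) : Set (CplxCoord n) := {x | (cplxT x).PosDef}

theorem cplxDomain_eq : {x : CplxCoord n | cplxT x + cplxS x ∈ wedge n ℂ} = cplxDomain n :=
  Set.ext fun x => mem_wedge_iff (cplxT_isHermitian x) (cplxS_antiHermitian x)
    (selfAdj_cplxT_add_cplxS x)

theorem mem_cplxDomain_succ (x : CplxCoord (n + 1)) : x ∈ cplxDomain (n + 1) ↔
    cplxPrev x ∈ cplxDomain n ∧
      0 < schurT (cplxT (cplxPrev x)) (cplxLast x).1.1.1 (cplxLast x).1.2 := by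
  have h := posDef_succ_iff (cplxT_isHermitian x) (selfAdj_cplxT x) (cplxT_last x)
  rwa [restr_cplxT, lastCol_cplxT] at h

theorem cplxIntegrand_eq_exp (lam sig tau : ℕ → ℂ) (x : CplxCoord n) :
    cplxIntegrand n lam sig tau x = Complex.exp
      (powExponent n lam (fun j => logDet (leadBlock j (cplxT x))) -
        (powExponent n sig (fun j => logDet (leadBlock j (1 + cplxT x + cplxS x))) +
          powExponent n tau
            (fun j => (starRingEnd ℂ) (logDet (leadBlock j (1 + cplxT x + cplxS x))))) -
        (2 * (n : ℂ) - 1) * logDet (cplxT x)) := by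
  rw [cplxIntegrand, Finset.prod_div_distrib]
  simp only [detPow, detPowPair]
  rw [← Complex.exp_sum, ← Complex.exp_sum, ← Complex.exp_sub, ← Complex.exp_add, neg_mul,
    ← sub_eq_add_neg, Finset.sum_add_distrib]
  rfl

theorem stepDet_cplx {T S : Matrix (BlockIdx n) (BlockIdx n) ℂ} (hT : T.PosDef) (hS : Sᴴ = -S) :
    (stepDet T S : ℂ) = Complex.exp
      (logDet T + logDet (1 + T + S) + (starRingEnd ℂ) (logDet (1 + T + S))) := by
  have hTp := fun x hx => reForm_pos_of_posDef hT (x := x) hx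
  have hPp := reForm_one_add_add_pos hT hS
  rw [Complex.exp_add, Complex.exp_add, Complex.exp_conj, exp_logDet hTp, exp_logDet hPp,
    mul_assoc, Complex.mul_conj, Complex.normSq_eq_norm_sq, stepDet, Complex.finrank_real_complex,
    det_eq_ofReal_re hT]
  simp

/-- Now `stepDet` is `det T |det (1+T+S)|²`, so `λ`, `σ` and `τ` are all shifted by `2`, and the
exponent of `u` is `λ_{n+1} - 2(2n+1)`. -/
theorem cplxIntegrand_succ {lam sig tau : ℕ → ℂ} (hlam : lam (n + 2) = 0) (hsig : sig (n + 2) = 0)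
    (htau : tau (n + 2) = 0) {x : CplxCoord (n + 1)} (hx : x ∈ cplxDomain (n + 1)) :
    cplxIntegrand (n + 1) lam sig tau x =
      cplxIntegrand n (shiftParam n 2 lam) (shiftParam n 2 sig) (shiftParam n 2 tau) (cplxPrev x) *
        ((stepDet (cplxT (cplxPrev x)) (cplxS (cplxPrev x)) : ℂ)⁻¹ *
          cplxKernel (lam (n + 1) - 2 * (2 * n + 1)) (sig (n + 1)) (tau (n + 1))
            (cplxT (cplxPrev x)) (cplxS (cplxPrev x)) (cplxLast x)) := by
  obtain ⟨hprev, hu⟩ := (mem_cplxDomain_succ x).1 hx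
  have hTx : (cplxT x).PosDef := hx
  have hSx := cplxS_antiHermitian x
  have hPx := reForm_one_add_add_pos hTx hSx
  have hJP : SelfAdj (1 + cplxT x + cplxS x) := by
    rw [add_assoc]; exact SelfAdj.one.add (selfAdj_cplxT_add_cplxS x)
  set T := cplxT (cplxPrev x) with hT
  set S := cplxS (cplxPrev x) with hS
  have hc := schurCompl_one_add_add (cplxT_isHermitian x) hSx
  rw [cplxT_last, cplxS_last, restr_cplxT, restr_cplxS, lastCol_cplxT, lastCol_cplxS,
    Prod.mk.eta, ← hT, ← hS] at hc
  have hcpos := one_le_re_schurForm (T := T) (S := S) hprev (cplxS_antiHermitian _)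
    (cplxLast x).1 hu
  rw [RCLike.re_eq_complex_re] at hcpos
  set c : ℂ := ((1 + (cplxLast x).1.2 - RCLike.re (schurForm T S (cplxLast x).1.1) : ℝ) : ℂ) +
      (((cplxLast x).2 - RCLike.im (schurForm T S (cplxLast x).1.1) : ℝ) : ℂ) * Complex.I with hcdef
  have hcc : schurCompl (1 + cplxT x + cplxS x) 0 0 = c := by
    rw [hc, hcdef]
    apply Complex.ext <;> simp
  have hcre : 0 < c.re := by
    rw [hcdef]
    simpa using hcpos
  have hc0 : c ≠ 0 := fun h => by simp [h] at hcre
  -- Off the branch cut, conjugation commutes with the logarithm; this identifies the power of `c̄`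
  -- in `cpowPair` with the conjugated logarithm in `detPowPair`.
  have hcarg : c.arg ≠ Real.pi := fun h => by
    have := (Complex.arg_eq_pi_iff.1 h).1
    linarith
  have hsT := schurCompl_hermitian (t := (cplxLast x).1.2) (cplxT_isHermitian x) (cplxT_last x)
  rw [restr_cplxT, lastCol_cplxT, ← hT] at hsT
  have rT : restr (cplxT x) = T := restr_cplxT x
  have rP : restr (1 + cplxT x + cplxS x) = 1 + T + S := by
    rw [restr_add, restr_add, restr_one, restr_cplxT, restr_cplxS]
  have lT := logDet_succ (selfAdj_cplxT x) (fun z hz => reForm_pos_of_posDef hTx hz)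
  have lP := logDet_succ hJP hPx
  rw [rT, hsT] at lT
  rw [rP, hcc] at lP
  rw [cplxIntegrand_eq_exp, cplxIntegrand_eq_exp, stepDet_cplx hprev (cplxS_antiHermitian _),
    ← hT, ← hS, cplxKernel, posCpow_of_pos _ hu, ← hcdef, cpowPair,
    powExponent_succ (L := fun j => logDet (leadBlock j T)) 2 hlam
      (logDet_leadBlock_zero _) (fun j hj => by rw [logDet_leadBlock_restr hj, rT])
      (by rw [logDet_leadBlock_self, logDet_leadBlock_self, lT]),
    powExponent_succ (L := fun j => logDet (leadBlock j (1 + T + S))) 2 hsig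
      (logDet_leadBlock_zero _) (fun j hj => by rw [logDet_leadBlock_restr hj, rP])
      (by rw [logDet_leadBlock_self, logDet_leadBlock_self, lP]),
    powExponent_succ (L := fun j => (starRingEnd ℂ) (logDet (leadBlock j (1 + T + S)))) 2 htau
      (by rw [logDet_leadBlock_zero, map_zero])
      (fun j hj => by rw [logDet_leadBlock_restr hj, rP])
      (ℓ := (starRingEnd ℂ) (Complex.log c))
      (by rw [logDet_leadBlock_self, logDet_leadBlock_self, lP, map_add, map_mul, map_ofNat]),
    logDet_leadBlock_self, logDet_leadBlock_self, lT,
    Complex.cpow_def_of_ne_zero (by exact_mod_cast hu.ne'),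
    Complex.cpow_def_of_ne_zero hc0, Complex.cpow_def_of_ne_zero ((map_ne_zero _).2 hc0),
    Complex.log_conj _ hcarg, ← Complex.exp_neg,
    ← Complex.exp_add, ← Complex.exp_add, ← Complex.exp_add, ← Complex.exp_add]
  congr 1
  push_cast
  simp only [Complex.coe_algebraMap]
  ring

set_option synthInstance.maxSize 1000 in
theorem measurableSet_cplxDomain : MeasurableSet (cplxDomain n) :=
  measurableSet_posDef continuous_cplxT cplxT_isHermitian

theorem indicator_cplxIntegrand_succ {lam sig tau : ℕ → ℂ} (hlam : lam (n + 2) = 0)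
    (hsig : sig (n + 2) = 0) (htau : tau (n + 2) = 0) (x : CplxCoord (n + 1)) :
    (cplxDomain (n + 1)).indicator (cplxIntegrand (n + 1) lam sig tau) x =
      (cplxDomain n).indicator (cplxIntegrand n (shiftParam n 2 lam) (shiftParam n 2 sig)
        (shiftParam n 2 tau)) (cplxPrev x) *
        ((stepDet (cplxT (cplxPrev x)) (cplxS (cplxPrev x)) : ℂ)⁻¹ *
          cplxKernel (lam (n + 1) - 2 * (2 * n + 1)) (sig (n + 1)) (tau (n + 1))
            (cplxT (cplxPrev x)) (cplxS (cplxPrev x)) (cplxLast x)) := by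
  by_cases hx : x ∈ cplxDomain (n + 1)
  · rw [Set.indicator_of_mem hx, Set.indicator_of_mem ((mem_cplxDomain_succ x).1 hx).1,
      cplxIntegrand_succ hlam hsig htau hx]
  · rw [Set.indicator_of_notMem hx]
    by_cases hp : cplxPrev x ∈ cplxDomain n
    · have hu : ¬0 < schurT (cplxT (cplxPrev x)) (cplxLast x).1.1.1 (cplxLast x).1.2 := fun h =>
        hx ((mem_cplxDomain_succ x).2 ⟨hp, h⟩)
      rw [cplxKernel, posCpow_of_nonpos _ hu]
      simp
    · rw [Set.indicator_of_notMem hp, zero_mul]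

set_option synthInstance.maxSize 1000 in
theorem integralEq_cplx_succ {lam sig tau : ℕ → ℂ} (hlam : lam (n + 2) = 0)
    (hsig : sig (n + 2) = 0) (htau : tau (n + 2) = 0) (h1 : 0 < (lam (n + 1) - 4 * n - 1).re)
    (h2 : 0 < (sig (n + 1) + tau (n + 1) - lam (n + 1)).re) {c : ℂ}
    (ih : IntegralEq ((cplxDomain n).indicator (cplxIntegrand n (shiftParam n 2 lam)
      (shiftParam n 2 sig) (shiftParam n 2 tau))) volume c) :
    IntegralEq ((cplxDomain (n + 1)).indicator (cplxIntegrand (n + 1) lam sig tau)) volume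
      (c * (stepConst ℂ (BlockIdx n) (lam (n + 1) - 2 * (2 * n + 1))
        (sig (n + 1) + tau (n + 1) - 1) * cauchyConst (sig (n + 1)) (tau (n + 1)))) := by
  set b : ℂ := lam (n + 1) - 2 * (2 * n + 1) with hbdef
  set σ : ℂ := sig (n + 1)
  set τ : ℂ := tau (n + 1)
  have hre : b.re = (lam (n + 1) - 4 * n - 1).re - 1 := by
    rw [← Complex.one_re, ← Complex.sub_re, hbdef]
    congr 1
    ring
  have hb : -1 < b.re := by linarith
  have hσ : b.re + 1 + (Module.finrank ℝ ℂ * Fintype.card (BlockIdx n) : ℕ) < (σ + τ - 1).re := by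
    rw [hre, Complex.finrank_real_complex, Fintype.card_prod, Fintype.card_fin, Fintype.card_fin]
    simp only [Complex.sub_re, Complex.add_re, Complex.mul_re, Complex.natCast_re,
      Complex.natCast_im, Complex.re_ofNat, Complex.im_ofNat, Complex.one_re] at h2 ⊢
    push_cast
    linarith
  have hm : Measurable (Function.uncurry fun (y : CplxCoord n)
      (z : (((BlockIdx n → ℂ) × (BlockIdx n → ℂ)) × ℝ) × ℝ) =>
      (stepDet (cplxT y) (cplxS y) : ℂ)⁻¹ * cplxKernel b σ τ (cplxT y) (cplxS y) z) :=
    ((Complex.measurable_ofReal.comp ((measurable_stepDet continuous_cplxT continuous_cplxS).comp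
      measurable_fst)).inv).mul (measurable_cplxKernel continuous_cplxT continuous_cplxS _ _ _)
  have hdom : ∀ y : CplxCoord n, (cplxDomain n).indicator (cplxIntegrand n (shiftParam n 2 lam)
      (shiftParam n 2 sig) (shiftParam n 2 tau)) y ≠ 0 → (cplxT y).PosDef :=
    fun y hy => by
      have : y ∈ cplxDomain n := Set.mem_of_indicator_ne_zero hy
      exact this
  have h := (ih.mul_kernel (ν := volume) (d := stepConst ℂ (BlockIdx n) b (σ + τ - 1) *
    cauchyConst σ τ) (B := ‖stepConst ℂ (BlockIdx n) (b.re : ℂ) ((σ + τ - 1).re : ℂ)‖ *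
      cauchyBound σ τ) hm
    (fun y hy => by
      have hd := stepDet_pos (hdom y hy) (cplxS_antiHermitian y)
      have := (integralEq_cplxKernel (hdom y hy) (cplxS_antiHermitian y) hb hσ).1.const_mul
        ((stepDet (cplxT y) (cplxS y) : ℂ)⁻¹)
      rwa [inv_mul_cancel_left₀ (by exact_mod_cast hd.ne')] at this)
    (fun y hy => by
      have hd := stepDet_pos (hdom y hy) (cplxS_antiHermitian y)
      simp only [norm_mul, norm_inv, Complex.norm_real]
      rw [integral_const_mul, Real.norm_of_nonneg hd.le, inv_mul_le_iff₀ hd]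
      exact (integralEq_cplxKernel (hdom y hy) (cplxS_antiHermitian y) hb
        hσ).2)).comp_measurePreserving measurePreserving_cplxSplit
  convert h using 1
  exact funext fun x => indicator_cplxIntegrand_succ hlam hsig htau x

/-- The factor `Γ(σ+τ-1)` of Cauchy's integral cancels the denominator of the column integral; the
conditions give `Re (σ+τ-1) > 4n`, so it is nonzero. -/
theorem stepConst_mul_cauchyConst {lam σ τ : ℂ} (h1 : 0 < (lam - 4 * n - 1).re)
    (h2 : 0 < (σ + τ - lam).re) :
    stepConst ℂ (BlockIdx n) (lam - 2 * (2 * n + 1)) (σ + τ - 1) * cauchyConst σ τ =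
      (2 : ℂ) ^ (2 - σ - τ) * (Real.pi : ℂ) ^ (4 * n + 1) *
        ((Complex.Gamma (lam - 4 * n - 1) * Complex.Gamma (σ + τ - lam)) /
          (Complex.Gamma σ * Complex.Gamma τ)) := by
  have hΓ : Complex.Gamma (σ + τ - 1) ≠ 0 := by
    refine Complex.Gamma_ne_zero_of_re_pos ?_
    have hn : (0 : ℝ) ≤ n := Nat.cast_nonneg n
    simp only [Complex.sub_re, Complex.add_re, Complex.mul_re, Complex.natCast_re,
      Complex.natCast_im, Complex.re_ofNat, Complex.im_ofNat, Complex.one_re] at h1 h2 ⊢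
    linarith
  have e1 : lam - 2 * (2 * n + 1) + 1 = lam - 4 * n - 1 := by ring
  have e2 : (2 : ℂ) ^ (2 - σ - τ) = 2 * 2 ^ (1 - σ - τ) := by
    rw [show 2 - σ - τ = 1 + (1 - σ - τ) by ring, Complex.cpow_add _ _ two_ne_zero,
      Complex.cpow_one]
  have e3 : 2 * (n * 2) = 4 * n := by ring
  rw [stepConst, cauchyConst, Complex.finrank_real_complex, Fintype.card_prod, Fintype.card_fin,
    Fintype.card_fin, e1, e2, e3, pow_succ]
  have e4 : σ + τ - 1 - (lam - 4 * n - 1 + ((4 * n : ℕ) : ℂ)) = σ + τ - lam := by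
    push_cast; ring
  rw [e4]
  push_cast
  field_simp

/-- A common shift of all parameters by `2` compensates `n + 1 → n` in every Gamma argument and in
the exponent of `2`, so the factors with `k ≤ n` are those of the previous rank. -/
theorem integralEq_cplx (n : ℕ) : ∀ lam sig tau : ℕ → ℂ, lam (n + 1) = 0 → sig (n + 1) = 0 →
    tau (n + 1) = 0 →
    (∀ k ∈ Finset.Icc 1 n,
      0 < (lam k - 2 * ((n : ℂ) + k) + 3).re ∧
        0 < (sig k + tau k - lam k - 2 * ((n : ℂ) - k)).re) →
    IntegralEq ((cplxDomain n).indicator (cplxIntegrand n lam sig tau)) volume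
      (∏ k ∈ Finset.Icc 1 n, (2 : ℂ) ^ (2 + 4 * ((n : ℂ) - k) - sig k - tau k) *
          (Real.pi : ℂ) ^ (4 * k - 3) *
          ((Complex.Gamma (lam k - 2 * ((n : ℂ) + k) + 3) *
            Complex.Gamma (sig k + tau k - lam k - 2 * ((n : ℂ) - k))) /
            (Complex.Gamma (sig k - 2 * ((n : ℂ) - k)) *
              Complex.Gamma (tau k - 2 * ((n : ℂ) - k))))) := by
  induction n with
  | zero =>
    intro lam sig tau _ _ _ _
    have e : (cplxDomain 0).indicator (cplxIntegrand 0 lam sig tau) = fun _ => 1 := by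
      ext x
      have hx : x ∈ cplxDomain 0 := Matrix.PosDef.of_dotProduct_mulVec_pos (cplxT_isHermitian x)
        fun y hy => absurd (Subsingleton.elim y 0) hy
      rw [Set.indicator_of_mem hx, cplxIntegrand_eq_exp, ← logDet_leadBlock_self]
      simp [powExponent, logDet_leadBlock_zero]
    rw [e]
    exact ⟨integrable_const _, by simp⟩
  | succ n ih =>
    intro lam sig tau hlam hsig htau hk
    have hlast := hk (n + 1) (by simp)
    have e1 : lam (n + 1) - 2 * (((n + 1 : ℕ) : ℂ) + ((n + 1 : ℕ) : ℂ)) + 3 =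
        lam (n + 1) - 4 * n - 1 := by
      push_cast; ring
    rw [e1, sub_self, mul_zero, sub_zero] at hlast
    have h := integralEq_cplx_succ hlam hsig htau hlast.1 hlast.2
      (ih _ _ _ (shiftParam_succ _ _ _) (shiftParam_succ _ _ _) (shiftParam_succ _ _ _)
        fun k hkn => ?_)
    · convert h using 1
      rw [Finset.prod_Icc_succ_top (by lia)]
      congr 1
      · refine Finset.prod_congr rfl fun k hkn => ?_
        have hkn' := (Finset.mem_Icc.1 hkn).2
        rw [shiftParam_of_le _ _ hkn', shiftParam_of_le _ _ hkn', shiftParam_of_le _ _ hkn']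
        have a0 : 2 + 4 * ((n : ℂ) - k) - (sig k - 2) - (tau k - 2) =
            2 + 4 * (((n + 1 : ℕ) : ℂ) - k) - sig k - tau k := by push_cast; ring
        have a1 : lam k - 2 - 2 * ((n : ℂ) + k) + 3 =
            lam k - 2 * (((n + 1 : ℕ) : ℂ) + k) + 3 := by push_cast; ring
        have a2 : sig k - 2 + (tau k - 2) - (lam k - 2) - 2 * ((n : ℂ) - k) =
            sig k + tau k - lam k - 2 * (((n + 1 : ℕ) : ℂ) - k) := by push_cast; ring
        have a3 : sig k - 2 - 2 * ((n : ℂ) - k) = sig k - 2 * (((n + 1 : ℕ) : ℂ) - k) := by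
          push_cast; ring
        have a4 : tau k - 2 - 2 * ((n : ℂ) - k) = tau k - 2 * (((n + 1 : ℕ) : ℂ) - k) := by
          push_cast; ring
        rw [a0, a1, a2, a3, a4]
      · have e2 : 4 * (n + 1) - 3 = 4 * n + 1 := by lia
        rw [stepConst_mul_cauchyConst hlast.1 hlast.2, e1, e2, sub_self, mul_zero, mul_zero,
          sub_zero, sub_zero, sub_zero, add_zero]
    · have hkn' := (Finset.mem_Icc.1 hkn).2
      have := hk k (Finset.mem_Icc.2 ⟨(Finset.mem_Icc.1 hkn).1, by lia⟩)
      rw [shiftParam_of_le _ _ hkn', shiftParam_of_le _ _ hkn', shiftParam_of_le _ _ hkn']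
      convert this using 3 <;> push_cast <;> ring

end ComplexCase

/-! ### Conclusion -/

theorem IntegralEq.of_indicator {α : Type*} [MeasurableSpace α] {μ : Measure α} {f : α → ℂ}
    {s : Set α} (hs : MeasurableSet s) {c : ℂ} (h : IntegralEq (s.indicator f) μ c) :
    IntegrableOn f s μ ∧ ∫ x in s, f x ∂μ = c :=
  ⟨(integrable_indicator_iff hs).1 h.1, by rw [← integral_indicator hs, h.2]⟩

theorem mainTheorem6 (n : ℕ) (lam sig tau : ℕ → ℂ)
    (hlam : lam (n + 1) = 0) (hsig : sig (n + 1) = 0) (htau : tau (n + 1) = 0) :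
    -- the space O(2n,ℂ)/O(2n)
    ((∀ k ∈ Finset.Icc 1 n,
        0 < (lam k - ((n : ℂ) + k) + 2).re ∧ 0 < (sig k - lam k - ((n : ℂ) - k)).re) →
      MeasureTheory.IntegrableOn (realIntegrand n lam sig)
        {x | realT x + realS x ∈ wedge n ℝ} ∧
      ∫ x in {x : RealCoord n | realT x + realS x ∈ wedge n ℝ}, realIntegrand n lam sig x =
        ∏ k ∈ Finset.Icc 1 n, (Real.pi : ℂ) ^ (2 * k - 2) *
          ((Complex.Gamma (lam k - ((n : ℂ) + k) + 2) *
            Complex.Gamma (sig k - lam k - ((n : ℂ) - k))) /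
            Complex.Gamma (sig k - 2 * ((n : ℂ) - k)))) ∧
    -- the space SO*(4n)/U(2n)
    ((∀ k ∈ Finset.Icc 1 n,
        0 < (lam k - 2 * ((n : ℂ) + k) + 3).re ∧
          0 < (sig k + tau k - lam k - 2 * ((n : ℂ) - k)).re) →
      MeasureTheory.IntegrableOn (cplxIntegrand n lam sig tau)
        {x | cplxT x + cplxS x ∈ wedge n ℂ} ∧
      ∫ x in {x : CplxCoord n | cplxT x + cplxS x ∈ wedge n ℂ}, cplxIntegrand n lam sig tau x =
        ∏ k ∈ Finset.Icc 1 n, (2 : ℂ) ^ (2 + 4 * ((n : ℂ) - k) - sig k - tau k) *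
          (Real.pi : ℂ) ^ (4 * k - 3) *
          ((Complex.Gamma (lam k - 2 * ((n : ℂ) + k) + 3) *
            Complex.Gamma (sig k + tau k - lam k - 2 * ((n : ℂ) - k))) /
            (Complex.Gamma (sig k - 2 * ((n : ℂ) - k)) *
              Complex.Gamma (tau k - 2 * ((n : ℂ) - k))))) := by
  rw [realDomain_eq, cplxDomain_eq]
  exact ⟨fun h => (integralEq_real n lam sig hlam hsig h).of_indicator
      (measurableSet_posDef continuous_realT realT_isHermitian),
    fun h => (integralEq_cplx n lam sig tau hlam hsig htau h).of_indicator
      measurableSet_cplxDomain⟩
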